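/- Let $\mathcal C$ be an Abelian braided monoidal category with unit $\underline 1$ and braiding $\Psi$ such that all functors $Z\otimes-$ and $-\otimes Z$ are right exact, and let $\overline{\mathcal C}$ be the same monoidal category with the inverse braiding. (Associativity constraints are suppressed.) Compositions below are written right to left. **Graded and filtered structures.** A graded (filtered) space is a family $(F_n)_{n\ge 0}$ of objects of $\mathcal C$ (a functor $(\mathbb N,\le)\to\mathcal C$, $n\mapsto F_n$). On such spaces an algebra is given by morphisms $\eta:\underline 1\to F_0$, $\mu_{m,n}:F_m\otimes F_n\to F_{m+n}$; a coalgebra by $\Delta_n:F_n\to F_n\otimes F_n$, $\epsilon_n:F_n\to\underline 1$; a pairing by $\rho_{m,n}:F_m\otimes F_n\to\underline 1$; an antipode by $S_n:F_n\to F_n$; all compatible with the transition morphisms in the filtered case, with the usual axioms (in the filtered case the antipode axiom $\mu_{n,n}(S_n\otimes\mathrm{id})\Delta_n=\eta\epsilon_n=\mu_{n,n}(\mathrm{id}\otimes S_n)\Delta_n$ is an equality of morphisms $F_n\to F_{2n}$). For pairings put $\rho\cdot\rho'=(\rho\otimes\rho')(\mathrm{id}\otimes\Psi\otimes\mathrm{id})(\Delta\otimes\Delta)$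 and $\rho\,\widetilde\cdot\,\rho'=\rho(\mathrm{id}\otimes\rho'\otimes\mathrm{id})(\Delta\otimes\Delta)$, both with unit $\epsilon\otimes\epsilon$. A coquasitriangular bialgebra $(A,\overline A,\rho)$ consists of bialgebras $A$ in $\mathcal C$ and $\overline A$ in $\overline{\mathcal C}$ with the same underlying coalgebra and multiplications $\mu,\overline\mu$, and a bialgebra pairing $\rho:\overline A^{\rm op}\otimes A\to\underline 1$, where $\overline A^{\rm op}$ has the multiplication $\overline\mu^{\rm op}=\overline\mu\,\Psi$; that is, $$\rho(\overline\mu^{\rm op}\otimes\mathrm{id})=\rho(\mathrm{id}\otimes\rho\otimes\mathrm{id})(\mathrm{id}\otimes\mathrm{id}\otimes\Delta),\qquad \rho(\mathrm{id}\otimes\mu)=\rho(\mathrm{id}\otimes\rho\otimes\mathrm{id})(\Delta\otimes\mathrm{id}\otimes\mathrm{id}),$$ $\rho(\overline\eta\otimes\mathrm{id})=\epsilon=\rho(\mathrm{id}\otimes\eta)$, such that $\rho$ is invertible for $\cdot$ and $$(\overline\mu^{\rm op}\otimes\rho)(\mathrm{id}\otimes\Psi\otimes\mathrm{id})(\Delta\otimes\Delta)=(\rho\otimes\mu)(\mathrm{id}\otimes\Psi\otimes\mathrm{id})(\Delta\otimes\Delta).$$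 It is a dual quantum braided group (coquasitriangular Hopf algebra) if $A$ and $\overline A$ have antipodes. **Data.** Let $X$ be an object with left dual ${}^\vee\!X$, with $\cup:{}^\vee\!X\otimes X\to\underline 1$ and $\cap:\underline 1\to X\otimes{}^\vee\!X$; write also $\cup,\cap$ for the nested duality between ${}^\vee\!X^{\otimes n}$ and $X^{\otimes n}$, and ${}^\vee\!f$ for the dual of a morphism $f$. Let $R:X\otimes X\to X\otimes X$ be an invertible solution of the braid equation such that $(\cup\otimes X\otimes{}^\vee\!X)({}^\vee\!X\otimes R\otimes{}^\vee\!X)({}^\vee\!X\otimes X\otimes\cap)$ is invertible, with inverse $R_{X,{}^\vee\!X}$. Let $R_{X^{\otimes m},X^{\otimes n}}$ and $R_{X^{\otimes m},{}^\vee\!X^{\otimes n}}$ be the extensions by the hexagon identities. Let $A(X)$ be the graded bialgebra $A_n={}^\vee\!X^{\otimes n}\otimes X^{\otimes n}$ with $\mu_{m,n}=\Psi_{A_m,{}^\vee\!X^{\otimes n}}\otimes X^{\otimes n}$, $\Delta_n={}^\vee\!X^{\otimes n}\otimes\cap\otimes X^{\otimes n}$, $\epsilon_n=\cup$, and let $\overline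 A(X)$ be the same construction in $\overline{\mathcal C}$. Let $$\rho_{m,n}=\cup\,({}^\vee\!X^{\otimes m}\otimes\cup\otimes X^{\otimes m})\,(\mathrm{id}\otimes R_{X^{\otimes m},X^{\otimes n}})\,({}^\vee\!X^{\otimes m}\otimes\Psi_{X^{\otimes m},{}^\vee\!X^{\otimes n}}\otimes X^{\otimes n}):A_m\otimes A_n\to\underline 1 .$$ $A(X,R)$ is the graded quotient of $A(X)$ by the ideal generated by the relation ${}^\vee\!R\otimes\mathrm{id}=\mathrm{id}\otimes R$ on $A_2$, and $\overline A(X,R^{-1})$ is the quotient of $\overline A(X)$ by the ideal generated by the same relation for $R^{-1}$. Given a duality $C$ of $X$ with itself (pairing $C:X\otimes X\to\underline 1$ and copairing $\underline 1\to X\otimes X$) whose pairing is compatible with $R$, i.e. $(C\otimes X)R_{X,X\otimes X}=X\otimes C$ and $(X\otimes C)R_{X\otimes X,X}=C\otimes X$, let ${}^\vee C:{}^\vee\!X\otimes{}^\vee\!X\to\underline 1$ be the dual of the copairing. Then $A(X,R;C)$ is the quotient of the filtered algebra $\bigl(\bigoplus_{k\le n}A_k\bigr)_n$ by the ideal generated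 by the above relation and by $(C\otimes\mathrm{id})(\cap\otimes X^{\otimes 2})=\eta\,C$ on $X^{\otimes 2}$ and $(\mathrm{id}\otimes{}^\vee C)({}^\vee\!X^{\otimes 2}\otimes\cap)=\eta\,{}^\vee C$ on ${}^\vee\!X^{\otimes 2}$ (invariance of $C$ and of ${}^\vee C$). Here ideals and quotients are formed in the category of functors $(\mathbb N,\le)\to\mathcal C$: degree $n$ of the ideal generated by relations $f=g$ of filtration degree $2$ is the sum of the images of $a\otimes z\otimes b\mapsto a\,(f-g)(z)\,b$, $a\in A_i$, $b\in A_j$, $i+2+j\le n$. Similarly $\overline A(X,R^{-1};C)$ is a quotient of $\overline A(X)$. **Theorem.** 1. The ideals of $A(X)$ and $\overline A(X)$ defining $A(X,R)$ and $\overline A(X,R^{-1})$ coincide as subobjects, and the structures of $A(X)$ and $\overline A(X)$ and the pairings $\rho_{m,n}$ induce on the quotient a graded coquasitriangular bialgebra $(A(X,R),\overline A(X,R^{-1}),\rho)$. 2. For every $C$ as above, the ideals defining $A(X,R;C)$ and $\overline A(X,R^{-1};C)$ coincide as subobjects, $A(X,R;C)$ is a factor of $A(X,R)$ (the morphisms $A_k\to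 A(X,R;C)_n$, $k\le n$, factor through $A(X,R)_k$), and the same structures induce a filtered dual quantum braided group $(A(X,R;C),\overline A(X,R^{-1};C),\rho)$. 3. In both cases $\rho$ has an inverse $\rho^\sim$ for the second product $\widetilde\cdot$, and it is induced by $$\rho^\sim_{m,n}=(\cup\otimes\cup)\circ\bigl({}^\vee\!X^{\otimes m}\otimes(\Psi^{-1}_{X^{\otimes m},{}^\vee\!X^{\otimes n}}\circ R_{X^{\otimes m},{}^\vee\!X^{\otimes n}})\otimes X^{\otimes n}\bigr):A_m\otimes A_n\to\underline 1,$$ where $\Psi^{-1}_{X^{\otimes m},{}^\vee\!X^{\otimes n}}$ is the inverse of $\Psi_{X^{\otimes m},{}^\vee\!X^{\otimes n}}$. -/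

import Mathlib

open CategoryTheory CategoryTheory.Limits CategoryTheory.MonoidalCategory

universe v u

namespace BraidedFRT

/-! ### Graded and filtered spaces

A space of shape `J` over `C` is a functor `J ⥤ C`. The discrete category `Deg` on `ℕ` gives
graded spaces (families `A 0, A 1, …` of objects) and the ordered set `ℕ` gives filtered spaces
(sequences `A 0 ⟶ A 1 ⟶ …`). Multiplications add degrees, comultiplications are taken
in each degree. -/

/-- Addition as a tensor product on the ordered set `ℕ`. -/
instance natMonoidal : MonoidalCategory ℕ where
  tensorObj m n := m + n
  whiskerLeft m _ _ f := homOfLE (Nat.add_le_add_left (leOfHom f) m)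
  whiskerRight f n := homOfLE (Nat.add_le_add_right (leOfHom f) n)
  tensorUnit := (0 : ℕ)
  associator a b c := eqToIso (Nat.add_assoc a b c)
  leftUnitor a := eqToIso (Nat.zero_add a)
  rightUnitor a := eqToIso (Nat.add_zero a)

instance natBraided : BraidedCategory ℕ where
  braiding a b := eqToIso (Nat.add_comm a b)

/-- The discrete category on `ℕ`. -/
def Deg : Type := Discrete ℕ

instance : SmallCategory Deg := inferInstanceAs (SmallCategory (Discrete ℕ))

/-- The degree `n` as an object of `Deg`. -/
def deg (n : ℕ) : Deg := Discrete.mk n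

/-- Addition as a tensor product on the discrete category `Deg`. -/
instance degMonoidal : MonoidalCategory Deg := Discrete.addMonoidal ℕ

theorem deg_tensor (m n : ℕ) : deg m ⊗ deg n = deg (m + n) := rfl

theorem deg_zero : 𝟙_ Deg = deg 0 := rfl

instance degBraided : BraidedCategory Deg where
  braiding a b := Discrete.eqToIso (Nat.add_comm a.as b.as)
  braiding_naturality_right _ _ _ _ := Subsingleton.elim (α := ULift (PLift _)) _ _
  braiding_naturality_left _ _ := Subsingleton.elim (α := ULift (PLift _)) _ _
  hexagon_forward _ _ _ := Subsingleton.elim (α := ULift (PLift _)) _ _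
  hexagon_reverse _ _ _ := Subsingleton.elim (α := ULift (PLift _)) _ _

section General

variable {C : Type u} [Category.{v} C] [MonoidalCategory C]

/-- The nested pairing: `b` with `e` inside, `a` with `d` outside. -/
def nest {A B D E : C} (a : A ⊗ D ⟶ 𝟙_ C) (b : B ⊗ E ⟶ 𝟙_ C) : (A ⊗ B) ⊗ (E ⊗ D) ⟶ 𝟙_ C :=
  𝟙 ((A ⊗ B) ⊗ (E ⊗ D)) ⊗≫ A ◁ b ▷ D ⊗≫ a

variable {J : Type} [SmallCategory J]

/-- Coalgebra structures on a graded or filtered space: a coalgebra in each degree. -/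
structure Coalg (F : J ⥤ C) where
  comul : ∀ i : J, F.obj i ⟶ F.obj i ⊗ F.obj i
  counit : ∀ i : J, F.obj i ⟶ 𝟙_ C
  comul_natural : ∀ {i j : J} (f : i ⟶ j), F.map f ≫ comul j = comul i ≫ (F.map f ⊗ₘ F.map f)
  counit_natural : ∀ {i j : J} (f : i ⟶ j), F.map f ≫ counit j = counit i
  comul_assoc : ∀ i : J,
    comul i ≫ comul i ▷ F.obj i ≫ (α_ _ _ _).hom = comul i ≫ F.obj i ◁ comul i
  counit_comul : ∀ i : J, comul i ≫ counit i ▷ F.obj i = (λ_ (F.obj i)).inv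
  comul_counit : ∀ i : J, comul i ≫ F.obj i ◁ counit i = (ρ_ (F.obj i)).inv

/-- A morphism `F ⊗ F ⟶ 𝟙`, given on all pairs of degrees. -/
structure Pairing (F : J ⥤ C) where
  app : ∀ i j : J, F.obj i ⊗ F.obj j ⟶ 𝟙_ C
  natural : ∀ {i i' j j' : J} (f : i ⟶ i') (g : j ⟶ j'),
    (F.map f ⊗ₘ F.map g) ≫ app i' j' = app i j

/-- `ε ⊗ ε`. -/
def counitPairing {F : J ⥤ C} (K : Coalg F) (i j : J) : F.obj i ⊗ F.obj j ⟶ 𝟙_ C :=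
  (K.counit i ⊗ₘ K.counit j) ≫ (λ_ (𝟙_ C)).hom

/-- The convolution product `r · s`. -/
def conv [BraidedCategory C] {F : J ⥤ C} (K : Coalg F) (r s : Pairing F) (i j : J) :
    F.obj i ⊗ F.obj j ⟶ 𝟙_ C :=
  (K.comul i ⊗ₘ K.comul j) ≫ tensorμ (F.obj i) (F.obj i) (F.obj j) (F.obj j) ≫
    (r.app i j ⊗ₘ s.app i j) ≫ (λ_ (𝟙_ C)).hom

/-- The second product of `r` and `s`: `s` is applied to the two inner factors and `r` to the two
outer factors of `Δ ⊗ Δ`. -/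
def conv₂ {F : J ⥤ C} (K : Coalg F) (r s : Pairing F) (i j : J) :
    F.obj i ⊗ F.obj j ⟶ 𝟙_ C :=
  (K.comul i ⊗ₘ K.comul j) ≫ nest (r.app i j) (s.app i j)

/-- `s` is the inverse of `r` for the convolution product. -/
def IsConvInverse [BraidedCategory C] {F : J ⥤ C} (K : Coalg F) (r s : Pairing F) : Prop :=
  ∀ i j : J, conv K r s i j = counitPairing K i j ∧ conv K s r i j = counitPairing K i j

/-- `s` is the inverse of `r` for the second product. -/
def IsSecondInverse {F : J ⥤ C} (K : Coalg F) (r s : Pairing F) : Prop :=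
  ∀ i j : J, conv₂ K r s i j = counitPairing K i j ∧ conv₂ K s r i j = counitPairing K i j

variable [MonoidalCategory J]

/-- Algebra structures on a graded or filtered space. -/
structure Alg (F : J ⥤ C) where
  one : 𝟙_ C ⟶ F.obj (𝟙_ J)
  mul : ∀ i j : J, F.obj i ⊗ F.obj j ⟶ F.obj (i ⊗ j)
  mul_natural : ∀ {i i' j j' : J} (f : i ⟶ i') (g : j ⟶ j'),
    (F.map f ⊗ₘ F.map g) ≫ mul i' j' = mul i j ≫ F.map (f ⊗ₘ g)
  mul_assoc : ∀ i j k : J,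
    mul i j ▷ F.obj k ≫ mul (i ⊗ j) k ≫ F.map (α_ i j k).hom =
      (α_ (F.obj i) (F.obj j) (F.obj k)).hom ≫ F.obj i ◁ mul j k ≫ mul i (j ⊗ k)
  one_mul : ∀ i : J,
    one ▷ F.obj i ≫ mul (𝟙_ J) i ≫ F.map (λ_ i).hom = (λ_ (F.obj i)).hom
  mul_one : ∀ i : J,
    F.obj i ◁ one ≫ mul i (𝟙_ J) ≫ F.map (ρ_ i).hom = (ρ_ (F.obj i)).hom

/-- The bialgebra axiom: `Δ` and `ε` are algebra morphisms. -/
structure IsBialg [BraidedCategory C] {F : J ⥤ C} (K : Coalg F) (M : Alg F) : Prop where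
  mul_comul : ∀ i j : J, M.mul i j ≫ K.comul (i ⊗ j) =
    (K.comul i ⊗ₘ K.comul j) ≫ tensorμ (F.obj i) (F.obj i) (F.obj j) (F.obj j) ≫
      (M.mul i j ⊗ₘ M.mul i j)
  mul_counit : ∀ i j : J, M.mul i j ≫ K.counit (i ⊗ j) =
    (K.counit i ⊗ₘ K.counit j) ≫ (λ_ (𝟙_ C)).hom
  one_comul : M.one ≫ K.comul (𝟙_ J) = (λ_ (𝟙_ C)).inv ≫ (M.one ⊗ₘ M.one)
  one_counit : M.one ≫ K.counit (𝟙_ J) = 𝟙 (𝟙_ C)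

/-- The multiplication of the opposite, taken in `C`, of an algebra in the category with
the inverse braiding. -/
def opMul [BraidedCategory C] [BraidedCategory J] {F : J ⥤ C} (M : Alg F) (i j : J) :
    F.obj i ⊗ F.obj j ⟶ F.obj (i ⊗ j) :=
  (β_ (F.obj i) (F.obj j)).hom ≫ M.mul j i ≫ F.map (β_ j i).hom

/-- A coquasitriangular bialgebra in `C` with underlying space `F`: a bialgebra `A` in `C`,
a bialgebra `Ā` in `C` with the inverse braiding, with the same coalgebra, and a
convolution invertible bialgebra pairing `Āᵒᵖ ⊗ A ⟶ 𝟙` which interchanges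
the two multiplications. -/
structure CoquasiBialg [BraidedCategory C] [BraidedCategory J] (F : J ⥤ C) where
  coalg : Coalg F
  alg : Alg F
  algBar : Alg F
  isBialg : IsBialg coalg alg
  isBialgBar : @IsBialg C _ _ J _ _ (reverseBraiding C) F coalg algBar
  pairing : Pairing F
  opMul_pairing : ∀ i j k : J,
    opMul algBar i j ▷ F.obj k ≫ pairing.app (i ⊗ j) k =
      (F.obj i ⊗ F.obj j) ◁ coalg.comul k ≫ nest (pairing.app i k) (pairing.app j k)
  pairing_mul : ∀ i j k : J,
    F.obj i ◁ alg.mul j k ≫ pairing.app i (j ⊗ k) =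
      coalg.comul i ▷ (F.obj j ⊗ F.obj k) ≫ nest (pairing.app i k) (pairing.app i j)
  one_pairing : ∀ k : J,
    algBar.one ▷ F.obj k ≫ pairing.app (𝟙_ J) k = (λ_ (F.obj k)).hom ≫ coalg.counit k
  pairing_one : ∀ i : J,
    F.obj i ◁ alg.one ≫ pairing.app i (𝟙_ J) = (ρ_ (F.obj i)).hom ≫ coalg.counit i
  invertible : ∃ s : Pairing F, IsConvInverse coalg pairing s
  interchange : ∀ i j : J,
    (coalg.comul i ⊗ₘ coalg.comul j) ≫ tensorμ (F.obj i) (F.obj i) (F.obj j) (F.obj j) ≫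
        (opMul algBar i j ⊗ₘ pairing.app i j) ≫ (ρ_ (F.obj (i ⊗ j))).hom =
      (coalg.comul i ⊗ₘ coalg.comul j) ≫ tensorμ (F.obj i) (F.obj i) (F.obj j) (F.obj j) ≫
        (pairing.app i j ⊗ₘ alg.mul i j) ≫ (λ_ (F.obj (i ⊗ j))).hom

/-- An antipode on a filtered bialgebra: a morphism `S` of filtered spaces with
`μ ∘ (S ⊗ id) ∘ Δ = η ∘ ε = μ ∘ (id ⊗ S) ∘ Δ`, where `η ∘ ε` is followed by the transition
morphism from degree `0`. -/
structure Antipode {F : ℕ ⥤ C} (K : Coalg F) (M : Alg F) where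
  S : F ⟶ F
  antipode_left : ∀ n : ℕ, K.comul n ≫ S.app n ▷ F.obj n ≫ M.mul n n =
    K.counit n ≫ M.one ≫ F.map (homOfLE (Nat.zero_le (n + n)))
  antipode_right : ∀ n : ℕ, K.comul n ≫ F.obj n ◁ S.app n ≫ M.mul n n =
    K.counit n ≫ M.one ≫ F.map (homOfLE (Nat.zero_le (n + n)))

/-- Dual quantum braided groups (coquasitriangular Hopf algebras): both `A` and `Ā`
have antipodes. -/
def IsCoquasiHopf [BraidedCategory C] {F : ℕ ⥤ C} (T : CoquasiBialg F) : Prop :=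
  Nonempty (Antipode T.coalg T.alg) ∧ Nonempty (Antipode T.coalg T.algBar)

/-! ### Tensor powers, duals and braid operators -/

/-- `X^{⊗ n}`. -/
def tpow (X : C) : ℕ → C
  | 0 => 𝟙_ C
  | n + 1 => tpow X n ⊗ X

/-- `D^{⊗ n}`, bracketed so that for `D` dual to `X` it is the dual of `X^{⊗ n}`. -/
def dpow (D : C) : ℕ → C
  | 0 => 𝟙_ C
  | n + 1 => D ⊗ dpow D n

/-- `X^{⊗ m} ⊗ X^{⊗ n} ≅ X^{⊗ (m + n)}`. -/
def tpowAdd (X : C) (m : ℕ) : ∀ n : ℕ, tpow X m ⊗ tpow X n ≅ tpow X (m + n)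
  | 0 => ρ_ (tpow X m)
  | n + 1 => (α_ (tpow X m) (tpow X n) X).symm ≪≫ whiskerRightIso (tpowAdd X m n) X

/-- `D^{⊗ n} ⊗ D^{⊗ m} ≅ D^{⊗ (m + n)}`. -/
def dpowAdd (D : C) (m : ℕ) : ∀ n : ℕ, dpow D n ⊗ dpow D m ≅ dpow D (m + n)
  | 0 => λ_ (dpow D m)
  | n + 1 => α_ D (dpow D n) (dpow D m) ≪≫ whiskerLeftIso D (dpowAdd D m n)

/-- `X ⊗ X ≅ X^{⊗ 2}`. -/
def tpowTwo (X : C) : X ⊗ X ≅ tpow X 2 := whiskerRightIso (λ_ X).symm X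

/-- From `r : X ⊗ Z ⟶ Z ⊗ X` to `X^{⊗ m} ⊗ Z ⟶ Z ⊗ X^{⊗ m}`. -/
def extLeft {X Z : C} (r : X ⊗ Z ⟶ Z ⊗ X) : ∀ m : ℕ, tpow X m ⊗ Z ⟶ Z ⊗ tpow X m
  | 0 => (λ_ Z).hom ≫ (ρ_ Z).inv
  | m + 1 => (α_ (tpow X m) X Z).hom ≫ tpow X m ◁ r ≫ (α_ (tpow X m) Z X).inv ≫
      extLeft r m ▷ X ≫ (α_ Z (tpow X m) X).hom

/-- From `r : W ⊗ Y ⟶ Y ⊗ W` to `W ⊗ Y^{⊗ n} ⟶ Y^{⊗ n} ⊗ W`. -/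
def extRight {W Y : C} (r : W ⊗ Y ⟶ Y ⊗ W) : ∀ n : ℕ, W ⊗ tpow Y n ⟶ tpow Y n ⊗ W
  | 0 => (ρ_ W).hom ≫ (λ_ W).inv
  | n + 1 => (α_ W (tpow Y n) Y).inv ≫ extRight r n ▷ Y ≫ (α_ (tpow Y n) W Y).hom ≫
      tpow Y n ◁ r ≫ (α_ (tpow Y n) Y W).inv

/-- From `r : W ⊗ D ⟶ D ⊗ W` to `W ⊗ D^{⊗ n} ⟶ D^{⊗ n} ⊗ W`. -/
def extRightDual {W D : C} (r : W ⊗ D ⟶ D ⊗ W) : ∀ n : ℕ, W ⊗ dpow D n ⟶ dpow D n ⊗ W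
  | 0 => (ρ_ W).hom ≫ (λ_ W).inv
  | n + 1 => (α_ W D (dpow D n)).inv ≫ r ▷ dpow D n ≫ (α_ D W (dpow D n)).hom ≫
      D ◁ extRightDual r n ≫ (α_ D (dpow D n) W).inv

/-- `R_{X^{⊗ m}, X^{⊗ n}}`, determined by the hexagon identities. -/
def Rpow {X : C} (R : X ⊗ X ⟶ X ⊗ X) (m n : ℕ) :
    tpow X m ⊗ tpow X n ⟶ tpow X n ⊗ tpow X m :=
  extLeft (extRight R n) m

/-- The braid equation. -/
def BraidEq {X : C} (R : X ⊗ X ⟶ X ⊗ X) : Prop :=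
  (α_ X X X).inv ≫ R ▷ X ≫ (α_ X X X).hom ≫ X ◁ R ≫ (α_ X X X).inv ≫ R ▷ X ≫ (α_ X X X).hom =
    X ◁ R ≫ (α_ X X X).inv ≫ R ▷ X ≫ (α_ X X X).hom ≫ X ◁ R

/-- The pairing `c : X ⊗ X ⟶ 𝟙` is compatible with `R`: it flows along the braids `R_{X,-}`
and `R_{-,X}`. -/
def Flows {X : C} (R : X ⊗ X ⟶ X ⊗ X) (c : X ⊗ X ⟶ 𝟙_ C) : Prop :=
  ((α_ X X X).inv ≫ R ▷ X ≫ (α_ X X X).hom ≫ X ◁ R ≫ (α_ X X X).inv ≫ c ▷ X ≫ (λ_ X).hom =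
      X ◁ c ≫ (ρ_ X).hom) ∧
    ((α_ X X X).hom ≫ X ◁ R ≫ (α_ X X X).inv ≫ R ▷ X ≫ (α_ X X X).hom ≫ X ◁ c ≫ (ρ_ X).hom =
      c ▷ X ≫ (λ_ X).hom)

/-- `R` as an endomorphism of `tpow X 2`. -/
def Rtwo {X : C} (R : X ⊗ X ⟶ X ⊗ X) : tpow X 2 ⟶ tpow X 2 :=
  (tpowTwo X).inv ≫ R ≫ (tpowTwo X).hom

variable (X D : C)

/-- `A_n(X) = D^{⊗ n} ⊗ X^{⊗ n}`. -/
def AX (n : ℕ) : C := dpow D n ⊗ tpow X n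

def AX.one : 𝟙_ C ⟶ AX X D 0 := (λ_ (𝟙_ C)).inv

def AX.mul [BraidedCategory C] (m n : ℕ) : AX X D m ⊗ AX X D n ⟶ AX X D (m + n) :=
  (α_ (AX X D m) (dpow D n) (tpow X n)).inv ≫
    (β_ (AX X D m) (dpow D n)).hom ▷ tpow X n ≫
      (α_ (dpow D n) (dpow D m) (tpow X m)).inv ▷ tpow X n ≫
        (α_ (dpow D n ⊗ dpow D m) (tpow X m) (tpow X n)).hom ≫
          ((dpowAdd D m n).hom ⊗ₘ (tpowAdd X m n).hom)

variable {X D} in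
/-- `a ⊗ z ⊗ b ↦ a h(z) b`. -/
def AX.sandwich [BraidedCategory C] {Z : C} {d : ℕ} (h : Z ⟶ AX X D d) (i j : ℕ) :
    (AX X D i ⊗ Z) ⊗ AX X D j ⟶ AX X D (i + d + j) :=
  (AX X D i ◁ h) ▷ AX X D j ≫ AX.mul X D i d ▷ AX X D j ≫ AX.mul X D (i + d) j

variable [ExactPairing X D]

/-- `∪ : D^{⊗ n} ⊗ X^{⊗ n} ⟶ 𝟙`. -/
def ev : ∀ n : ℕ, dpow D n ⊗ tpow X n ⟶ 𝟙_ C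
  | 0 => (λ_ (𝟙_ C)).hom
  | n + 1 => nest (ε_ X D) (ev n)

/-- `∩ : 𝟙 ⟶ X^{⊗ n} ⊗ D^{⊗ n}`. -/
def coev : ∀ n : ℕ, 𝟙_ C ⟶ tpow X n ⊗ dpow D n
  | 0 => (λ_ (𝟙_ C)).inv
  | n + 1 => coev n ≫ tpow X n ◁ (λ_ (dpow D n)).inv ≫ tpow X n ◁ (η_ X D ▷ dpow D n) ≫
      tpow X n ◁ (α_ X D (dpow D n)).hom ≫ (α_ (tpow X n) X (D ⊗ dpow D n)).inv

variable {X} in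
/-- The (left) dual of a morphism between tensor powers of `X`. -/
def dualArrow {m n : ℕ} (f : tpow X m ⟶ tpow X n) : dpow D n ⟶ dpow D m :=
  (ρ_ (dpow D n)).inv ≫ dpow D n ◁ coev X D m ≫ dpow D n ◁ (f ▷ dpow D m) ≫
    (α_ (dpow D n) (tpow X n) (dpow D m)).inv ≫ ev X D n ▷ dpow D m ≫ (λ_ (dpow D m)).hom

variable {X} in
/-- The morphism `D ⊗ X ⟶ X ⊗ D` obtained by rotating `R`; its inverse is `R_{X,D}`. -/
def rotate (R : X ⊗ X ⟶ X ⊗ X) : D ⊗ X ⟶ X ⊗ D :=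
  𝟙 (D ⊗ X) ⊗≫ D ◁ X ◁ η_ X D ⊗≫ D ◁ R ▷ D ⊗≫ ε_ X D ▷ (X ⊗ D) ≫ (λ_ (X ⊗ D)).hom

variable {X} in
/-- `R_{X^{⊗ m}, D^{⊗ n}}`, determined by `R_{X,D}` and the hexagon identities. -/
noncomputable def RDpow (R : X ⊗ X ⟶ X ⊗ X) [IsIso (rotate D R)] (m n : ℕ) :
    tpow X m ⊗ dpow D n ⟶ dpow D n ⊗ tpow X m :=
  extLeft (extRightDual (inv (rotate D R)) n) m

def AX.comul (n : ℕ) : AX X D n ⟶ AX X D n ⊗ AX X D n :=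
  dpow D n ◁ (λ_ (tpow X n)).inv ≫ dpow D n ◁ (coev X D n ▷ tpow X n) ≫
    dpow D n ◁ (α_ (tpow X n) (dpow D n) (tpow X n)).hom ≫
      (α_ (dpow D n) (tpow X n) (dpow D n ⊗ tpow X n)).inv

def AX.counit (n : ℕ) : AX X D n ⟶ 𝟙_ C := ev X D n

variable {X} in
/-- The pairing `ρ_{m,n} : A_m(X) ⊗ A_n(X) ⟶ 𝟙`. -/
def AX.pairing [BraidedCategory C] (R : X ⊗ X ⟶ X ⊗ X) (m n : ℕ) :
    AX X D m ⊗ AX X D n ⟶ 𝟙_ C :=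
  tensorμ (dpow D m) (tpow X m) (dpow D n) (tpow X n) ≫
    (dpow D m ⊗ dpow D n) ◁ Rpow R m n ≫ nest (ev X D m) (ev X D n)

variable {X} in
/-- `(∪ ⊗ ∪) ∘ (id ⊗ Ψ⁻¹ R_{X^{⊗ m}, D^{⊗ n}} ⊗ id) : A_m(X) ⊗ A_n(X) ⟶ 𝟙`. -/
noncomputable def AX.secondInverse [BraidedCategory C] (R : X ⊗ X ⟶ X ⊗ X)
    [IsIso (rotate D R)] (m n : ℕ) : AX X D m ⊗ AX X D n ⟶ 𝟙_ C :=
  𝟙 ((dpow D m ⊗ tpow X m) ⊗ (dpow D n ⊗ tpow X n)) ⊗≫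
    dpow D m ◁ (RDpow D R m n ≫ (β_ (tpow X m) (dpow D n)).inv) ▷ tpow X n ⊗≫
      (ev X D m ⊗ₘ ev X D n) ≫ (λ_ (𝟙_ C)).hom

end General

section Filtered

variable {C : Type u} [Category.{v} C] [Abelian C]

theorem le_kernelSubobject_iff {A B : C} (S : Subobject A) (f : A ⟶ B) :
    S ≤ kernelSubobject f ↔ S.arrow ≫ f = 0 := by
  refine ⟨fun h => ?_, le_kernelSubobject f S⟩
  rw [← Subobject.ofLE_arrow h, Category.assoc, kernelSubobject_arrow_comp, comp_zero]

theorem imageSubobject_le_kernelSubobject_iff {Z A B : C} (g : Z ⟶ A) (f : A ⟶ B) :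
    imageSubobject g ≤ kernelSubobject f ↔ g ≫ f = 0 := by
  constructor
  · intro h
    rw [← imageSubobject_arrow_comp g, Category.assoc, ← Subobject.ofLE_arrow h,
      Category.assoc, kernelSubobject_arrow_comp, comp_zero, comp_zero]
  · intro h
    exact imageSubobject_le g (factorThruKernelSubobject f g h) (by simp)

variable [MonoidalCategory C]

attribute [local instance] Abelian.hasFiniteBiproducts

/-- The filtered space of `A(X)`: degree `n` is `A_0(X) ⊕ … ⊕ A_n(X)`. -/
noncomputable def filtAX (X D : C) (n : ℕ) : C := ⨁ fun k : Fin (n + 1) => AX X D k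

noncomputable def filtIncl (X D : C) {k n : ℕ} (h : k ≤ n) : AX X D k ⟶ filtAX X D n :=
  biproduct.ι (fun k : Fin (n + 1) => AX X D k) ⟨k, Nat.lt_succ_of_le h⟩

/-- `A_0(X) ⊕ … ⊕ A_m(X) ⟶ A_0(X) ⊕ … ⊕ A_n(X)` for `m ≤ n`. -/
noncomputable def filtAXMap (X D : C) {m n : ℕ} (h : m ≤ n) : filtAX X D m ⟶ filtAX X D n :=
  biproduct.desc fun k : Fin (m + 1) => filtIncl X D ((Nat.le_of_lt_succ k.2).trans h)

theorem filtIncl_map (X D : C) {k m n : ℕ} (hk : k ≤ m) (h : m ≤ n) :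
    filtIncl X D hk ≫ filtAXMap X D h = filtIncl X D (hk.trans h) :=
  biproduct.ι_desc _ _

theorem filtAX_hom_ext {X D Z : C} {n : ℕ} {f g : filtAX X D n ⟶ Z}
    (H : ∀ (k : ℕ) (h : k ≤ n), filtIncl X D h ≫ f = filtIncl X D h ≫ g) : f = g :=
  biproduct.hom_ext' _ _ fun k => H k (Nat.le_of_lt_succ k.2)

end Filtered

section Quotients

variable {C : Type u} [Category.{v} C] [Abelian C] [MonoidalCategory C] [BraidedCategory C]
/-- The part in filtration degree `n` of the relation `f = g`, with `f` in degree `2` and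
`g` in degree `0`, multiplied by `A_i(X)` on the left and by `A_j(X)` on the right. -/
noncomputable def inhomRel {X D Z : C} (f : Z ⟶ AX X D 2) (g : Z ⟶ AX X D 0) (i j n : ℕ)
    (h : i + 2 + j ≤ n) : (AX X D i ⊗ Z) ⊗ AX X D j ⟶ filtAX X D n :=
  AX.sandwich f i j ≫ filtIncl X D h -
    AX.sandwich g i j ≫ filtIncl X D (show i + 0 + j ≤ n by omega)

theorem inhomRel_map {X D Z : C} (f : Z ⟶ AX X D 2) (g : Z ⟶ AX X D 0) (i j m n : ℕ)
    (h : i + 2 + j ≤ m) (hmn : m ≤ n) :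
    inhomRel f g i j m h ≫ filtAXMap X D hmn = inhomRel f g i j n (h.trans hmn) := by
  simp only [inhomRel, Preadditive.sub_comp, Category.assoc, filtIncl_map]

variable {X : C} (D : C) [ExactPairing X D]

/-- The difference of the two sides of the FRT relation in `A_2(X)`. -/
def frtRel (R : X ⊗ X ⟶ X ⊗ X) : AX X D 2 ⟶ AX X D 2 :=
  dualArrow D (Rtwo R) ▷ tpow X 2 - dpow D 2 ◁ Rtwo R

open Classical in
/-- Degree `n` of the graded ideal of `A(X)` generated by the FRT relation. -/
noncomputable def frtIdeal (R : X ⊗ X ⟶ X ⊗ X) (n : ℕ) : Subobject (AX X D n) :=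
  (Finset.range (n + 1) ×ˢ Finset.range (n + 1)).sup fun p =>
    if h : p.1 + 2 + p.2 = n then
      imageSubobject (AX.sandwich (frtRel D R) p.1 p.2 ≫ eqToHom (congrArg (AX X D) h))
    else ⊥

/-- The graded space `A(X,R)`. -/
noncomputable def frtSpace (R : X ⊗ X ⟶ X ⊗ X) : Deg ⥤ C :=
  Discrete.functor fun n => cokernel (frtIdeal D R n).arrow

/-- The projection `A_n(X) ⟶ A(X,R)_n`. -/
noncomputable def frtProj (R : X ⊗ X ⟶ X ⊗ X) (n : ℕ) : AX X D n ⟶ (frtSpace D R).obj (deg n) :=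
  cokernel.π (frtIdeal D R n).arrow

/-- `(c ⊗ id) ∘ Δ_r : X^{⊗ 2} ⟶ A_2(X)` for a pairing `c`. -/
def pairingCoaction (c : X ⊗ X ⟶ 𝟙_ C) : tpow X 2 ⟶ AX X D 2 :=
  (λ_ (tpow X 2)).inv ≫
    (coev X D 2 ≫ ((tpowTwo X).inv ≫ c) ▷ dpow D 2 ≫ (λ_ (dpow D 2)).hom) ▷ tpow X 2

/-- `η ∘ c : X^{⊗ 2} ⟶ A_0(X)`. -/
def pairingUnit (c : X ⊗ X ⟶ 𝟙_ C) : tpow X 2 ⟶ AX X D 0 :=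
  ((tpowTwo X).inv ≫ c) ≫ AX.one X D

/-- The pairing `ᵛc : D^{⊗ 2} ⟶ 𝟙` dual to a copairing `k : 𝟙 ⟶ X ⊗ X`. -/
def dualPairing (k : 𝟙_ C ⟶ X ⊗ X) : dpow D 2 ⟶ 𝟙_ C :=
  dualArrow (X := X) (m := 0) (n := 2) D (k ≫ (tpowTwo X).hom)

/-- `(id ⊗ ᵛc) ∘ Δ_ℓ : D^{⊗ 2} ⟶ A_2(X)`. -/
def copairingCoaction (k : 𝟙_ C ⟶ X ⊗ X) : dpow D 2 ⟶ AX X D 2 :=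
  (ρ_ (dpow D 2)).inv ≫
    dpow D 2 ◁ (coev X D 2 ≫ tpow X 2 ◁ dualPairing D k ≫ (ρ_ (tpow X 2)).hom)

/-- `η ∘ ᵛc : D^{⊗ 2} ⟶ A_0(X)`. -/
def copairingUnit (k : 𝟙_ C ⟶ X ⊗ X) : dpow D 2 ⟶ AX X D 0 :=
  dualPairing D k ≫ AX.one X D

open Classical in
/-- Filtration degree `n` of the ideal of `A(X)` generated by the FRT relation and by the
invariance of the pairings `c` and `ᵛc`, for a duality `c` of `X` with itself. -/
noncomputable def filtIdeal (R : X ⊗ X ⟶ X ⊗ X) (c : ExactPairing X X) (n : ℕ) :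
    Subobject (filtAX X D n) :=
  (Finset.range (n + 1) ×ˢ Finset.range (n + 1)).sup fun p =>
    if h : p.1 + 2 + p.2 ≤ n then
      imageSubobject (AX.sandwich (frtRel D R) p.1 p.2 ≫ filtIncl X D h) ⊔
        (imageSubobject (inhomRel (pairingCoaction D c.evaluation')
            (pairingUnit D c.evaluation') p.1 p.2 n h) ⊔
          imageSubobject (inhomRel (copairingCoaction D c.coevaluation')
            (copairingUnit D c.coevaluation') p.1 p.2 n h))
    else ⊥

variable (R : X ⊗ X ⟶ X ⊗ X) (c : ExactPairing X X)

theorem filtIdeal_le_iff {n : ℕ} (S : Subobject (filtAX X D n)) :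
    filtIdeal D R c n ≤ S ↔ ∀ (i j : ℕ) (h : i + 2 + j ≤ n),
      imageSubobject (AX.sandwich (frtRel D R) i j ≫ filtIncl X D h) ≤ S ∧
      imageSubobject (inhomRel (pairingCoaction D c.evaluation')
            (pairingUnit D c.evaluation') i j n h) ≤ S ∧
      imageSubobject (inhomRel (copairingCoaction D c.coevaluation')
            (copairingUnit D c.coevaluation') i j n h) ≤ S := by
  unfold filtIdeal
  rw [Finset.sup_le_iff]
  constructor
  · intro H i j h
    have := H (i, j) (by simp; omega)
    rw [dif_pos h] at this
    simpa using this
  · rintro H ⟨i, j⟩ -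
    split_ifs with h
    · simpa using H i j h
    · exact bot_le

theorem filtIdeal_map {m n : ℕ} (hmn : m ≤ n) :
    (filtIdeal D R c m).arrow ≫ filtAXMap X D hmn ≫ cokernel.π (filtIdeal D R c n).arrow = 0 := by
  rw [← le_kernelSubobject_iff, filtIdeal_le_iff]
  intro i j h
  have hn : i + 2 + j ≤ n := h.trans hmn
  have key := (filtIdeal_le_iff D R c (kernelSubobject (cokernel.π (filtIdeal D R c n).arrow))).1
    ((le_kernelSubobject_iff _ _).2 (cokernel.condition _)) i j hn
  simp only [imageSubobject_le_kernelSubobject_iff] at key ⊢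
  refine ⟨?_, ?_, ?_⟩
  · rw [Category.assoc, ← Category.assoc (filtIncl X D h), filtIncl_map, ← Category.assoc]
    exact key.1
  · rw [← Category.assoc, inhomRel_map]
    exact key.2.1
  · rw [← Category.assoc, inhomRel_map]
    exact key.2.2

/-- The filtered space `A(X,R;c)`. -/
noncomputable def filtSpace : ℕ ⥤ C where
  obj n := cokernel (filtIdeal D R c n).arrow
  map {m n} f := cokernel.desc _ (filtAXMap X D (leOfHom f) ≫ cokernel.π (filtIdeal D R c n).arrow)
    (filtIdeal_map D R c (leOfHom f))
  map_id n := by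
    apply coequalizer.hom_ext
    apply filtAX_hom_ext
    intro k h
    rw [cokernel.π_desc, ← Category.assoc, filtIncl_map, Category.comp_id]
  map_comp {l m n} f g := by
    apply coequalizer.hom_ext
    apply filtAX_hom_ext
    intro k h
    rw [cokernel.π_desc, cokernel.π_desc_assoc, Category.assoc, cokernel.π_desc,
      ← Category.assoc, filtIncl_map, ← Category.assoc, filtIncl_map, ← Category.assoc,
      filtIncl_map]

/-- The canonical morphism `A_k(X) ⟶ A(X,R;c)_(n)` for `k ≤ n`. -/
noncomputable def filtProj {k n : ℕ} (h : k ≤ n) : AX X D k ⟶ (filtSpace D R c).obj n :=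
  filtIncl X D h ≫ cokernel.π (filtIdeal D R c n).arrow

variable {D R c}

/-- The structure of `T` on `A(X,R)` is induced by that of `A(X)`, by the multiplication of
`A(X)` formed with the inverse braiding, and by the pairing `ρ_{m,n}`. -/
structure FrtInduced (T : CoquasiBialg (frtSpace D R)) : Prop where
  comul : ∀ n : ℕ, frtProj D R n ≫ T.coalg.comul (deg n) =
    AX.comul X D n ≫ (frtProj D R n ⊗ₘ frtProj D R n)
  counit : ∀ n : ℕ, frtProj D R n ≫ T.coalg.counit (deg n) = AX.counit X D n
  one : T.alg.one = AX.one X D ≫ frtProj D R 0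
  mul : ∀ m n : ℕ, (frtProj D R m ⊗ₘ frtProj D R n) ≫ T.alg.mul (deg m) (deg n) =
    AX.mul X D m n ≫ frtProj D R (m + n)
  one_bar : T.algBar.one = AX.one X D ≫ frtProj D R 0
  mul_bar : ∀ m n : ℕ, (frtProj D R m ⊗ₘ frtProj D R n) ≫ T.algBar.mul (deg m) (deg n) =
    @AX.mul C _ _ X D (reverseBraiding C) m n ≫ frtProj D R (m + n)
  pairing : ∀ m n : ℕ, (frtProj D R m ⊗ₘ frtProj D R n) ≫ T.pairing.app (deg m) (deg n) =
    AX.pairing D R m n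

/-- The structure of `T` on `A(X,R;c)` is induced by that of `A(X)`, by the multiplication of
`A(X)` formed with the inverse braiding, and by the pairing `ρ_{m,n}`. -/
structure FiltInduced (T : CoquasiBialg (filtSpace D R c)) : Prop where
  comul : ∀ (k n : ℕ) (h : k ≤ n), filtProj D R c h ≫ T.coalg.comul n =
    AX.comul X D k ≫ (filtProj D R c h ⊗ₘ filtProj D R c h)
  counit : ∀ (k n : ℕ) (h : k ≤ n), filtProj D R c h ≫ T.coalg.counit n = AX.counit X D k
  one : T.alg.one = AX.one X D ≫ filtProj D R c (le_refl 0)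
  mul : ∀ (k l m n : ℕ) (h : k ≤ m) (h' : l ≤ n),
    (filtProj D R c h ⊗ₘ filtProj D R c h') ≫ T.alg.mul m n =
      AX.mul X D k l ≫ filtProj D R c (Nat.add_le_add h h')
  one_bar : T.algBar.one = AX.one X D ≫ filtProj D R c (le_refl 0)
  mul_bar : ∀ (k l m n : ℕ) (h : k ≤ m) (h' : l ≤ n),
    (filtProj D R c h ⊗ₘ filtProj D R c h') ≫ T.algBar.mul m n =
      @AX.mul C _ _ X D (reverseBraiding C) k l ≫ filtProj D R c (Nat.add_le_add h h')
  pairing : ∀ (k l m n : ℕ) (h : k ≤ m) (h' : l ≤ n),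
    (filtProj D R c h ⊗ₘ filtProj D R c h') ≫ T.pairing.app m n = AX.pairing D R k l

variable (D)

/-- The ideal of `Ā(X)`, the algebra formed with the inverse braiding, defining
`Ā(X,R⁻¹)`. -/
noncomputable def frtIdealBar (R : X ⊗ X ≅ X ⊗ X) (n : ℕ) : Subobject (AX X D n) :=
  @frtIdeal C _ _ _ (reverseBraiding C) X D _ R.inv n

/-- The ideal of `Ā(X)` defining `Ā(X,R⁻¹;c)`. -/
noncomputable def filtIdealBar (R : X ⊗ X ≅ X ⊗ X) (c : ExactPairing X X) (n : ℕ) :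
    Subobject (filtAX X D n) :=
  @filtIdeal C _ _ _ (reverseBraiding C) X D _ R.inv c n

end Quotients

end BraidedFRT

open BraidedFRT

/-!
The object `A_n = D^{⊗n} ⊗ X^{⊗n}` is the coefficient coalgebra `V' ⊗ V` of `V = X^{⊗n}`. A family
of morphisms `p_V : V' ⊗ V ⟶ Z` is dinatural along `f : V ⟶ W` if `p_V ∘ (f' ⊗ V) = p_W ∘ (W' ⊗ f)`,
where `f'` is the dual of `f`. The relation for `R` is dinaturality along `R`, and the invariance
relations for `C` and for its dual are dinaturality along the pairing and along the copairing.
Multiplying such a relation by `A_i` and `A_j` gives dinaturality along `1 ⊗ f ⊗ 1`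
(`sandwich_relation_iff`). Hence both quotients are universal targets of families that are dinatural
along the generators `Gen R K`, the morphisms `1 ⊗ f ⊗ 1` with `f` among `R`, the pairing and the
copairing. As the tensor product is right exact, they remain universal after tensoring with other
objects. This is the notion of `Presentation`; the two quotients are `frtPresentation` and
`filtPresentation`, and the structure is constructed for any presentation.

A structure morphism descends as soon as it is dinatural in each variable. For the comultiplication
and the counit this holds along any morphism, and for the multiplication because generators are
stable under tensoring with powers of `X`. The pairing of `V' ⊗ V` with `W' ⊗ W` built from an
exchange morphism `V ⊗ W ⟶ W ⊗ V` is dinatural along the morphisms with which the exchange commutes;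
that `R_{X^{⊗m}, X^{⊗n}}` commutes with the generators follows from the braid equation and from the
compatibility of the pairing with `R` (`Gen.natExchange`, `Gen.exchangeNat`).

The axioms are then identities between matrix coefficients. Multiplicativity of `ρ` is the hexagon
identity. The convolution of pairings is the composition of endomorphisms of `X^{⊗m} ⊗ X^{⊗n}`, and
the second product is the composition of endomorphisms of `X^{⊗m} ⊗ D^{⊗n}`, so that the inverses of
`R_{X^{⊗m}, X^{⊗n}}` and of its rotation, the latter being `R_{X^{⊗m}, D^{⊗n}}`, give the two
inverses of `ρ` (`Presentation.isConvInverse`, `Presentation.isSecondInverse`). The exchange law is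
dinaturality along `R_{X^{⊗m}, X^{⊗n}}`, which is a composite of generators (`word_Rpow`).

In the filtered case `C` makes every `X^{⊗n}` self-dual, by pairings that are composites of
generators, and the transpose of a generator is a generator (`Gen.transpose`). Applying the
self-duality to both factors of `D^{⊗n} ⊗ X^{⊗n}` and exchanging them by the braiding gives the
antipode; its two axioms are dinaturality along the pairing and the copairing of `X^{⊗n}`.

Finally, dinaturality along an isomorphism is equivalent to dinaturality along its inverse, and it
involves the dual of a morphism but no braiding. So the ideals defined by `R` with the braiding and
by `R⁻¹` with the inverse braiding are defined by the same condition and coincide (`frtIdealBar_eq`,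
`filtIdealBar_eq`).
-/

namespace BraidedFRT

section Duality

variable {C : Type u} [Category.{v} C] [MonoidalCategory C]

/-! ### Duals of morphisms -/

/-- The dual `W' ⟶ V'` of a morphism `f : V ⟶ W`, for chosen duals `V'` of `V` and `W'` of `W`. -/
def mate {V W : C} (V' W' : C) [ExactPairing V V'] [ExactPairing W W'] (f : V ⟶ W) : W' ⟶ V' :=
  @rightAdjointMate C _ _ V W ⟨V'⟩ ⟨W'⟩ f

theorem mate_evaluation {V W : C} (V' W' : C) [ExactPairing V V'] [ExactPairing W W']
    (f : V ⟶ W) : mate V' W' f ▷ V ≫ ε_ V V' = W' ◁ f ≫ ε_ W W' :=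
  @rightAdjointMate_comp_evaluation C _ _ V W ⟨V'⟩ ⟨W'⟩ f

theorem coevaluation_mate {V W : C} (V' W' : C) [ExactPairing V V'] [ExactPairing W W']
    (f : V ⟶ W) : η_ W W' ≫ W ◁ mate V' W' f = η_ V V' ≫ f ▷ V' :=
  @coevaluation_comp_rightAdjointMate C _ _ V W ⟨V'⟩ ⟨W'⟩ f

/-- A morphism into a dual is determined by the functional it defines. -/
theorem eq_of_whiskerRight_evaluation {V V' Z : C} [ExactPairing V V'] {g h : Z ⟶ V'}
    (H : g ▷ V ≫ ε_ V V' = h ▷ V ≫ ε_ V V') : g = h := by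
  have key : ∀ k : Z ⟶ V', k = 𝟙 _ ⊗≫ Z ◁ η_ V V' ⊗≫ (k ▷ V ≫ ε_ V V') ▷ V' ⊗≫ 𝟙 _ := by
    intro k
    calc k = 𝟙 _ ⊗≫ k ⊗≫ (V' ◁ η_ V V' ⊗≫ ε_ V V' ▷ V') ⊗≫ 𝟙 _ := by
          rw [ExactPairing.coevaluation_evaluation'']; monoidal
      _ = 𝟙 _ ⊗≫ (k ▷ (𝟙_ C) ≫ V' ◁ η_ V V') ⊗≫ ε_ V V' ▷ V' ⊗≫ 𝟙 _ := by monoidal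
      _ = _ := by rw [← whisker_exchange]; monoidal
  rw [key g, key h, H]

theorem mate_unique {V W : C} {V' W' : C} [ExactPairing V V'] [ExactPairing W W']
    {f : V ⟶ W} {g : W' ⟶ V'} (h : g ▷ V ≫ ε_ V V' = W' ◁ f ≫ ε_ W W') :
    mate V' W' f = g :=
  eq_of_whiskerRight_evaluation (by rw [h, mate_evaluation])

theorem mate_id {V V' : C} [ExactPairing V V'] : mate V' V' (𝟙 V) = 𝟙 V' :=
  mate_unique (by simp)

theorem mate_comp {V W U : C} (V' W' U' : C) [ExactPairing V V'] [ExactPairing W W']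
    [ExactPairing U U'] (f : V ⟶ W) (g : W ⟶ U) :
    mate V' U' (f ≫ g) = mate W' U' g ≫ mate V' W' f :=
  mate_unique (by
    rw [comp_whiskerRight, Category.assoc, mate_evaluation, ← whisker_exchange_assoc,
      mate_evaluation, whiskerLeft_comp, Category.assoc])

theorem mate_whiskerRight {V W U : C} (V' W' U' : C) [ExactPairing V V'] [ExactPairing W W']
    [ExactPairing U U'] (f : V ⟶ W) :
    mate (U' ⊗ V') (U' ⊗ W') (f ▷ U) = U' ◁ mate V' W' f :=
  mate_unique (by
    rw [ExactPairing.tensor_evaluation, ExactPairing.tensor_evaluation]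
    calc _ = 𝟙 _ ⊗≫ U' ◁ (mate V' W' f ▷ V ≫ ε_ V V') ▷ U ⊗≫ ε_ U U' := by monoidal
      _ = _ := by rw [mate_evaluation]; monoidal)

theorem mate_whiskerLeft {V W U : C} (V' W' U' : C) [ExactPairing V V'] [ExactPairing W W']
    [ExactPairing U U'] (f : V ⟶ W) :
    mate (V' ⊗ U') (W' ⊗ U') (U ◁ f) = mate V' W' f ▷ U' :=
  mate_unique (by
    rw [ExactPairing.tensor_evaluation, ExactPairing.tensor_evaluation]
    calc _ = 𝟙 _ ⊗≫ (mate V' W' f ▷ (U' ⊗ U) ≫ V' ◁ ε_ U U') ▷ V ⊗≫ ε_ V V' := by monoidal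
      _ = 𝟙 _ ⊗≫ W' ◁ ε_ U U' ▷ V ⊗≫ (mate V' W' f ▷ V ≫ ε_ V V') := by
        rw [← whisker_exchange]; monoidal
      _ = 𝟙 _ ⊗≫ W' ◁ (ε_ U U' ▷ V ≫ (𝟙_ C) ◁ f) ⊗≫ ε_ W W' := by
        rw [mate_evaluation]; monoidal
      _ = _ := by rw [← whisker_exchange]; monoidal)

theorem mate_associator {U V W : C} (U' V' W' : C) [ExactPairing U U'] [ExactPairing V V']
    [ExactPairing W W'] :
    mate (W' ⊗ (V' ⊗ U')) ((W' ⊗ V') ⊗ U') (α_ U V W).hom = (α_ W' V' U').hom :=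
  mate_unique (by simp only [ExactPairing.tensor_evaluation]; monoidal)

theorem mate_hom_inv {V W : C} (V' W' : C) [ExactPairing V V'] [ExactPairing W W'] (e : V ≅ W) :
    mate V' W' e.hom ≫ mate W' V' e.inv = 𝟙 _ := by
  rw [← mate_comp, e.inv_hom_id, mate_id]

theorem mate_inv_hom {V W : C} (V' W' : C) [ExactPairing V V'] [ExactPairing W W'] (e : V ≅ W) :
    mate W' V' e.inv ≫ mate V' W' e.hom = 𝟙 _ := by
  rw [← mate_comp, e.hom_inv_id, mate_id]

/-! ### The coefficient coalgebra of an object -/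

/-- `P ⊗ Q ⟶ P ⊗ V ⊗ V' ⊗ Q`, the insertion of the coevaluation of `V`. For `P = V'` and `Q = V`
this is the comultiplication of the coefficient coalgebra `V' ⊗ V`, whose counit is the
evaluation. -/
def insertCoev (P Q V V' : C) [ExactPairing V V'] : P ⊗ Q ⟶ (P ⊗ V) ⊗ (V' ⊗ Q) :=
  P ◁ (λ_ Q).inv ≫ P ◁ (η_ V V' ▷ Q) ≫ P ◁ (α_ V V' Q).hom ≫ (α_ P V (V' ⊗ Q)).inv

theorem insertCoev_eq (P Q V V' : C) [ExactPairing V V'] :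
    insertCoev P Q V V' = 𝟙 _ ⊗≫ P ◁ η_ V V' ▷ Q ⊗≫ 𝟙 _ := by
  unfold insertCoev; monoidal

theorem insertCoev_natural_left {P P₂ : C} (p : P ⟶ P₂) (Q V V' : C) [ExactPairing V V'] :
    p ▷ Q ≫ insertCoev P₂ Q V V' = insertCoev P Q V V' ≫ (p ▷ V) ▷ (V' ⊗ Q) := by
  rw [insertCoev_eq, insertCoev_eq]
  calc _ = 𝟙 _ ⊗≫ (p ▷ (𝟙_ C) ≫ P₂ ◁ η_ V V') ▷ Q ⊗≫ 𝟙 _ := by monoidal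
    _ = _ := by rw [← whisker_exchange]; monoidal

theorem insertCoev_natural_right (P : C) {Q Q₂ : C} (q : Q ⟶ Q₂) (V V' : C) [ExactPairing V V'] :
    P ◁ q ≫ insertCoev P Q₂ V V' = insertCoev P Q V V' ≫ (P ⊗ V) ◁ (V' ◁ q) := by
  rw [insertCoev_eq, insertCoev_eq]
  calc _ = 𝟙 _ ⊗≫ P ◁ ((𝟙_ C) ◁ q ≫ η_ V V' ▷ Q₂) ⊗≫ 𝟙 _ := by monoidal
    _ = _ := by rw [whisker_exchange]; monoidal

/-- Coevaluations are dinatural. -/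
theorem insertCoev_mate (P Q : C) {V W : C} (V' W' : C) [ExactPairing V V'] [ExactPairing W W']
    (f : V ⟶ W) : insertCoev P Q V V' ≫ (P ◁ f) ▷ (V' ⊗ Q) =
      insertCoev P Q W W' ≫ (P ⊗ W) ◁ (mate V' W' f ▷ Q) := by
  rw [insertCoev_eq P Q V V', insertCoev_eq P Q W W']
  calc _ = 𝟙 _ ⊗≫ P ◁ (η_ V V' ≫ f ▷ V') ▷ Q ⊗≫ 𝟙 _ := by monoidal
    _ = _ := by rw [← coevaluation_mate V' W']; monoidal

/-- The counit law, one of the triangle identities. -/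
theorem insertCoev_evaluation_left (Q V V' : C) [ExactPairing V V'] :
    insertCoev V' Q V V' ≫ ε_ V V' ▷ (V' ⊗ Q) ≫ (λ_ _).hom = 𝟙 _ := by
  rw [insertCoev_eq]
  calc _ = 𝟙 _ ⊗≫ (V' ◁ η_ V V' ⊗≫ ε_ V V' ▷ V') ▷ Q ⊗≫ 𝟙 _ := by monoidal
    _ = _ := by rw [ExactPairing.coevaluation_evaluation'']; monoidal

theorem insertCoev_evaluation_right (P V V' : C) [ExactPairing V V'] :
    insertCoev P V V V' ≫ (P ⊗ V) ◁ ε_ V V' ≫ (ρ_ _).hom = 𝟙 _ := by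
  rw [insertCoev_eq]
  calc _ = 𝟙 _ ⊗≫ P ◁ (η_ V V' ▷ V ⊗≫ V ◁ ε_ V V') ⊗≫ 𝟙 _ := by monoidal
    _ = _ := by rw [ExactPairing.evaluation_coevaluation'']; monoidal

/-- The functional on `V' ⊗ V` with matrix `f`. -/
def coeffPairing {V : C} (V' : C) [ExactPairing V V'] (f : V ⟶ V) : V' ⊗ V ⟶ 𝟙_ C :=
  V' ◁ f ≫ ε_ V V'

theorem insertCoev_coeffPairing_right {V V' : C} [ExactPairing V V'] (f : V ⟶ V) :
    insertCoev V' V V V' ≫ (V' ⊗ V) ◁ coeffPairing V' f ≫ (ρ_ _).hom = V' ◁ f := by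
  rw [coeffPairing, whiskerLeft_comp, Category.assoc, ← reassoc_of% @insertCoev_natural_right,
    insertCoev_evaluation_right, Category.comp_id]

/-- Acting with the functional of `f` on the left tensor factor is the dual of `f`; on the right
factor it is `f` itself. Relations imposed on the coalgebra compare these two actions. -/
theorem insertCoev_coeffPairing_left {V V' : C} [ExactPairing V V'] (f : V ⟶ V) :
    insertCoev V' V V V' ≫ coeffPairing V' f ▷ (V' ⊗ V) ≫ (λ_ _).hom = mate V' V' f ▷ V := by
  rw [coeffPairing, ← mate_evaluation V' V', comp_whiskerRight, Category.assoc,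
    ← reassoc_of% @insertCoev_natural_left,
    insertCoev_evaluation_left, Category.comp_id]

/-- Multiplicativity of `coeffPairing`, for the convolution product. -/
theorem insertCoev_coeffPairing {V V' : C} [ExactPairing V V'] (f g : V ⟶ V) :
    insertCoev V' V V V' ≫ (coeffPairing V' f ⊗ₘ coeffPairing V' g) ≫ (λ_ (𝟙_ C)).hom =
      coeffPairing V' (g ≫ f) := by
  have : (coeffPairing V' f ⊗ₘ coeffPairing V' g) ≫ (λ_ (𝟙_ C)).hom =
      ((V' ⊗ V) ◁ coeffPairing V' g ≫ (ρ_ _).hom) ≫ coeffPairing V' f := by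
    rw [tensorHom_def']; simp [unitors_equal]
  rw [this, ← Category.assoc, insertCoev_coeffPairing_right, coeffPairing, coeffPairing]
  simp

/-- The comultiplication of `V' ⊗ V` is compatible with any morphism `p` identifying the matrix
coefficients along `f : V ⟶ W`. -/
theorem insertCoev_dinatural {V W : C} {V' W' : C} [ExactPairing V V'] [ExactPairing W W']
    {f : V ⟶ W} {Z : C} {p : V' ⊗ V ⟶ Z} {q : W' ⊗ W ⟶ Z}
    (h : mate V' W' f ▷ V ≫ p = W' ◁ f ≫ q) :
    mate V' W' f ▷ V ≫ insertCoev V' V V V' ≫ (p ⊗ₘ p) =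
      W' ◁ f ≫ insertCoev W' W W W' ≫ (q ⊗ₘ q) := by
  calc _ = insertCoev W' V V V' ≫ ((mate V' W' f ▷ V ≫ p) ⊗ₘ p) := by
        rw [reassoc_of% @insertCoev_natural_left, whiskerRight_comp_tensorHom]
    _ = insertCoev W' V W W' ≫ (q ⊗ₘ (mate V' W' f ▷ V ≫ p)) := by
        rw [h, ← whiskerRight_comp_tensorHom, reassoc_of% insertCoev_mate W' V V' W',
          whiskerLeft_comp_tensorHom, h]
    _ = _ := by
        rw [h, reassoc_of% @insertCoev_natural_right, whiskerLeft_comp_tensorHom]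

theorem insertCoev_coassoc (V V' : C) [ExactPairing V V'] :
    insertCoev V' V V V' ≫ insertCoev V' V V V' ▷ (V' ⊗ V) ≫ (α_ _ _ _).hom =
      insertCoev V' V V V' ≫ (V' ⊗ V) ◁ insertCoev V' V V V' := by
  simp only [insertCoev_eq]
  calc _ = 𝟙 _ ⊗≫ V' ◁ ((𝟙_ C) ◁ η_ V V' ≫ η_ V V' ▷ (V ⊗ V')) ▷ V ⊗≫ 𝟙 _ := by
        monoidal
    _ = _ := by rw [whisker_exchange]; monoidal

theorem insertCoev_counit_left (V V' : C) [ExactPairing V V'] :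
    insertCoev V' V V V' ≫ ε_ V V' ▷ (V' ⊗ V) = (λ_ _).inv := by
  rw [← cancel_mono (λ_ (V' ⊗ V)).hom, Category.assoc, insertCoev_evaluation_left]; simp

theorem insertCoev_counit_right (V V' : C) [ExactPairing V V'] :
    insertCoev V' V V V' ≫ (V' ⊗ V) ◁ ε_ V V' = (ρ_ _).inv := by
  rw [← cancel_mono (ρ_ (V' ⊗ V)).hom, Category.assoc, insertCoev_evaluation_right]; simp

end Duality

/-! ### Exchange morphisms -/

section HalfBraidings

variable {C : Type u} [Category.{v} C] [MonoidalCategory C]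

/-- Exchange of `Y` with `A ⊗ B`, composed of exchanges with `A` and with `B`. -/
def tensorExchange {A B Y : C} (a : A ⊗ Y ⟶ Y ⊗ A) (b : B ⊗ Y ⟶ Y ⊗ B) :
    (A ⊗ B) ⊗ Y ⟶ Y ⊗ (A ⊗ B) :=
  (α_ A B Y).hom ≫ A ◁ b ≫ (α_ A Y B).inv ≫ a ▷ B ≫ (α_ Y A B).hom

/-- Exchange of `V` with `A ⊗ B`, composed of exchanges with `A` and with `B`. -/
def exchangeTensor {V A B : C} (a : V ⊗ A ⟶ A ⊗ V) (b : V ⊗ B ⟶ B ⊗ V) :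
    V ⊗ (A ⊗ B) ⟶ (A ⊗ B) ⊗ V :=
  (α_ V A B).inv ≫ a ▷ B ≫ (α_ A V B).hom ≫ A ◁ b ≫ (α_ A B V).inv

/-- The exchanges `a`, `b` of `V` with `A` and `B` are compatible with `f : A ⟶ B`. -/
def ExchangeNat {V A B : C} (a : V ⊗ A ⟶ A ⊗ V) (b : V ⊗ B ⟶ B ⊗ V) (f : A ⟶ B) : Prop :=
  V ◁ f ≫ b = a ≫ f ▷ V

/-- The exchanges `a`, `b` of `A` and `B` with `Y` are compatible with `f : A ⟶ B`. -/
def NatExchange {A B Y : C} (a : A ⊗ Y ⟶ Y ⊗ A) (b : B ⊗ Y ⟶ Y ⊗ B) (f : A ⟶ B) : Prop :=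
  f ▷ Y ≫ b = a ≫ Y ◁ f

/-- The exchange of `V` with the unit of `C`. -/
def exchangeUnit (V : C) : V ⊗ 𝟙_ C ⟶ 𝟙_ C ⊗ V := (ρ_ V).hom ≫ (λ_ V).inv

/-- The exchange of the unit of `C` with `Y`. -/
def unitExchange (Y : C) : 𝟙_ C ⊗ Y ⟶ Y ⊗ 𝟙_ C := (λ_ Y).hom ≫ (ρ_ Y).inv

theorem NatExchange.comp {A B E Y : C} {a : A ⊗ Y ⟶ Y ⊗ A} {b : B ⊗ Y ⟶ Y ⊗ B}
    {e : E ⊗ Y ⟶ Y ⊗ E} {f : A ⟶ B} {g : B ⟶ E} (hf : NatExchange a b f)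
    (hg : NatExchange b e g) : NatExchange a e (f ≫ g) := by
  unfold NatExchange at *
  rw [comp_whiskerRight, Category.assoc, hg, reassoc_of% hf, whiskerLeft_comp]

theorem ExchangeNat.comp {A B E V : C} {a : V ⊗ A ⟶ A ⊗ V} {b : V ⊗ B ⟶ B ⊗ V}
    {e : V ⊗ E ⟶ E ⊗ V} {f : A ⟶ B} {g : B ⟶ E} (hf : ExchangeNat a b f)
    (hg : ExchangeNat b e g) : ExchangeNat a e (f ≫ g) := by
  unfold ExchangeNat at *
  rw [whiskerLeft_comp, Category.assoc, hg, reassoc_of% hf, comp_whiskerRight]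

theorem NatExchange.whiskerRight {A B E Y : C} {a : A ⊗ Y ⟶ Y ⊗ A} {b : B ⊗ Y ⟶ Y ⊗ B}
    {f : A ⟶ B} (hf : NatExchange a b f) (e : E ⊗ Y ⟶ Y ⊗ E) :
    NatExchange (tensorExchange a e) (tensorExchange b e) (f ▷ E) := by
  unfold NatExchange tensorExchange at *
  calc _ = 𝟙 _ ⊗≫ (f ▷ (E ⊗ Y) ≫ B ◁ e) ⊗≫ b ▷ E ⊗≫ 𝟙 _ := by monoidal
    _ = 𝟙 _ ⊗≫ A ◁ e ⊗≫ (f ▷ Y ≫ b) ▷ E ⊗≫ 𝟙 _ := by rw [← whisker_exchange]; monoidal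
    _ = _ := by rw [hf]; monoidal

theorem NatExchange.whiskerLeft {A B E Y : C} {a : A ⊗ Y ⟶ Y ⊗ A} {b : B ⊗ Y ⟶ Y ⊗ B}
    {f : A ⟶ B} (hf : NatExchange a b f) (e : E ⊗ Y ⟶ Y ⊗ E) :
    NatExchange (tensorExchange e a) (tensorExchange e b) (E ◁ f) := by
  unfold NatExchange tensorExchange at *
  calc _ = 𝟙 _ ⊗≫ E ◁ (f ▷ Y ≫ b) ⊗≫ e ▷ B ⊗≫ 𝟙 _ := by monoidal
    _ = 𝟙 _ ⊗≫ E ◁ a ⊗≫ ((E ⊗ Y) ◁ f ≫ e ▷ B) ⊗≫ 𝟙 _ := by rw [hf]; monoidal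
    _ = _ := by rw [whisker_exchange]; monoidal

theorem NatExchange.associator {A B E Y : C} (a : A ⊗ Y ⟶ Y ⊗ A) (b : B ⊗ Y ⟶ Y ⊗ B)
    (e : E ⊗ Y ⟶ Y ⊗ E) :
    NatExchange (tensorExchange (tensorExchange a b) e) (tensorExchange a (tensorExchange b e))
      (α_ A B E).hom := by
  unfold NatExchange tensorExchange
  monoidal

theorem NatExchange.rightUnitor {A Y : C} (a : A ⊗ Y ⟶ Y ⊗ A) :
    NatExchange (tensorExchange a (unitExchange Y)) a (ρ_ A).hom := by
  unfold NatExchange tensorExchange unitExchange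
  monoidal

theorem NatExchange.symm {A B Y : C} {a : A ⊗ Y ⟶ Y ⊗ A} {b : B ⊗ Y ⟶ Y ⊗ B}
    {f : A ≅ B} (hf : NatExchange a b f.hom) : NatExchange b a f.inv := by
  unfold NatExchange at *
  rw [← cancel_epi (f.hom ▷ Y), reassoc_of% hf]
  simp

theorem ExchangeNat.whiskerRight {A B E V : C} {a : V ⊗ A ⟶ A ⊗ V} {b : V ⊗ B ⟶ B ⊗ V}
    {f : A ⟶ B} (hf : ExchangeNat a b f) (e : V ⊗ E ⟶ E ⊗ V) :
    ExchangeNat (exchangeTensor a e) (exchangeTensor b e) (f ▷ E) := by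
  unfold ExchangeNat exchangeTensor at *
  calc _ = 𝟙 _ ⊗≫ (V ◁ f ≫ b) ▷ E ⊗≫ B ◁ e ⊗≫ 𝟙 _ := by monoidal
    _ = 𝟙 _ ⊗≫ a ▷ E ⊗≫ (f ▷ (V ⊗ E) ≫ B ◁ e) ⊗≫ 𝟙 _ := by rw [hf]; monoidal
    _ = _ := by rw [← whisker_exchange]; monoidal

theorem ExchangeNat.whiskerLeft {A B E V : C} {a : V ⊗ A ⟶ A ⊗ V} {b : V ⊗ B ⟶ B ⊗ V}
    {f : A ⟶ B} (hf : ExchangeNat a b f) (e : V ⊗ E ⟶ E ⊗ V) :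
    ExchangeNat (exchangeTensor e a) (exchangeTensor e b) (E ◁ f) := by
  unfold ExchangeNat exchangeTensor at *
  calc _ = 𝟙 _ ⊗≫ ((V ⊗ E) ◁ f ≫ e ▷ B) ⊗≫ E ◁ b ⊗≫ 𝟙 _ := by monoidal
    _ = 𝟙 _ ⊗≫ e ▷ A ⊗≫ E ◁ (V ◁ f ≫ b) ⊗≫ 𝟙 _ := by rw [whisker_exchange]; monoidal
    _ = _ := by rw [hf]; monoidal

theorem ExchangeNat.associator {A B E V : C} (a : V ⊗ A ⟶ A ⊗ V) (b : V ⊗ B ⟶ B ⊗ V)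
    (e : V ⊗ E ⟶ E ⊗ V) :
    ExchangeNat (exchangeTensor (exchangeTensor a b) e) (exchangeTensor a (exchangeTensor b e))
      (α_ A B E).hom := by
  unfold ExchangeNat exchangeTensor
  monoidal

theorem ExchangeNat.rightUnitor {A V : C} (a : V ⊗ A ⟶ A ⊗ V) :
    ExchangeNat (exchangeTensor a (exchangeUnit V)) a (ρ_ A).hom := by
  unfold ExchangeNat exchangeTensor exchangeUnit
  monoidal

theorem ExchangeNat.symm {A B V : C} {a : V ⊗ A ⟶ A ⊗ V} {b : V ⊗ B ⟶ B ⊗ V}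
    {f : A ≅ B} (hf : ExchangeNat a b f.hom) : ExchangeNat b a f.inv := by
  unfold ExchangeNat at *
  rw [← cancel_epi (V ◁ f.hom), reassoc_of% hf]
  simp

/-- If `f : A ⟶ B` commutes with the exchanges with `V` and with `W`, it does so with `V ⊗ W`. -/
theorem ExchangeNat.tensorExchange {A B V W : C} {a : V ⊗ A ⟶ A ⊗ V} {b : V ⊗ B ⟶ B ⊗ V}
    {a' : W ⊗ A ⟶ A ⊗ W} {b' : W ⊗ B ⟶ B ⊗ W} {f : A ⟶ B} (h : ExchangeNat a b f)
    (h' : ExchangeNat a' b' f) :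
    ExchangeNat (tensorExchange a a') (tensorExchange b b') f := by
  unfold ExchangeNat BraidedFRT.tensorExchange at *
  calc _ = 𝟙 _ ⊗≫ V ◁ (W ◁ f ≫ b') ⊗≫ b ▷ W ⊗≫ 𝟙 _ := by monoidal
    _ = 𝟙 _ ⊗≫ V ◁ a' ⊗≫ (V ◁ f ≫ b) ▷ W ⊗≫ 𝟙 _ := by rw [h']; monoidal
    _ = _ := by rw [h]; monoidal

/-- If `f : A ⟶ B` commutes with the exchanges with `Y` and with `Z`, it does so with `Y ⊗ Z`. -/
theorem NatExchange.exchangeTensor {A B Y Z : C} {a : A ⊗ Y ⟶ Y ⊗ A} {b : B ⊗ Y ⟶ Y ⊗ B}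
    {a' : A ⊗ Z ⟶ Z ⊗ A} {b' : B ⊗ Z ⟶ Z ⊗ B} {f : A ⟶ B} (h : NatExchange a b f)
    (h' : NatExchange a' b' f) :
    NatExchange (exchangeTensor a a') (exchangeTensor b b') f := by
  unfold NatExchange BraidedFRT.exchangeTensor at *
  calc _ = 𝟙 _ ⊗≫ (f ▷ Y ≫ b) ▷ Z ⊗≫ Y ◁ b' ⊗≫ 𝟙 _ := by monoidal
    _ = 𝟙 _ ⊗≫ a ▷ Z ⊗≫ Y ◁ (f ▷ Z ≫ b') ⊗≫ 𝟙 _ := by rw [h]; monoidal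
    _ = _ := by rw [h']; monoidal

/-- The two ways of composing the exchange of `A ⊗ B` with `Y ⊗ Z` agree. -/
theorem exchangeTensor_tensorExchange {A B Y Z : C} (a : A ⊗ Y ⟶ Y ⊗ A) (b : B ⊗ Y ⟶ Y ⊗ B)
    (a' : A ⊗ Z ⟶ Z ⊗ A) (b' : B ⊗ Z ⟶ Z ⊗ B) :
    exchangeTensor (tensorExchange a b) (tensorExchange a' b') =
      tensorExchange (exchangeTensor a a') (exchangeTensor b b') := by
  unfold exchangeTensor tensorExchange
  calc _ = 𝟙 _ ⊗≫ A ◁ b ▷ Z ⊗≫ (a ▷ (B ⊗ Z) ≫ (Y ⊗ A) ◁ b') ⊗≫ Y ◁ a' ▷ B ⊗≫ 𝟙 _ := by monoidal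
    _ = _ := by rw [← whisker_exchange]; monoidal

/-! ### Rotated exchanges -/

/-- The exchange `Y' ⊗ V ⟶ V ⊗ Y'` obtained by rotating `r : V ⊗ Y ⟶ Y ⊗ V`. -/
def rotateExchange {V Y : C} (Y' : C) [ExactPairing Y Y'] (r : V ⊗ Y ⟶ Y ⊗ V) : Y' ⊗ V ⟶ V ⊗ Y' :=
  𝟙 (Y' ⊗ V) ⊗≫ Y' ◁ V ◁ η_ Y Y' ⊗≫ Y' ◁ r ▷ Y' ⊗≫ ε_ Y Y' ▷ (V ⊗ Y') ≫ (λ_ (V ⊗ Y')).hom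

/-- If evaluation slides through `r'` and `r`, then rotating `r` gives a one-sided inverse of
`r'`. -/
theorem comp_rotateExchange {V Y Y' : C} [ExactPairing Y Y'] {r' : V ⊗ Y' ⟶ Y' ⊗ V}
    {r : V ⊗ Y ⟶ Y ⊗ V} (h : ExchangeNat (exchangeTensor r' r) (exchangeUnit V) (ε_ Y Y')) :
    r' ≫ rotateExchange Y' r = 𝟙 _ := by
  unfold ExchangeNat exchangeTensor exchangeUnit at h
  unfold rotateExchange
  calc _ = 𝟙 _ ⊗≫ (r' ▷ (𝟙_ C) ≫ (Y' ⊗ V) ◁ η_ Y Y') ⊗≫ Y' ◁ r ▷ Y' ⊗≫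
        ε_ Y Y' ▷ (V ⊗ Y') ⊗≫ 𝟙 _ := by monoidal
    _ = 𝟙 _ ⊗≫ V ◁ Y' ◁ η_ Y Y' ⊗≫ (((α_ V Y' Y).inv ≫ r' ▷ Y ≫ (α_ Y' V Y).hom ≫ Y' ◁ r ≫
        (α_ Y' Y V).inv) ≫ ε_ Y Y' ▷ V) ▷ Y' ⊗≫ 𝟙 _ := by rw [← whisker_exchange]; monoidal
    _ = 𝟙 _ ⊗≫ V ◁ (Y' ◁ η_ Y Y' ⊗≫ ε_ Y Y' ▷ Y') ⊗≫ 𝟙 _ := by rw [← h]; monoidal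
    _ = _ := by rw [ExactPairing.coevaluation_evaluation'']; monoidal

/-- Conversely, evaluation slides through `r` and any one-sided inverse of its rotation. -/
theorem exchangeNat_evaluation {V Y Y' : C} [ExactPairing Y Y'] {r' : V ⊗ Y' ⟶ Y' ⊗ V}
    {r : V ⊗ Y ⟶ Y ⊗ V} (h : r' ≫ rotateExchange Y' r = 𝟙 _) :
    ExchangeNat (exchangeTensor r' r) (exchangeUnit V) (ε_ Y Y') := by
  unfold ExchangeNat exchangeTensor exchangeUnit
  unfold rotateExchange at h
  symm
  calc _ = 𝟙 _ ⊗≫ r' ▷ Y ⊗≫ Y' ◁ r ⊗≫ Y' ◁ (𝟙 Y ⊗≫ 𝟙 Y) ▷ V ⊗≫ ε_ Y Y' ▷ V ⊗≫ 𝟙 _ := by monoidal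
    _ = 𝟙 _ ⊗≫ r' ▷ Y ⊗≫ Y' ◁ V ◁ (η_ Y Y' ▷ Y ⊗≫ Y ◁ ε_ Y Y') ⊗≫ Y' ◁ r ⊗≫
          ε_ Y Y' ▷ V ⊗≫ 𝟙 _ := by
        rw [ExactPairing.evaluation_coevaluation'']; monoidal
    _ = 𝟙 _ ⊗≫ r' ▷ Y ⊗≫ Y' ◁ V ◁ η_ Y Y' ▷ Y ⊗≫ Y' ◁ ((V ⊗ Y) ◁ ε_ Y Y' ≫ r ▷ (𝟙_ C)) ⊗≫
          ε_ Y Y' ▷ V ⊗≫ 𝟙 _ := by monoidal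
    _ = 𝟙 _ ⊗≫ r' ▷ Y ⊗≫ Y' ◁ V ◁ η_ Y Y' ▷ Y ⊗≫ Y' ◁ r ▷ (Y' ⊗ Y) ⊗≫
          ((Y' ⊗ Y) ◁ (V ◁ ε_ Y Y') ≫ ε_ Y Y' ▷ (V ⊗ 𝟙_ C)) ⊗≫ 𝟙 _ := by
        rw [whisker_exchange]; monoidal
    _ = 𝟙 _ ⊗≫ (r' ≫ 𝟙 (Y' ⊗ V) ⊗≫ Y' ◁ V ◁ η_ Y Y' ⊗≫ Y' ◁ r ▷ Y' ⊗≫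
          ε_ Y Y' ▷ (V ⊗ Y') ≫ (λ_ (V ⊗ Y')).hom) ▷ Y ⊗≫ V ◁ ε_ Y Y' ⊗≫ 𝟙 _ := by
        rw [whisker_exchange]; monoidal
    _ = _ := by rw [h]; monoidal

theorem exchangeNat_coevaluation {V Y Y' : C} [ExactPairing Y Y'] {r' : V ⊗ Y' ⟶ Y' ⊗ V}
    {r : V ⊗ Y ⟶ Y ⊗ V} (h : rotateExchange Y' r ≫ r' = 𝟙 _) :
    ExchangeNat (exchangeUnit V) (exchangeTensor r r') (η_ Y Y') := by
  unfold ExchangeNat exchangeTensor exchangeUnit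
  unfold rotateExchange at h
  symm
  calc _ = 𝟙 _ ⊗≫ η_ Y Y' ▷ V ⊗≫ Y ◁ ((𝟙 (Y' ⊗ V) ⊗≫ Y' ◁ V ◁ η_ Y Y' ⊗≫ Y' ◁ r ▷ Y' ⊗≫
          ε_ Y Y' ▷ (V ⊗ Y') ≫ (λ_ (V ⊗ Y')).hom) ≫ r') ⊗≫ 𝟙 _ := by rw [h]; monoidal
    _ = 𝟙 _ ⊗≫ (η_ Y Y' ▷ (V ⊗ 𝟙_ C) ≫ (Y ⊗ Y') ◁ (V ◁ η_ Y Y')) ⊗≫ Y ◁ Y' ◁ r ▷ Y' ⊗≫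
          Y ◁ ε_ Y Y' ▷ (V ⊗ Y') ⊗≫ Y ◁ r' ⊗≫ 𝟙 _ := by monoidal
    _ = 𝟙 _ ⊗≫ V ◁ η_ Y Y' ⊗≫ (η_ Y Y' ▷ (V ⊗ Y) ≫ (Y ⊗ Y') ◁ r) ▷ Y' ⊗≫
          Y ◁ ε_ Y Y' ▷ (V ⊗ Y') ⊗≫ Y ◁ r' ⊗≫ 𝟙 _ := by rw [← whisker_exchange]; monoidal
    _ = 𝟙 _ ⊗≫ V ◁ η_ Y Y' ⊗≫ r ▷ Y' ⊗≫ (η_ Y Y' ▷ Y ⊗≫ Y ◁ ε_ Y Y') ▷ (V ⊗ Y') ⊗≫ Y ◁ r' ⊗≫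
          𝟙 _ := by rw [← whisker_exchange]; monoidal
    _ = _ := by rw [ExactPairing.evaluation_coevaluation'']; monoidal

/-- If evaluation is compatible with the exchanges with `V`, so is coevaluation. -/
theorem ExchangeNat.coevaluation {V Y Y' : C} [ExactPairing Y Y'] {r' : V ⊗ Y' ⟶ Y' ⊗ V}
    [IsIso r'] {r : V ⊗ Y ⟶ Y ⊗ V}
    (h : ExchangeNat (exchangeTensor r' r) (exchangeUnit V) (ε_ Y Y')) :
    ExchangeNat (exchangeUnit V) (exchangeTensor r r') (η_ Y Y') := by
  have := comp_rotateExchange h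
  refine exchangeNat_coevaluation ?_
  rw [← IsIso.inv_eq_of_hom_inv_id this, IsIso.inv_hom_id]

/-- If evaluation is compatible with the exchanges with `Z`, so is coevaluation. -/
theorem NatExchange.coevaluation {Z Y Y' : C} [ExactPairing Y Y'] {r' : Y' ⊗ Z ⟶ Z ⊗ Y'}
    {r : Y ⊗ Z ⟶ Z ⊗ Y} [IsIso r]
    (h : NatExchange (tensorExchange r' r) (unitExchange Z) (ε_ Y Y')) :
    NatExchange (unitExchange Z) (tensorExchange r r') (η_ Y Y') := by
  unfold NatExchange tensorExchange unitExchange at *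
  -- `s`, the rotation of `r'`, is inverse to `r`.
  let s : Z ⊗ Y ⟶ Y ⊗ Z :=
    𝟙 _ ⊗≫ η_ Y Y' ▷ (Z ⊗ Y) ⊗≫ Y ◁ r' ▷ Y ⊗≫ (Y ⊗ Z) ◁ ε_ Y Y' ⊗≫ 𝟙 _
  have h1 : r ≫ s = 𝟙 _ := by
    calc _ = 𝟙 _ ⊗≫ ((𝟙_ C) ◁ r ≫ η_ Y Y' ▷ (Z ⊗ Y)) ⊗≫ Y ◁ r' ▷ Y ⊗≫ (Y ⊗ Z) ◁ ε_ Y Y' ⊗≫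
          𝟙 _ := by dsimp only [s]; monoidal
      _ = 𝟙 _ ⊗≫ η_ Y Y' ▷ (Y ⊗ Z) ⊗≫ Y ◁ (((α_ Y' Y Z).hom ≫ Y' ◁ r ≫ (α_ Y' Z Y).inv ≫
          r' ▷ Y ≫ (α_ Z Y' Y).hom) ≫ Z ◁ ε_ Y Y') ⊗≫ 𝟙 _ := by
        rw [whisker_exchange]; monoidal
      _ = 𝟙 _ ⊗≫ (η_ Y Y' ▷ Y ⊗≫ Y ◁ ε_ Y Y') ▷ Z ⊗≫ 𝟙 _ := by rw [← h]; monoidal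
      _ = _ := by rw [ExactPairing.evaluation_coevaluation'']; monoidal
  have h2 : s ≫ r = 𝟙 _ := by
    rw [← IsIso.inv_eq_of_hom_inv_id h1, IsIso.inv_hom_id]
  symm
  calc _ = 𝟙 _ ⊗≫ Z ◁ η_ Y Y' ⊗≫ (s ≫ r) ▷ Y' ⊗≫ 𝟙 _ := by rw [h2]; monoidal
    _ = 𝟙 _ ⊗≫ ((𝟙_ C) ◁ (Z ◁ η_ Y Y') ≫ η_ Y Y' ▷ (Z ⊗ (Y ⊗ Y'))) ⊗≫ Y ◁ r' ▷ Y ▷ Y' ⊗≫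
          (Y ⊗ Z) ◁ ε_ Y Y' ▷ Y' ⊗≫ r ▷ Y' ⊗≫ 𝟙 _ := by dsimp only [s]; monoidal
    _ = 𝟙 _ ⊗≫ η_ Y Y' ▷ Z ⊗≫ Y ◁ ((Y' ⊗ Z) ◁ η_ Y Y' ≫ r' ▷ (Y ⊗ Y')) ⊗≫
          (Y ⊗ Z) ◁ ε_ Y Y' ▷ Y' ⊗≫ r ▷ Y' ⊗≫ 𝟙 _ := by rw [whisker_exchange]; monoidal
    _ = 𝟙 _ ⊗≫ η_ Y Y' ▷ Z ⊗≫ Y ◁ r' ⊗≫ (Y ⊗ Z) ◁ (Y' ◁ η_ Y Y' ⊗≫ ε_ Y Y' ▷ Y') ⊗≫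
          r ▷ Y' ⊗≫ 𝟙 _ := by rw [whisker_exchange]; monoidal
    _ = _ := by rw [ExactPairing.coevaluation_evaluation'']; monoidal

/-- Evaluation compatible with the exchanges with `V` and `W` is so with `V ⊗ W`. -/
theorem ExchangeNat.tensorExchange_evaluation {V W Y Y' : C} [ExactPairing Y Y']
    {a' : V ⊗ Y' ⟶ Y' ⊗ V} {a : V ⊗ Y ⟶ Y ⊗ V} {b' : W ⊗ Y' ⟶ Y' ⊗ W} {b : W ⊗ Y ⟶ Y ⊗ W}
    (h : ExchangeNat (exchangeTensor a' a) (exchangeUnit V) (ε_ Y Y'))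
    (h' : ExchangeNat (exchangeTensor b' b) (exchangeUnit W) (ε_ Y Y')) :
    ExchangeNat (exchangeTensor (BraidedFRT.tensorExchange a' b')
      (BraidedFRT.tensorExchange a b)) (exchangeUnit (V ⊗ W)) (ε_ Y Y') := by
  rw [exchangeTensor_tensorExchange]
  have := ExchangeNat.tensorExchange h h'
  convert this using 1
  unfold BraidedFRT.tensorExchange exchangeUnit
  monoidal

theorem exchangeNat_unit {A B : C} (f : A ⟶ B) :
    ExchangeNat (unitExchange A) (unitExchange B) f := by
  unfold ExchangeNat unitExchange; simp

theorem exchangeTensor_unitExchange (A B : C) :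
    exchangeTensor (unitExchange A) (unitExchange B) = unitExchange (A ⊗ B) := by
  unfold exchangeTensor unitExchange; monoidal

theorem tensorExchange_exchangeUnit (A B : C) :
    tensorExchange (exchangeUnit A) (exchangeUnit B) = exchangeUnit (A ⊗ B) := by
  unfold tensorExchange exchangeUnit; monoidal

theorem exchangeUnit_unit : exchangeUnit (𝟙_ C) = unitExchange (𝟙_ C) := by
  unfold exchangeUnit unitExchange; monoidal

/-- Compatibility of the nested evaluation with the exchanges with `V`. -/
theorem ExchangeNat.nest {V A A' B B' : C} [ExactPairing A A'] [ExactPairing B B']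
    {a' : V ⊗ A' ⟶ A' ⊗ V} {a : V ⊗ A ⟶ A ⊗ V} {b' : V ⊗ B' ⟶ B' ⊗ V} {b : V ⊗ B ⟶ B ⊗ V}
    (h : ExchangeNat (exchangeTensor a' a) (exchangeUnit V) (ε_ A A'))
    (h' : ExchangeNat (exchangeTensor b' b) (exchangeUnit V) (ε_ B B')) :
    ExchangeNat (exchangeTensor (exchangeTensor b' a') (exchangeTensor a b)) (exchangeUnit V)
      (ε_ (A ⊗ B) (B' ⊗ A')) := by
  unfold ExchangeNat BraidedFRT.exchangeTensor exchangeUnit at *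
  rw [ExactPairing.tensor_evaluation]
  symm
  calc _ = 𝟙 _ ⊗≫ b' ▷ (A' ⊗ (A ⊗ B)) ⊗≫ B' ◁ a' ▷ A ▷ B ⊗≫ B' ◁ A' ◁ a ▷ B ⊗≫
        B' ◁ ((A' ⊗ A) ◁ b ≫ ε_ A A' ▷ (B ⊗ V)) ⊗≫ ε_ B B' ▷ V ⊗≫ 𝟙 _ := by monoidal
    _ = 𝟙 _ ⊗≫ b' ▷ (A' ⊗ (A ⊗ B)) ⊗≫ B' ◁ (((α_ V A' A).inv ≫ a' ▷ A ≫ (α_ A' V A).hom ≫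
          A' ◁ a ≫ (α_ A' A V).inv) ≫ ε_ A A' ▷ V) ▷ B ⊗≫
        B' ◁ b ⊗≫ ε_ B B' ▷ V ⊗≫ 𝟙 _ := by rw [whisker_exchange]; monoidal
    _ = 𝟙 _ ⊗≫ (b' ▷ (A' ⊗ A) ≫ (B' ⊗ V) ◁ ε_ A A') ▷ B ⊗≫
        B' ◁ b ⊗≫ ε_ B B' ▷ V ⊗≫ 𝟙 _ := by rw [← h]; monoidal
    _ = 𝟙 _ ⊗≫ V ◁ B' ◁ ε_ A A' ▷ B ⊗≫ (((α_ V B' B).inv ≫ b' ▷ B ≫ (α_ B' V B).hom ≫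
          B' ◁ b ≫ (α_ B' B V).inv) ≫ ε_ B B' ▷ V) ⊗≫ 𝟙 _ := by rw [← whisker_exchange]; monoidal
    _ = _ := by rw [← h']; monoidal

/-- Naturality of rotation in the rotated object. -/
theorem rotateExchange_mate {V Y Z : C} {Y' Z' : C} [ExactPairing Y Y'] [ExactPairing Z Z']
    {r : V ⊗ Y ⟶ Y ⊗ V} {s : V ⊗ Z ⟶ Z ⊗ V} {f : Y ⟶ Z} (h : ExchangeNat r s f) :
    mate Y' Z' f ▷ V ≫ rotateExchange Y' r = rotateExchange Z' s ≫ V ◁ mate Y' Z' f := by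
  unfold ExchangeNat at h
  unfold rotateExchange
  calc _ = 𝟙 _ ⊗≫ (mate Y' Z' f ▷ (V ⊗ 𝟙_ C) ≫ Y' ◁ (V ◁ η_ Y Y')) ⊗≫ Y' ◁ r ▷ Y' ⊗≫
        ε_ Y Y' ▷ (V ⊗ Y') ⊗≫ 𝟙 _ := by monoidal
    _ = 𝟙 _ ⊗≫ Z' ◁ V ◁ η_ Y Y' ⊗≫ (mate Y' Z' f ▷ (V ⊗ Y) ≫ Y' ◁ r) ▷ Y' ⊗≫
        ε_ Y Y' ▷ (V ⊗ Y') ⊗≫ 𝟙 _ := by rw [← whisker_exchange]; monoidal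
    _ = 𝟙 _ ⊗≫ Z' ◁ V ◁ η_ Y Y' ⊗≫ Z' ◁ r ▷ Y' ⊗≫
        (mate Y' Z' f ▷ Y ≫ ε_ Y Y') ▷ (V ⊗ Y') ⊗≫ 𝟙 _ := by rw [← whisker_exchange]; monoidal
    _ = 𝟙 _ ⊗≫ Z' ◁ V ◁ η_ Y Y' ⊗≫ Z' ◁ (r ≫ f ▷ V) ▷ Y' ⊗≫
        ε_ Z Z' ▷ (V ⊗ Y') ⊗≫ 𝟙 _ := by rw [mate_evaluation]; monoidal
    _ = 𝟙 _ ⊗≫ Z' ◁ V ◁ (η_ Y Y' ≫ f ▷ Y') ⊗≫ Z' ◁ s ▷ Y' ⊗≫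
        ε_ Z Z' ▷ (V ⊗ Y') ⊗≫ 𝟙 _ := by rw [← h]; monoidal
    _ = 𝟙 _ ⊗≫ Z' ◁ V ◁ η_ Z Z' ⊗≫ Z' ◁ ((V ⊗ Z) ◁ mate Y' Z' f ≫ s ▷ Y') ⊗≫
        ε_ Z Z' ▷ (V ⊗ Y') ⊗≫ 𝟙 _ := by rw [← coevaluation_mate Y' Z']; monoidal
    _ = 𝟙 _ ⊗≫ Z' ◁ V ◁ η_ Z Z' ⊗≫ Z' ◁ s ▷ Z' ⊗≫ ((Z' ⊗ Z) ◁ (V ◁ mate Y' Z' f) ≫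
        ε_ Z Z' ▷ (V ⊗ Y')) ⊗≫ 𝟙 _ := by rw [whisker_exchange]; monoidal
    _ = _ := by rw [whisker_exchange]; monoidal

/-- Naturality of rotation in the other object. -/
theorem rotateExchange_natural {V W Y : C} {Y' : C} [ExactPairing Y Y']
    {r : V ⊗ Y ⟶ Y ⊗ V} {s : W ⊗ Y ⟶ Y ⊗ W} {f : V ⟶ W} (h : NatExchange r s f) :
    Y' ◁ f ≫ rotateExchange Y' s = rotateExchange Y' r ≫ f ▷ Y' := by
  unfold NatExchange at h
  unfold rotateExchange
  calc _ = 𝟙 _ ⊗≫ Y' ◁ (f ▷ (𝟙_ C) ≫ W ◁ η_ Y Y') ⊗≫ Y' ◁ s ▷ Y' ⊗≫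
        ε_ Y Y' ▷ (W ⊗ Y') ⊗≫ 𝟙 _ := by monoidal
    _ = 𝟙 _ ⊗≫ Y' ◁ V ◁ η_ Y Y' ⊗≫ Y' ◁ (f ▷ Y ≫ s) ▷ Y' ⊗≫
        ε_ Y Y' ▷ (W ⊗ Y') ⊗≫ 𝟙 _ := by rw [← whisker_exchange]; monoidal
    _ = 𝟙 _ ⊗≫ Y' ◁ V ◁ η_ Y Y' ⊗≫ Y' ◁ r ▷ Y' ⊗≫ ((Y' ⊗ Y) ◁ (f ▷ Y') ≫
        ε_ Y Y' ▷ (W ⊗ Y')) ⊗≫ 𝟙 _ := by rw [h]; monoidal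
    _ = _ := by rw [whisker_exchange]; monoidal

/-! ### Functionals given by an endomorphism of `V ⊗ W'` -/

/-- The functional on `(V' ⊗ V) ⊗ (W' ⊗ W)` which applies `T : V ⊗ W' ⟶ V ⊗ W'` to the two middle
factors before the evaluations. -/
def innerPairing {V W' : C} (V' W : C) [ExactPairing V V'] [ExactPairing W W']
    (T : V ⊗ W' ⟶ V ⊗ W') : (V' ⊗ V) ⊗ (W' ⊗ W) ⟶ 𝟙_ C :=
  𝟙 ((V' ⊗ V) ⊗ (W' ⊗ W)) ⊗≫ V' ◁ T ▷ W ⊗≫ (ε_ V V' ⊗ₘ ε_ W W') ≫ (λ_ (𝟙_ C)).hom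

theorem innerPairing_eq {V W' : C} (V' W : C) [ExactPairing V V'] [ExactPairing W W']
    (T : V ⊗ W' ⟶ V ⊗ W') :
    innerPairing V' W T = 𝟙 _ ⊗≫ V' ◁ T ▷ W ⊗≫ ε_ V V' ▷ (W' ⊗ W) ⊗≫ ε_ W W' := by
  unfold innerPairing
  rw [MonoidalCategory.tensorHom_def]
  monoidal

theorem innerPairing_eq' {V W' : C} (V' W : C) [ExactPairing V V'] [ExactPairing W W']
    (T : V ⊗ W' ⟶ V ⊗ W') :
    innerPairing V' W T = 𝟙 _ ⊗≫ V' ◁ T ▷ W ⊗≫ (V' ⊗ V) ◁ ε_ W W' ⊗≫ ε_ V V' := by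
  unfold innerPairing
  rw [MonoidalCategory.tensorHom_def']
  monoidal

theorem innerPairing_id {V W : C} (V' W' : C) [ExactPairing V V'] [ExactPairing W W'] :
    innerPairing V' W (𝟙 (V ⊗ W')) = (ε_ V V' ⊗ₘ ε_ W W') ≫ (λ_ (𝟙_ C)).hom := by
  unfold innerPairing
  monoidal

/-- The functional respects the relation for `f` in its first argument as soon as `S` and `T`
intertwine `f`. -/
theorem innerPairing_dinatural_left {V U W' : C} (V' U' W : C) [ExactPairing V V']
    [ExactPairing U U'] [ExactPairing W W'] {S : V ⊗ W' ⟶ V ⊗ W'} {T : U ⊗ W' ⟶ U ⊗ W'}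
    {f : V ⟶ U} (h : f ▷ W' ≫ T = S ≫ f ▷ W') :
    (mate V' U' f ▷ V) ▷ (W' ⊗ W) ≫ innerPairing V' W S =
      (U' ◁ f) ▷ (W' ⊗ W) ≫ innerPairing U' W T := by
  rw [innerPairing_eq', innerPairing_eq']
  calc _ = 𝟙 _ ⊗≫ (mate V' U' f ▷ (V ⊗ W') ≫ V' ◁ S) ▷ W ⊗≫ (V' ⊗ V) ◁ ε_ W W' ⊗≫ ε_ V V' := by
        monoidal
    _ = 𝟙 _ ⊗≫ U' ◁ S ▷ W ⊗≫ (mate V' U' f ▷ (V ⊗ (W' ⊗ W)) ≫ V' ◁ (V ◁ ε_ W W')) ⊗≫ ε_ V V' := by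
        rw [← whisker_exchange]; monoidal
    _ = 𝟙 _ ⊗≫ U' ◁ S ▷ W ⊗≫ (U' ⊗ V) ◁ ε_ W W' ⊗≫ mate V' U' f ▷ V ≫ ε_ V V' := by
        rw [← whisker_exchange]; monoidal
    _ = 𝟙 _ ⊗≫ U' ◁ S ▷ W ⊗≫ U' ◁ (V ◁ ε_ W W' ≫ f ▷ (𝟙_ C)) ⊗≫ ε_ U U' := by
        rw [mate_evaluation]; monoidal
    _ = 𝟙 _ ⊗≫ U' ◁ (S ≫ f ▷ W') ▷ W ⊗≫ (U' ⊗ U) ◁ ε_ W W' ⊗≫ ε_ U U' := by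
        rw [whisker_exchange]; monoidal
    _ = _ := by rw [← h]; monoidal

/-- The functional respects the relation for `f` in its second argument as soon as `S` and `T`
intertwine the dual of `f`. -/
theorem innerPairing_dinatural_right {V U' W' : C} (V' U W : C) [ExactPairing V V']
    [ExactPairing U U'] [ExactPairing W W'] {S : V ⊗ W' ⟶ V ⊗ W'} {T : V ⊗ U' ⟶ V ⊗ U'}
    {f : W ⟶ U} (h : V ◁ mate W' U' f ≫ S = T ≫ V ◁ mate W' U' f) :
    (V' ⊗ V) ◁ (mate W' U' f ▷ W) ≫ innerPairing V' W S =
      (V' ⊗ V) ◁ (U' ◁ f) ≫ innerPairing V' U T := by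
  rw [innerPairing_eq, innerPairing_eq]
  calc _ = 𝟙 _ ⊗≫ V' ◁ (V ◁ mate W' U' f ≫ S) ▷ W ⊗≫ ε_ V V' ▷ (W' ⊗ W) ⊗≫ ε_ W W' := by
        monoidal
    _ = 𝟙 _ ⊗≫ V' ◁ T ▷ W ⊗≫ ((V' ⊗ V) ◁ (mate W' U' f ▷ W) ≫ ε_ V V' ▷ (W' ⊗ W)) ⊗≫ ε_ W W' := by
        rw [h]; monoidal
    _ = 𝟙 _ ⊗≫ V' ◁ T ▷ W ⊗≫ ε_ V V' ▷ (U' ⊗ W) ⊗≫ mate W' U' f ▷ W ≫ ε_ W W' := by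
        rw [whisker_exchange]; monoidal
    _ = 𝟙 _ ⊗≫ V' ◁ T ▷ W ⊗≫ (ε_ V V' ▷ (U' ⊗ W) ≫ (𝟙_ C) ◁ (U' ◁ f)) ⊗≫ ε_ U U' := by
        rw [mate_evaluation]; monoidal
    _ = 𝟙 _ ⊗≫ V' ◁ (T ▷ W ≫ (V ⊗ U') ◁ f) ⊗≫ ε_ V V' ▷ (U' ⊗ U) ⊗≫ ε_ U U' := by
        rw [← whisker_exchange]; monoidal
    _ = _ := by rw [← whisker_exchange]; monoidal

/-- The second product of pairings corresponds to the composition of endomorphisms. -/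
theorem insertCoev_innerPairing {V W : C} (V' W' : C) [ExactPairing V V'] [ExactPairing W W']
    (S T : V ⊗ W' ⟶ V ⊗ W') :
    (insertCoev V' V V V' ⊗ₘ insertCoev W' W W W') ≫
      nest (innerPairing V' W S) (innerPairing V' W T) = innerPairing V' W (T ≫ S) := by
  -- The part of the diagram that contains `T` straightens to `T`.
  have key : 𝟙 _ ⊗≫ η_ V V' ▷ (V ⊗ W') ⊗≫ (V ⊗ V') ◁ (V ⊗ W') ◁ η_ W W' ⊗≫
      (V ⊗ V') ◁ T ▷ (W ⊗ W') ⊗≫ V ◁ (ε_ V V' ▷ (W' ⊗ W) ⊗≫ ε_ W W') ▷ W' ⊗≫ 𝟙 _ = T := by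
    calc _ = 𝟙 _ ⊗≫ η_ V V' ▷ (V ⊗ W') ⊗≫ (V ⊗ V') ◁ ((V ⊗ W') ◁ η_ W W' ≫ T ▷ (W ⊗ W')) ⊗≫
          V ◁ (ε_ V V' ▷ (W' ⊗ W) ⊗≫ ε_ W W') ▷ W' ⊗≫ 𝟙 _ := by monoidal
      _ = 𝟙 _ ⊗≫ (η_ V V' ▷ (V ⊗ W') ≫ (V ⊗ V') ◁ T) ⊗≫ (V ⊗ V') ◁ (V ⊗ W') ◁ η_ W W' ⊗≫
          V ◁ (ε_ V V' ▷ (W' ⊗ W) ≫ (𝟙_ C) ◁ ε_ W W') ▷ W' ⊗≫ 𝟙 _ := by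
        rw [whisker_exchange]; monoidal
      _ = 𝟙 _ ⊗≫ T ⊗≫ η_ V V' ▷ (V ⊗ W') ⊗≫
          V ◁ ((V' ⊗ V) ◁ W' ◁ η_ W W' ≫ ε_ V V' ▷ (W' ⊗ (W ⊗ W'))) ⊗≫ V ◁ ε_ W W' ▷ W' ⊗≫ 𝟙 _ := by
        rw [← whisker_exchange]; monoidal
      _ = 𝟙 _ ⊗≫ T ⊗≫ (η_ V V' ▷ V ⊗≫ V ◁ ε_ V V') ▷ W' ⊗≫
          V ◁ (W' ◁ η_ W W' ⊗≫ ε_ W W' ▷ W') ⊗≫ 𝟙 _ := by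
        rw [whisker_exchange]; monoidal
      _ = _ := by
        rw [ExactPairing.evaluation_coevaluation'', ExactPairing.coevaluation_evaluation'']
        monoidal
  simp only [innerPairing_eq]
  unfold nest
  rw [insertCoev_eq, insertCoev_eq, MonoidalCategory.tensorHom_def]
  calc _ = 𝟙 _ ⊗≫ V' ◁ (𝟙 (V ⊗ W') ⊗≫ η_ V V' ▷ (V ⊗ W') ⊗≫ (V ⊗ V') ◁ (V ⊗ W') ◁ η_ W W' ⊗≫
      (V ⊗ V') ◁ T ▷ (W ⊗ W') ⊗≫ V ◁ (ε_ V V' ▷ (W' ⊗ W) ⊗≫ ε_ W W') ▷ W' ⊗≫ 𝟙 (V ⊗ W')) ▷ W ⊗≫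
        V' ◁ S ▷ W ⊗≫ ε_ V V' ▷ (W' ⊗ W) ⊗≫ ε_ W W' := by monoidal
    _ = _ := by rw [key]; monoidal

end HalfBraidings

/-! ### The multiplication and the pairing of coefficient objects -/

section CrossMul

variable {C : Type u} [Category.{v} C] [MonoidalCategory C] [BraidedCategory C]

/-- The multiplication `(P' ⊗ P) ⊗ (Q' ⊗ Q) ⟶ (Q' ⊗ P') ⊗ (P ⊗ Q)`, given by the braiding of
`P' ⊗ P` with `Q'`. -/
def crossMul (P' P Q' Q : C) : (P' ⊗ P) ⊗ (Q' ⊗ Q) ⟶ (Q' ⊗ P') ⊗ (P ⊗ Q) :=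
  (α_ (P' ⊗ P) Q' Q).inv ≫ (β_ (P' ⊗ P) Q').hom ▷ Q ≫ (α_ Q' P' P).inv ▷ Q ≫
    (α_ (Q' ⊗ P') P Q).hom

theorem crossMul_eq (P' P Q' Q : C) :
    crossMul P' P Q' Q = 𝟙 _ ⊗≫ (β_ (P' ⊗ P) Q').hom ▷ Q ⊗≫ 𝟙 _ := by
  unfold crossMul; monoidal

instance (P' P Q' Q : C) : IsIso (crossMul P' P Q' Q) := by unfold crossMul; infer_instance

theorem crossMul_natural {P' P Q' Q A' A B' B : C} (p' : P' ⟶ A') (p : P ⟶ A) (q' : Q' ⟶ B')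
    (q : Q ⟶ B) : ((p' ⊗ₘ p) ⊗ₘ (q' ⊗ₘ q)) ≫ crossMul A' A B' B =
      crossMul P' P Q' Q ≫ ((q' ⊗ₘ p') ⊗ₘ (p ⊗ₘ q)) := by
  rw [crossMul_eq, crossMul_eq]
  calc _ = 𝟙 _ ⊗≫ (((p' ⊗ₘ p) ⊗ₘ q') ≫ (β_ (A' ⊗ A) B').hom ⊗ₘ q) ⊗≫ 𝟙 _ := by
        simp only [MonoidalCategory.tensorHom_def]
        calc _ = 𝟙 _ ⊗≫ (p' ▷ P ≫ A' ◁ p) ▷ (Q' ⊗ Q) ⊗≫ (A' ⊗ A) ◁ q' ▷ Q ⊗≫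
              (((A' ⊗ A) ⊗ B') ◁ q ≫ (β_ (A' ⊗ A) B').hom ▷ B) ⊗≫ 𝟙 _ := by monoidal
          _ = _ := by rw [whisker_exchange]; monoidal
    _ = _ := by
        rw [BraidedCategory.braiding_naturality]
        simp only [MonoidalCategory.tensorHom_def]
        monoidal

theorem crossMul_assoc (P' P Q' Q U' U : C) :
    crossMul P' P Q' Q ▷ (U' ⊗ U) ≫ crossMul (Q' ⊗ P') (P ⊗ Q) U' U ≫
        ((α_ U' Q' P').inv ⊗ₘ (α_ P Q U).hom) =
      (α_ (P' ⊗ P) (Q' ⊗ Q) (U' ⊗ U)).hom ≫ (P' ⊗ P) ◁ crossMul Q' Q U' U ≫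
        crossMul P' P (U' ⊗ Q') (Q ⊗ U) := by
  rw [MonoidalCategory.tensorHom_def]
  have h : (crossMul P' P Q' Q ▷ U' ≫ (β_ ((Q' ⊗ P') ⊗ (P ⊗ Q)) U').hom) =
      (β_ _ U').hom ≫ U' ◁ crossMul P' P Q' Q := BraidedCategory.braiding_naturality_left _ _
  calc _ = 𝟙 _ ⊗≫ (crossMul P' P Q' Q ▷ U' ≫ (β_ ((Q' ⊗ P') ⊗ (P ⊗ Q)) U').hom) ▷ U ⊗≫ 𝟙 _ := by
        rw [crossMul_eq (Q' ⊗ P')]; monoidal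
    _ = _ := by
        rw [h]
        simp only [crossMul_eq, BraidedCategory.braiding_tensor_left_hom _ (Q' ⊗ Q),
          BraidedCategory.braiding_tensor_right_hom (P' ⊗ P)]
        monoidal

theorem crossMul_one_left (Q' Q : C) :
    (λ_ (𝟙_ C)).inv ▷ (Q' ⊗ Q) ≫ crossMul (𝟙_ C) (𝟙_ C) Q' Q ≫ ((ρ_ Q').hom ⊗ₘ (λ_ Q).hom) =
      (λ_ (Q' ⊗ Q)).hom := by
  rw [MonoidalCategory.tensorHom_def, crossMul_eq, BraidedCategory.braiding_tensor_left_hom,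
    braiding_tensorUnit_left]
  monoidal

theorem crossMul_one_right (P' P : C) :
    (P' ⊗ P) ◁ (λ_ (𝟙_ C)).inv ≫ crossMul P' P (𝟙_ C) (𝟙_ C) ≫ ((λ_ P').hom ⊗ₘ (ρ_ P).hom) =
      (ρ_ (P' ⊗ P)).hom := by
  rw [MonoidalCategory.tensorHom_def, crossMul_eq,
    braiding_tensorUnit_right]
  monoidal

theorem tensorμ_eq (P' P Q' Q : C) :
    tensorμ P' P Q' Q = 𝟙 _ ⊗≫ P' ◁ (β_ P Q').hom ▷ Q ⊗≫ 𝟙 _ := by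
  unfold tensorμ; monoidal

/-- The multiplication is a morphism of coalgebras into the coefficient coalgebra of `V ⊗ W`. -/
theorem crossMul_comul {V W : C} (V' W' : C) [ExactPairing V V'] [ExactPairing W W'] :
    crossMul V' V W' W ≫ insertCoev (W' ⊗ V') (V ⊗ W) (V ⊗ W) (W' ⊗ V') =
      (insertCoev V' V V V' ⊗ₘ insertCoev W' W W W') ≫
        tensorμ (V' ⊗ V) (V' ⊗ V) (W' ⊗ W) (W' ⊗ W) ≫
          (crossMul V' V W' W ⊗ₘ crossMul V' V W' W) := by
  simp only [MonoidalCategory.tensorHom_def, tensorμ_eq]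
  have h1 : (V' ⊗ V) ◁ η_ W W' ≫ (β_ (V' ⊗ V) (W ⊗ W')).hom = (ρ_ _).hom ≫ (λ_ _).inv ≫
      η_ W W' ▷ (V' ⊗ V) := by
    rw [BraidedCategory.braiding_naturality_right, braiding_tensorUnit_right]
    simp
  have h2 : insertCoev V' V V V' ▷ W' ≫ (β_ ((V' ⊗ V) ⊗ (V' ⊗ V)) W').hom =
      (β_ (V' ⊗ V) W').hom ≫ W' ◁ insertCoev V' V V V' :=
    BraidedCategory.braiding_naturality_left _ _
  symm
  calc _ = 𝟙 _ ⊗≫ insertCoev V' V V V' ▷ (W' ⊗ W) ⊗≫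
        (V' ⊗ V) ◁ (β_ (V' ⊗ V) W').hom ▷ W ⊗≫ ((V' ⊗ V) ⊗ W') ◁
          ((V' ⊗ V) ◁ η_ W W' ≫ (β_ (V' ⊗ V) (W ⊗ W')).hom) ▷ W ⊗≫
        (β_ (V' ⊗ V) W').hom ▷ (W ⊗ W' ⊗ V' ⊗ V ⊗ W) ⊗≫ 𝟙 _ := by
        calc _ = 𝟙 _ ⊗≫ insertCoev V' V V V' ▷ (W' ⊗ W) ⊗≫ (V' ⊗ V) ◁
              (((V' ⊗ V) ⊗ W') ◁ η_ W W' ≫ (β_ (V' ⊗ V) W').hom ▷ (W ⊗ W')) ▷ W ⊗≫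
              ((V' ⊗ V) ⊗ W') ◁ (β_ (V' ⊗ V) W).hom ▷ (W' ⊗ W) ⊗≫
              ((β_ (V' ⊗ V) W').hom ▷ (W ⊗ ((V' ⊗ V) ⊗ W')) ≫ (W' ⊗ (V' ⊗ V)) ◁
                W ◁ (β_ (V' ⊗ V) W').hom) ▷ W ⊗≫ 𝟙 _ := by
              rw [insertCoev_eq W' W, BraidedCategory.braiding_tensor_right_hom (V' ⊗ V) W' W,
                crossMul_eq]
              monoidal
          _ = _ := by
              rw [whisker_exchange,
                ← whisker_exchange (β_ (V' ⊗ V) W').hom (W ◁ (β_ (V' ⊗ V) W').hom),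
                BraidedCategory.braiding_tensor_right_hom (V' ⊗ V) W W']
              monoidal
    _ = 𝟙 _ ⊗≫ (insertCoev V' V V V' ▷ W' ≫ (β_ ((V' ⊗ V) ⊗ (V' ⊗ V)) W').hom) ▷ W ⊗≫
          (W' ⊗ V' ⊗ V) ◁ η_ W W' ▷ (V' ⊗ V ⊗ W) ⊗≫ 𝟙 _ := by
        rw [h1]
        calc _ = 𝟙 _ ⊗≫ insertCoev V' V V V' ▷ (W' ⊗ W) ⊗≫ (V' ⊗ V) ◁ (β_ (V' ⊗ V) W').hom ▷ W ⊗≫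
              (((V' ⊗ V) ⊗ W') ◁ η_ W W' ≫ (β_ (V' ⊗ V) W').hom ▷ (W ⊗ W')) ▷ (V' ⊗ V ⊗ W) ⊗≫
              𝟙 _ := by monoidal
          _ = _ := by
              rw [whisker_exchange, BraidedCategory.braiding_tensor_left_hom (V' ⊗ V) (V' ⊗ V) W']
              monoidal
    _ = 𝟙 _ ⊗≫ (β_ (V' ⊗ V) W').hom ▷ W ⊗≫ W' ◁ insertCoev V' V V V' ▷ W ⊗≫
          (W' ⊗ V' ⊗ V) ◁ η_ W W' ▷ (V' ⊗ V ⊗ W) ⊗≫ 𝟙 _ := by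
        rw [h2]; monoidal
    _ = _ := by
        simp only [insertCoev_eq, crossMul_eq, ExactPairing.tensor_coevaluation]
        monoidal

theorem crossMul_counit {V W : C} (V' W' : C) [ExactPairing V V'] [ExactPairing W W'] :
    crossMul V' V W' W ≫ ε_ (V ⊗ W) (W' ⊗ V') = (ε_ V V' ⊗ₘ ε_ W W') ≫ (λ_ (𝟙_ C)).hom := by
  rw [MonoidalCategory.tensorHom_def, crossMul_eq, ExactPairing.tensor_evaluation]
  have h : ε_ V V' ▷ W' ≫ (β_ (𝟙_ C) W').hom = (β_ (V' ⊗ V) W').hom ≫ W' ◁ ε_ V V' :=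
    BraidedCategory.braiding_naturality_left _ _
  calc _ = 𝟙 _ ⊗≫ ((β_ (V' ⊗ V) W').hom ≫ W' ◁ ε_ V V') ▷ W ⊗≫ ε_ W W' := by monoidal
    _ = _ := by rw [← h, braiding_tensorUnit_left]; monoidal

/-- The exchange of the two middle factors is the multiplication, up to the braiding of the duals.
-/
theorem tensorμ_eq_crossMul (P' P Q' Q : C) :
    tensorμ P' P Q' Q = crossMul P' P Q' Q ≫ (β_ P' Q').inv ▷ (P ⊗ Q) := by
  rw [tensorμ_eq, crossMul_eq, BraidedCategory.braiding_tensor_left_hom]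
  calc _ = 𝟙 _ ⊗≫ P' ◁ (β_ P Q').hom ▷ Q ⊗≫ ((β_ P' Q').hom ≫ (β_ P' Q').inv) ▷ (P ⊗ Q) ⊗≫ 𝟙 _ := by
        rw [Iso.hom_inv_id]; monoidal
    _ = _ := by monoidal

/-- The opposite of the multiplication formed with the inverse braiding. -/
theorem braiding_crossMul_reverse (P' P Q' Q : C) :
    (β_ (P' ⊗ P) (Q' ⊗ Q)).hom ≫ @crossMul C _ _ (reverseBraiding C) Q' Q P' P =
      crossMul P' P Q' Q ≫ ((β_ P' Q').inv ⊗ₘ (β_ P Q).hom) := by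
  have : @crossMul C _ _ (reverseBraiding C) Q' Q P' P =
    𝟙 _ ⊗≫ (β_ P' (Q' ⊗ Q)).inv ▷ P ⊗≫ 𝟙 _ := @crossMul_eq C _ _ (reverseBraiding C) Q' Q P' P
  rw [this, MonoidalCategory.tensorHom_def, ← Category.assoc (crossMul _ _ _ _),
    ← tensorμ_eq_crossMul,
    BraidedCategory.braiding_tensor_left_hom, tensorμ_eq]
  calc _ = 𝟙 _ ⊗≫ P' ◁ (β_ P (Q' ⊗ Q)).hom ⊗≫ ((β_ P' (Q' ⊗ Q)).hom ≫ (β_ P' (Q' ⊗ Q)).inv) ▷ P ⊗≫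
          𝟙 _ := by monoidal
    _ = _ := by rw [Iso.hom_inv_id, BraidedCategory.braiding_tensor_right_hom]; monoidal

/-- The dual of the braiding is the braiding of the duals. -/
theorem mate_braiding {V W : C} (V' W' : C) [ExactPairing V V'] [ExactPairing W W'] :
    mate (W' ⊗ V') (V' ⊗ W') (β_ V W).hom = (β_ V' W').hom := by
  apply mate_unique
  rw [ExactPairing.tensor_evaluation, ExactPairing.tensor_evaluation]
  have h1 : ε_ V V' ▷ W' ≫ (β_ (𝟙_ C) W').hom = (β_ (V' ⊗ V) W').hom ≫ W' ◁ ε_ V V' :=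
    BraidedCategory.braiding_naturality_left _ _
  have h2 : V ◁ ε_ W W' ≫ (β_ V (𝟙_ C)).hom = (β_ V (W' ⊗ W)).hom ≫ ε_ W W' ▷ V :=
    BraidedCategory.braiding_naturality_right _ _
  have i1 : (β_ V' W').hom ▷ V ⊗≫ W' ◁ ε_ V V' =
      𝟙 _ ⊗≫ V' ◁ (β_ V W').inv ⊗≫ ε_ V V' ▷ W' ⊗≫ 𝟙 _ := by
    have : (β_ (V' ⊗ V) W').hom ≫ W' ◁ ε_ V V' = ε_ V V' ▷ W' ≫ (λ_ _).hom ≫ (ρ_ _).inv := by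
      rw [← h1, braiding_tensorUnit_left]
    rw [BraidedCategory.braiding_tensor_left_hom] at this
    calc _ = 𝟙 _ ⊗≫ V' ◁ (β_ V W').inv ⊗≫ V' ◁ (β_ V W').hom ⊗≫ (β_ V' W').hom ▷ V ⊗≫
            W' ◁ ε_ V V' := by
          calc _ = 𝟙 _ ⊗≫ V' ◁ ((β_ V W').inv ≫ (β_ V W').hom) ⊗≫ (β_ V' W').hom ▷ V ⊗≫
                W' ◁ ε_ V V' := by rw [Iso.inv_hom_id]; monoidal
            _ = _ := by monoidal
      _ = 𝟙 _ ⊗≫ V' ◁ (β_ V W').inv ⊗≫ (((α_ V' V W').hom ≫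
            V' ◁ (β_ V W').hom ≫ (α_ V' W' V).inv ≫ (β_ V' W').hom ▷ V ≫ (α_ W' V' V).hom) ≫
            W' ◁ ε_ V V') := by monoidal
      _ = _ := by rw [this]; monoidal
  have i2 : 𝟙 ((W' ⊗ V) ⊗ W) ⊗≫ W' ◁ (β_ V W).hom ⊗≫ ε_ W W' ▷ V ⊗≫ 𝟙 V =
      𝟙 _ ⊗≫ (β_ V W').inv ▷ W ⊗≫ V ◁ ε_ W W' ⊗≫ 𝟙 V := by
    have : (β_ V (W' ⊗ W)).hom ≫ ε_ W W' ▷ V = V ◁ ε_ W W' ≫ (ρ_ _).hom ≫ (λ_ _).inv := by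
      rw [← h2, braiding_tensorUnit_right]
    rw [BraidedCategory.braiding_tensor_right_hom] at this
    calc _ = 𝟙 _ ⊗≫ (β_ V W').inv ▷ W ⊗≫ (β_ V W').hom ▷ W ⊗≫ W' ◁ (β_ V W).hom ⊗≫
            ε_ W W' ▷ V ⊗≫ 𝟙 V := by
          calc _ = 𝟙 _ ⊗≫ ((β_ V W').inv ≫ (β_ V W').hom) ▷ W ⊗≫ W' ◁ (β_ V W).hom ⊗≫
                ε_ W W' ▷ V ⊗≫ 𝟙 V := by rw [Iso.inv_hom_id]; monoidal
            _ = _ := by monoidal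
      _ = 𝟙 _ ⊗≫ (β_ V W').inv ▷ W ⊗≫ (((α_ V W' W).inv ≫
            (β_ V W').hom ▷ W ≫ (α_ W' V W).hom ≫ W' ◁ (β_ V W).hom ≫ (α_ W' W V).inv) ≫
            ε_ W W' ▷ V) ⊗≫ 𝟙 V := by monoidal
      _ = _ := by rw [this]; monoidal
  calc _ = 𝟙 _ ⊗≫ ((β_ V' W').hom ▷ V ⊗≫ W' ◁ ε_ V V') ▷ W ⊗≫ ε_ W W' := by monoidal
    _ = 𝟙 _ ⊗≫ V' ◁ (β_ V W').inv ▷ W ⊗≫ (ε_ V V' ▷ (W' ⊗ W) ≫ (𝟙_ C) ◁ ε_ W W') ⊗≫ 𝟙 _ := by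
        rw [i1]; monoidal
    _ = 𝟙 _ ⊗≫ V' ◁ (𝟙 ((W' ⊗ V) ⊗ W) ⊗≫ (β_ V W').inv ▷ W ⊗≫ V ◁ ε_ W W' ⊗≫ 𝟙 V) ⊗≫ ε_ V V' := by
        rw [← whisker_exchange]; monoidal
    _ = _ := by rw [← i2]; monoidal

/-- The pairing `(V' ⊗ V) ⊗ (W' ⊗ W) ⟶ 𝟙` given by `r : V ⊗ W ⟶ W ⊗ V`. -/
def crossPairing {V W : C} (V' W' : C) [ExactPairing V V'] [ExactPairing W W']
    (r : V ⊗ W ⟶ W ⊗ V) : (V' ⊗ V) ⊗ (W' ⊗ W) ⟶ 𝟙_ C :=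
  tensorμ V' V W' W ≫ (V' ⊗ W') ◁ r ≫ nest (ε_ V V') (ε_ W W')

/-- The pairing factors through the multiplication, as the functional of the endomorphism `r ≫
Ψ⁻¹` of `V ⊗ W`. Hence convolution of pairings is composition of such endomorphisms. -/
theorem crossPairing_eq_coeffPairing {V W : C} (V' W' : C) [ExactPairing V V']
    [ExactPairing W W'] (r : V ⊗ W ⟶ W ⊗ V) :
    crossPairing V' W' r =
      crossMul V' V W' W ≫ coeffPairing (V := V ⊗ W) (W' ⊗ V') (r ≫ (β_ V W).inv) := by
  have h : nest (ε_ V V') (ε_ W W') = ε_ (W ⊗ V) (V' ⊗ W') := rfl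
  have hm : mate (V' ⊗ W') (W' ⊗ V') (β_ V W).inv = (β_ V' W').inv := by
    rw [← cancel_epi (β_ V' W').hom, Iso.hom_inv_id, ← mate_braiding (V := V) (W := W),
      mate_hom_inv]
  rw [crossPairing, h, tensorμ_eq_crossMul, Category.assoc, coeffPairing, whiskerLeft_comp,
    Category.assoc, ← mate_evaluation (V' ⊗ W') (W' ⊗ V') (β_ V W).inv, hm, whisker_exchange_assoc]

/-- The pairing in the form suited to the second product of pairings. -/
theorem crossPairing_eq_innerPairing {V W : C} (V' W' : C) [ExactPairing V V']
    [ExactPairing W W'] (r : V ⊗ W ⟶ W ⊗ V) :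
    crossPairing V' W' r = innerPairing V' W ((β_ V W').hom ≫ rotateExchange W' r) := by
  rw [crossPairing, tensorμ_eq, innerPairing_eq']
  unfold nest rotateExchange
  symm
  calc _ = 𝟙 _ ⊗≫ V' ◁ (β_ V W').hom ▷ W ⊗≫ V' ◁ W' ◁ V ◁ η_ W W' ▷ W ⊗≫
          V' ◁ W' ◁ r ▷ (W' ⊗ W) ⊗≫ V' ◁ (ε_ W W' ▷ (V ⊗ (W' ⊗ W)) ≫ (𝟙_ C) ◁ (V ◁ ε_ W W')) ⊗≫
          ε_ V V' := by monoidal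
    _ = 𝟙 _ ⊗≫ V' ◁ (β_ V W').hom ▷ W ⊗≫ V' ◁ W' ◁ V ◁ η_ W W' ▷ W ⊗≫
          V' ◁ W' ◁ (r ▷ (W' ⊗ W) ≫ (W ⊗ V) ◁ ε_ W W') ⊗≫ V' ◁ ε_ W W' ▷ V ⊗≫
          ε_ V V' := by rw [← whisker_exchange]; monoidal
    _ = 𝟙 _ ⊗≫ V' ◁ (β_ V W').hom ▷ W ⊗≫ V' ◁ W' ◁ V ◁ (η_ W W' ▷ W ⊗≫ W ◁ ε_ W W') ⊗≫
          V' ◁ W' ◁ r ⊗≫ V' ◁ ε_ W W' ▷ V ⊗≫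
          ε_ V V' := by rw [← whisker_exchange]; monoidal
    _ = _ := by rw [ExactPairing.evaluation_coevaluation'']; monoidal

end CrossMul

/-! ### Compatibility of the pairing with the bialgebra structure -/

section Rotation

variable {C : Type u} [Category.{v} C] [MonoidalCategory C]

/-- The functionals of `φ` and `ψ` are compatible with the relation for `f` when `f` intertwines
`φ` and `ψ`. -/
theorem coeffPairing_dinatural {V W : C} (V' W' : C) [ExactPairing V V'] [ExactPairing W W']
    {f : V ⟶ W} {φ : V ⟶ V} {ψ : W ⟶ W} (h : f ≫ ψ = φ ≫ f) :
    mate V' W' f ▷ V ≫ coeffPairing V' φ = W' ◁ f ≫ coeffPairing W' ψ := by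
  rw [coeffPairing, coeffPairing, ← whisker_exchange_assoc, mate_evaluation,
    ← whiskerLeft_comp_assoc,
    ← whiskerLeft_comp_assoc, h]

theorem rotateExchange_tensorExchange {A B Y : C} (Y' : C) [ExactPairing Y Y'] (a : A ⊗ Y ⟶ Y ⊗ A)
    (b : B ⊗ Y ⟶ Y ⊗ B) : rotateExchange Y' (tensorExchange a b) =
      𝟙 _ ⊗≫ rotateExchange Y' a ▷ B ⊗≫ A ◁ rotateExchange Y' b ⊗≫ 𝟙 _ := by
  unfold rotateExchange tensorExchange
  symm
  calc _ = 𝟙 _ ⊗≫ Y' ◁ A ◁ η_ Y Y' ▷ B ⊗≫ Y' ◁ a ▷ Y' ▷ B ⊗≫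
          (ε_ Y Y' ▷ (A ⊗ Y' ⊗ B ⊗ 𝟙_ C) ≫ (𝟙_ C) ◁ (A ◁ Y' ◁ B ◁ η_ Y Y')) ⊗≫ A ◁ Y' ◁ b ▷ Y' ⊗≫
          A ◁ ε_ Y Y' ▷ (B ⊗ Y') ⊗≫ 𝟙 _ := by monoidal
    _ = 𝟙 _ ⊗≫ Y' ◁ A ◁ η_ Y Y' ▷ B ⊗≫ Y' ◁ (a ▷ (Y' ⊗ B ⊗ 𝟙_ C) ≫
          (Y ⊗ A) ◁ (Y' ◁ B ◁ η_ Y Y')) ⊗≫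
          (ε_ Y Y' ▷ (A ⊗ Y' ⊗ ((B ⊗ Y) ⊗ Y')) ≫ (𝟙_ C) ◁ (A ◁ Y' ◁ b ▷ Y')) ⊗≫
          A ◁ ε_ Y Y' ▷ (B ⊗ Y') ⊗≫ 𝟙 _ := by rw [← whisker_exchange]; monoidal
    _ = 𝟙 _ ⊗≫ Y' ◁ A ◁ (η_ Y Y' ▷ (B ⊗ 𝟙_ C) ≫ (Y ⊗ Y') ◁ (B ◁ η_ Y Y')) ⊗≫
          Y' ◁ (a ▷ (Y' ⊗ ((B ⊗ Y) ⊗ Y')) ≫ (Y ⊗ A) ◁ (Y' ◁ b ▷ Y')) ⊗≫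
          (ε_ Y Y' ▷ (A ⊗ (Y' ⊗ Y) ⊗ B ⊗ Y') ≫ (𝟙_ C) ◁ (A ◁ ε_ Y Y' ▷ (B ⊗ Y'))) ⊗≫ 𝟙 _ := by
        rw [← whisker_exchange, ← whisker_exchange]; monoidal
    _ = 𝟙 _ ⊗≫ Y' ◁ A ◁ B ◁ η_ Y Y' ⊗≫ Y' ◁ A ◁ (η_ Y Y' ▷ ((B ⊗ Y) ⊗ Y') ≫
          (Y ⊗ Y') ◁ (b ▷ Y')) ⊗≫
          Y' ◁ (a ▷ (Y' ⊗ (Y ⊗ B) ⊗ Y')) ⊗≫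
          (Y' ⊗ Y) ◁ A ◁ ε_ Y Y' ▷ (B ⊗ Y') ⊗≫ ε_ Y Y' ▷ (A ⊗ B ⊗ Y') ⊗≫ 𝟙 _ := by
        rw [← whisker_exchange, ← whisker_exchange, ← whisker_exchange]; monoidal
    _ = 𝟙 _ ⊗≫ Y' ◁ A ◁ B ◁ η_ Y Y' ⊗≫ Y' ◁ A ◁ b ▷ Y' ⊗≫ Y' ◁ A ◁ η_ Y Y' ▷ (Y ⊗ B ⊗ Y') ⊗≫
          Y' ◁ (a ▷ ((Y' ⊗ Y) ⊗ B ⊗ Y') ≫ (Y ⊗ A) ◁ (ε_ Y Y' ▷ (B ⊗ Y'))) ⊗≫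
          ε_ Y Y' ▷ (A ⊗ B ⊗ Y') ⊗≫ 𝟙 _ := by
        rw [← whisker_exchange]; monoidal
    _ = 𝟙 _ ⊗≫ Y' ◁ A ◁ B ◁ η_ Y Y' ⊗≫ Y' ◁ A ◁ b ▷ Y' ⊗≫
          Y' ◁ A ◁ (η_ Y Y' ▷ Y ⊗≫ Y ◁ ε_ Y Y') ▷ (B ⊗ Y') ⊗≫ Y' ◁ a ▷ (B ⊗ Y') ⊗≫
          ε_ Y Y' ▷ (A ⊗ B ⊗ Y') ⊗≫ 𝟙 _ := by
        rw [← whisker_exchange]; monoidal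
    _ = _ := by rw [ExactPairing.evaluation_coevaluation'']; monoidal

end Rotation

section MulPairing

variable {C : Type u} [Category.{v} C] [MonoidalCategory C] [BraidedCategory C]

theorem mate_crossMul_left {V U : C} (V' U' W' W : C) [ExactPairing V V'] [ExactPairing U U']
    [ExactPairing W W'] (f : V ⟶ U) :
    (mate V' U' f ▷ V) ▷ (W' ⊗ W) ≫ crossMul V' V W' W =
      crossMul U' V W' W ≫ mate (W' ⊗ V') (W' ⊗ U') (f ▷ W) ▷ (V ⊗ W) := by
  have := crossMul_natural (mate V' U' f) (𝟙 V) (𝟙 W') (𝟙 W)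
  simp only [tensorHom_id, id_tensorHom, id_whiskerRight] at this
  rw [this, mate_whiskerRight]

theorem crossMul_left {V U : C} (U' W' W : C) (f : V ⟶ U) :
    (U' ◁ f) ▷ (W' ⊗ W) ≫ crossMul U' U W' W =
      crossMul U' V W' W ≫ (W' ⊗ U') ◁ (f ▷ W) := by
  have := crossMul_natural (𝟙 U') f (𝟙 W') (𝟙 W)
  simpa only [tensorHom_id, id_tensorHom, id_whiskerRight, whiskerLeft_id] using this

theorem mate_crossMul_right {W U : C} (V' V W' U' : C) [ExactPairing V V'] [ExactPairing U U']
    [ExactPairing W W'] (f : W ⟶ U) :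
    (V' ⊗ V) ◁ (mate W' U' f ▷ W) ≫ crossMul V' V W' W =
      crossMul V' V U' W ≫ mate (W' ⊗ V') (U' ⊗ V') (V ◁ f) ▷ (V ⊗ W) := by
  have := crossMul_natural (𝟙 V') (𝟙 V) (mate W' U' f) (𝟙 W)
  simp only [tensorHom_id, id_tensorHom, id_whiskerRight] at this
  rw [this, mate_whiskerLeft]

theorem crossMul_right {W U : C} (V' V U' : C) (f : W ⟶ U) :
    (V' ⊗ V) ◁ (U' ◁ f) ≫ crossMul V' V U' U =
      crossMul V' V U' W ≫ (U' ⊗ V') ◁ (V ◁ f) := by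
  have := crossMul_natural (𝟙 V') (𝟙 V) (𝟙 U') f
  simpa only [tensorHom_id, id_tensorHom, id_whiskerRight, whiskerLeft_id] using this

/-- Convolution of functionals that factor through the multiplication is composition of
endomorphisms of `V ⊗ W`. -/
theorem comul_crossMul_coeffPairing {V W : C} (V' W' : C) [ExactPairing V V'] [ExactPairing W W']
    (φ ψ : V ⊗ W ⟶ V ⊗ W) :
    (insertCoev V' V V V' ⊗ₘ insertCoev W' W W W') ≫
        tensorμ (V' ⊗ V) (V' ⊗ V) (W' ⊗ W) (W' ⊗ W) ≫
          ((crossMul V' V W' W ≫ coeffPairing (W' ⊗ V') φ) ⊗ₘ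
            (crossMul V' V W' W ≫ coeffPairing (W' ⊗ V') ψ)) ≫ (λ_ (𝟙_ C)).hom =
      crossMul V' V W' W ≫ coeffPairing (W' ⊗ V') (ψ ≫ φ) := by
  rw [← MonoidalCategory.tensorHom_comp_tensorHom]
  simp only [Category.assoc]
  rw [← reassoc_of% crossMul_comul V' W', insertCoev_coeffPairing]

/-- One side of the exchange law between the multiplications and the pairing of `r`: the right
multiplication by `r`. -/
theorem comul_interchange_left {V W : C} (V' W' : C) [ExactPairing V V'] [ExactPairing W W']
    (r : V ⊗ W ⟶ W ⊗ V) :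
    (insertCoev V' V V V' ⊗ₘ insertCoev W' W W W') ≫
        tensorμ (V' ⊗ V) (V' ⊗ V) (W' ⊗ W) (W' ⊗ W) ≫
          ((crossMul V' V W' W ≫ ((β_ V' W').inv ⊗ₘ (β_ V W).hom)) ⊗ₘ crossPairing V' W' r) ≫
            (ρ_ _).hom =
      tensorμ V' V W' W ≫ (V' ⊗ W') ◁ r := by
  rw [crossPairing_eq_coeffPairing, ← MonoidalCategory.tensorHom_comp_tensorHom]
  simp only [Category.assoc]
  rw [← reassoc_of% crossMul_comul V' W', MonoidalCategory.tensorHom_def', Category.assoc,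
    rightUnitor_naturality, reassoc_of% @insertCoev_coeffPairing_right, tensorμ_eq_crossMul,
    Category.assoc, MonoidalCategory.tensorHom_def', ← whiskerLeft_comp_assoc,
    Category.assoc, Iso.inv_hom_id, Category.comp_id, whisker_exchange]

/-- The other side of the exchange law: the left multiplication by the dual of `r`. The two sides
agree after passing to a quotient in which the relation for `r` holds. -/
theorem comul_interchange_right {V W : C} (V' W' : C) [ExactPairing V V'] [ExactPairing W W']
    (r : V ⊗ W ⟶ W ⊗ V) :
    (insertCoev V' V V V' ⊗ₘ insertCoev W' W W W') ≫
        tensorμ (V' ⊗ V) (V' ⊗ V) (W' ⊗ W) (W' ⊗ W) ≫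
          (crossPairing V' W' r ⊗ₘ crossMul V' V W' W) ≫ (λ_ _).hom =
      tensorμ V' V W' W ≫ mate (W' ⊗ V') (V' ⊗ W') r ▷ (V ⊗ W) := by
  have hm : mate (V' ⊗ W') (W' ⊗ V') (β_ V W).inv = (β_ V' W').inv := by
    rw [← cancel_epi (β_ V' W').hom, Iso.hom_inv_id, ← mate_braiding (V := V) (W := W),
      mate_hom_inv]
  rw [crossPairing_eq_coeffPairing]
  have : ((crossMul V' V W' W ≫ coeffPairing (W' ⊗ V') (r ≫ (β_ V W).inv)) ⊗ₘ
      crossMul V' V W' W) = (crossMul V' V W' W ⊗ₘ crossMul V' V W' W) ≫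
        coeffPairing (W' ⊗ V') (r ≫ (β_ V W).inv) ▷ _ := by
    rw [← tensorHom_id, MonoidalCategory.tensorHom_comp_tensorHom, Category.comp_id]
  rw [this]
  simp only [Category.assoc]
  rw [← reassoc_of% crossMul_comul V' W', insertCoev_coeffPairing_left, tensorμ_eq_crossMul,
    mate_comp (W' ⊗ V') (V' ⊗ W') (W' ⊗ V'), hm]
  simp

/-- The action `V ⊗ (W' ⊗ W) ⟶ V` given by `r : V ⊗ W ⟶ W ⊗ V`. -/
def pairingAction {V W : C} (W' : C) [ExactPairing W W'] (r : V ⊗ W ⟶ W ⊗ V) :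
    V ⊗ (W' ⊗ W) ⟶ V :=
  𝟙 _ ⊗≫ (β_ V W').hom ▷ W ⊗≫ W' ◁ r ⊗≫ ε_ W W' ▷ V ⊗≫ 𝟙 V

theorem crossPairing_eq_action {V W : C} (V' W' : C) [ExactPairing V V'] [ExactPairing W W']
    (r : V ⊗ W ⟶ W ⊗ V) :
    crossPairing V' W' r = 𝟙 _ ⊗≫ V' ◁ pairingAction W' r ⊗≫ ε_ V V' := by
  rw [crossPairing, tensorμ_eq]
  unfold nest pairingAction
  monoidal

/-- The action is multiplicative. -/
theorem crossMul_pairingAction {V W U : C} (W' U' : C) [ExactPairing W W']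
    [ExactPairing U U'] (a : V ⊗ W ⟶ W ⊗ V) (b : V ⊗ U ⟶ U ⊗ V) :
    V ◁ crossMul W' W U' U ≫ pairingAction (U' ⊗ W') (exchangeTensor a b) =
      (α_ _ _ _).inv ≫ pairingAction W' a ▷ (U' ⊗ U) ≫ pairingAction U' b := by
  have hn : pairingAction W' a ▷ U' ≫ (β_ V U').hom =
      (β_ (V ⊗ (W' ⊗ W)) U').hom ≫ U' ◁ pairingAction W' a :=
    BraidedCategory.braiding_naturality_left _ _
  symm
  calc _ = 𝟙 _ ⊗≫ (pairingAction W' a ▷ U' ≫ (β_ V U').hom) ▷ U ⊗≫ U' ◁ b ⊗≫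
          ε_ U U' ▷ V ⊗≫ 𝟙 V := by
        rw [pairingAction.eq_def U' b]; monoidal
    _ = 𝟙 _ ⊗≫ V ◁ (β_ (W' ⊗ W) U').hom ▷ U ⊗≫ (β_ V U').hom ▷ (W' ⊗ W ⊗ U) ⊗≫
          U' ◁ (β_ V W').hom ▷ (W ⊗ U) ⊗≫ U' ◁ W' ◁ a ▷ U ⊗≫
            U' ◁ (ε_ W W' ▷ (V ⊗ U) ≫ (𝟙_ C) ◁ b) ⊗≫ ε_ U U' ▷ V ⊗≫ 𝟙 V := by
        rw [hn, BraidedCategory.braiding_tensor_left_hom V]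
        unfold pairingAction; monoidal
    _ = _ := by
        rw [← whisker_exchange, crossMul_eq]
        unfold pairingAction exchangeTensor
        rw [ExactPairing.tensor_evaluation, BraidedCategory.braiding_tensor_right_hom V U' W']
        monoidal

/-- The pairing is multiplicative in its second argument. -/
theorem crossPairing_mul {V W U : C} (V' W' U' : C) [ExactPairing V V'] [ExactPairing W W']
    [ExactPairing U U'] (a : V ⊗ W ⟶ W ⊗ V) (b : V ⊗ U ⟶ U ⊗ V) :
    (V' ⊗ V) ◁ crossMul W' W U' U ≫ crossPairing V' (U' ⊗ W') (exchangeTensor a b) =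
      insertCoev V' V V V' ▷ ((W' ⊗ W) ⊗ (U' ⊗ U)) ≫
        nest (crossPairing V' U' b) (crossPairing V' W' a) := by
  simp only [crossPairing_eq_action]
  symm
  calc _ = 𝟙 _ ⊗≫ V' ◁ η_ V V' ▷ (V ⊗ (W' ⊗ W) ⊗ (U' ⊗ U)) ⊗≫
          (V' ⊗ V ⊗ V') ◁ pairingAction W' a ▷ (U' ⊗ U) ⊗≫
          (V' ⊗ V) ◁ ε_ V V' ▷ (U' ⊗ U) ⊗≫ V' ◁ pairingAction U' b ⊗≫ ε_ V V' := by
        unfold nest; rw [insertCoev_eq]; monoidal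
    _ = 𝟙 _ ⊗≫ V' ◁ (η_ V V' ▷ (V ⊗ (W' ⊗ W)) ≫ (V ⊗ V') ◁ pairingAction W' a) ▷ (U' ⊗ U) ⊗≫
          (V' ⊗ V) ◁ ε_ V V' ▷ (U' ⊗ U) ⊗≫ V' ◁ pairingAction U' b ⊗≫ ε_ V V' := by monoidal
    _ = 𝟙 _ ⊗≫ V' ◁ pairingAction W' a ▷ (U' ⊗ U) ⊗≫
          V' ◁ (η_ V V' ▷ V ⊗≫ V ◁ ε_ V V') ▷ (U' ⊗ U) ⊗≫ V' ◁ pairingAction U' b ⊗≫ ε_ V V' := by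
        rw [← whisker_exchange]; monoidal
    _ = 𝟙 _ ⊗≫ V' ◁ ((α_ _ _ _).inv ≫ pairingAction W' a ▷ (U' ⊗ U) ≫ pairingAction U' b) ⊗≫
          ε_ V V' := by
        rw [ExactPairing.evaluation_coevaluation'']; monoidal
    _ = _ := by rw [← crossMul_pairingAction]; monoidal

/-- The action `(V' ⊗ V) ⊗ U' ⟶ U'` given by `r : V ⊗ U ⟶ U ⊗ V`. -/
def pairingActionLeft {V U : C} (V' U' : C) [ExactPairing V V'] [ExactPairing U U']
    (r : V ⊗ U ⟶ U ⊗ V) : (V' ⊗ V) ⊗ U' ⟶ U' :=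
  𝟙 _ ⊗≫ V' ◁ ((β_ V U').hom ≫ rotateExchange U' r) ⊗≫ ε_ V V' ▷ U' ⊗≫ 𝟙 U'

theorem crossPairing_eq_actionLeft {V U : C} (V' U' : C) [ExactPairing V V'] [ExactPairing U U']
    (r : V ⊗ U ⟶ U ⊗ V) :
    crossPairing V' U' r = 𝟙 _ ⊗≫ pairingActionLeft V' U' r ▷ U ⊗≫ ε_ U U' := by
  rw [crossPairing_eq_innerPairing, innerPairing_eq]
  unfold pairingActionLeft
  monoidal

/-- The action is multiplicative for the opposite of the multiplication formed with the inverse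
braiding. -/
theorem opMul_pairingActionLeft {V W U : C} (V' W' U' : C) [ExactPairing V V'] [ExactPairing W W']
    [ExactPairing U U'] (a : V ⊗ U ⟶ U ⊗ V) (b : W ⊗ U ⟶ U ⊗ W) :
    (crossMul V' V W' W ≫ ((β_ V' W').inv ⊗ₘ (β_ V W).hom)) ▷ U' ≫
        pairingActionLeft (V' ⊗ W') U' (tensorExchange b a) =
      (α_ _ _ _).hom ≫ (V' ⊗ V) ◁ pairingActionLeft W' U' b ≫ pairingActionLeft V' U' a := by
  have hn : V ◁ pairingActionLeft W' U' b ≫ (β_ V U').hom =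
      (β_ V ((W' ⊗ W) ⊗ U')).hom ≫ pairingActionLeft W' U' b ▷ V :=
    BraidedCategory.braiding_naturality_right _ _
  have ho : crossMul V' V W' W ≫ ((β_ V' W').inv ⊗ₘ (β_ V W).hom) =
      𝟙 _ ⊗≫ V' ◁ (β_ V (W' ⊗ W)).hom ⊗≫ 𝟙 _ := by
    rw [MonoidalCategory.tensorHom_def, ← Category.assoc, ← tensorμ_eq_crossMul, tensorμ_eq,
      BraidedCategory.braiding_tensor_right_hom]
    monoidal
  rw [ho]
  symm
  calc _ = 𝟙 _ ⊗≫ V' ◁ (V ◁ pairingActionLeft W' U' b ≫ (β_ V U').hom) ⊗≫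
        V' ◁ rotateExchange U' a ⊗≫ ε_ V V' ▷ U' ⊗≫ 𝟙 U' := by
        rw [pairingActionLeft.eq_def V' U' a]; monoidal
    _ = 𝟙 _ ⊗≫ V' ◁ (β_ V (W' ⊗ W)).hom ▷ U' ⊗≫ (V' ⊗ W' ⊗ W) ◁ (β_ V U').hom ⊗≫
          (V' ⊗ W') ◁ (β_ W U').hom ▷ V ⊗≫ (V' ⊗ W') ◁ rotateExchange U' b ▷ V ⊗≫
          V' ◁ (ε_ W W' ▷ (U' ⊗ V) ≫ (𝟙_ C) ◁ rotateExchange U' a) ⊗≫ ε_ V V' ▷ U' ⊗≫ 𝟙 U' := by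
        rw [hn, BraidedCategory.braiding_tensor_right_hom V (W' ⊗ W) U']
        unfold pairingActionLeft
        monoidal
    _ = _ := by
        rw [← whisker_exchange]
        unfold pairingActionLeft
        rw [rotateExchange_tensorExchange, ExactPairing.tensor_evaluation,
          BraidedCategory.braiding_tensor_left_hom W V U']
        monoidal

/-- The pairing is multiplicative in its first argument, for the opposite of the multiplication
formed with the inverse braiding. -/
theorem opMul_crossPairing {V W U : C} (V' W' U' : C) [ExactPairing V V'] [ExactPairing W W']
    [ExactPairing U U'] (a : V ⊗ U ⟶ U ⊗ V) (b : W ⊗ U ⟶ U ⊗ W) :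
    (crossMul V' V W' W ≫ ((β_ V' W').inv ⊗ₘ (β_ V W).hom)) ▷ (U' ⊗ U) ≫
        crossPairing (V' ⊗ W') U' (tensorExchange b a) =
      ((V' ⊗ V) ⊗ (W' ⊗ W)) ◁ insertCoev U' U U U' ≫
        nest (crossPairing V' U' a) (crossPairing W' U' b) := by
  simp only [crossPairing_eq_actionLeft]
  symm
  calc _ = 𝟙 _ ⊗≫ (V' ⊗ V) ◁ ((W' ⊗ W) ⊗ U') ◁ η_ U U' ▷ U ⊗≫
          (V' ⊗ V) ◁ pairingActionLeft W' U' b ▷ (U ⊗ U' ⊗ U) ⊗≫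
          (V' ⊗ V) ◁ ε_ U U' ▷ (U' ⊗ U) ⊗≫ pairingActionLeft V' U' a ▷ U ⊗≫ ε_ U U' := by
        unfold nest; rw [insertCoev_eq]; monoidal
    _ = 𝟙 _ ⊗≫ (V' ⊗ V) ◁ (((W' ⊗ W) ⊗ U') ◁ η_ U U' ≫
          pairingActionLeft W' U' b ▷ (U ⊗ U')) ▷ U ⊗≫
          (V' ⊗ V) ◁ ε_ U U' ▷ (U' ⊗ U) ⊗≫ pairingActionLeft V' U' a ▷ U ⊗≫ ε_ U U' := by monoidal
    _ = 𝟙 _ ⊗≫ (V' ⊗ V) ◁ pairingActionLeft W' U' b ▷ U ⊗≫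
          (V' ⊗ V) ◁ (U' ◁ η_ U U' ⊗≫ ε_ U U' ▷ U') ▷ U ⊗≫ pairingActionLeft V' U' a ▷ U ⊗≫
          ε_ U U' := by
        rw [whisker_exchange]; monoidal
    _ = 𝟙 _ ⊗≫ ((α_ _ _ _).hom ≫ (V' ⊗ V) ◁ pairingActionLeft W' U' b ≫
          pairingActionLeft V' U' a) ▷ U ⊗≫ ε_ U U' := by
        rw [ExactPairing.coevaluation_evaluation'']; monoidal
    _ = _ := by rw [← opMul_pairingActionLeft]; monoidal

end MulPairing

/-! ### Self-dual objects and the antipode -/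

section SelfDuality

variable {C : Type u} [Category.{v} C] [MonoidalCategory C]

theorem mate_associator_inv {U V W : C} (U' V' W' : C) [ExactPairing U U'] [ExactPairing V V']
    [ExactPairing W W'] :
    mate ((W' ⊗ V') ⊗ U') (W' ⊗ (V' ⊗ U')) (α_ U V W).inv = (α_ W' V' U').inv :=
  mate_unique (by simp only [ExactPairing.tensor_evaluation]; monoidal)

theorem mate_rightUnitor {V : C} (V' : C) [ExactPairing V V'] :
    mate (𝟙_ C ⊗ V') V' (ρ_ V).hom = (λ_ V').inv :=
  mate_unique (by
    have h : ε_ (𝟙_ C) (𝟙_ C) = (ρ_ (𝟙_ C)).hom := rfl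
    rw [ExactPairing.tensor_evaluation, h]
    monoidal)

theorem mate_rightUnitor_inv {V : C} (V' : C) [ExactPairing V V'] :
    mate V' (𝟙_ C ⊗ V') (ρ_ V).inv = (λ_ V').hom :=
  mate_unique (by
    have h : ε_ (𝟙_ C) (𝟙_ C) = (ρ_ (𝟙_ C)).hom := rfl
    rw [ExactPairing.tensor_evaluation, h]
    monoidal)

theorem mate_leftUnitor {V : C} (V' : C) [ExactPairing V V'] :
    mate (V' ⊗ 𝟙_ C) V' (λ_ V).hom = (ρ_ V').inv :=
  mate_unique (by
    have h : ε_ (𝟙_ C) (𝟙_ C) = (ρ_ (𝟙_ C)).hom := rfl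
    rw [ExactPairing.tensor_evaluation, h]
    monoidal)

theorem mate_leftUnitor_inv {V : C} (V' : C) [ExactPairing V V'] :
    mate V' (V' ⊗ 𝟙_ C) (λ_ V).inv = (ρ_ V').hom :=
  mate_unique (by
    have h : ε_ (𝟙_ C) (𝟙_ C) = (ρ_ (𝟙_ C)).hom := rfl
    rw [ExactPairing.tensor_evaluation, h]
    monoidal)

/-- The duality of `V'` with itself that is dual to a duality of `V` with itself. -/
@[reducible]
def dualSelfPairing {V : C} (V' : C) [ExactPairing V V'] (c : ExactPairing V V) :
    ExactPairing V' V' where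
  coevaluation' := mate (V' ⊗ V') (𝟙_ C) c.evaluation'
  evaluation' := mate (𝟙_ C) (V' ⊗ V') c.coevaluation'
  coevaluation_evaluation' := by
    have h : V ◁ c.coevaluation' ≫ (α_ V V V).inv ≫ c.evaluation' ▷ V = (ρ_ V).hom ≫ (λ_ V).inv :=
      c.coevaluation_evaluation'
    rw [← mate_leftUnitor_inv (V := V) V', ← mate_rightUnitor (V := V) V', ← mate_comp,
      ← mate_associator_inv (U := V) (V := V) (W := V),
      ← mate_whiskerRight (V' ⊗ V') (𝟙_ C) V' (U := V) c.evaluation',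
      ← mate_whiskerLeft (𝟙_ C) (V' ⊗ V') V' (U := V) c.coevaluation', ← mate_comp,
      ← mate_comp, ← h, Category.assoc]
  evaluation_coevaluation' := by
    have h : c.coevaluation' ▷ V ≫ (α_ V V V).hom ≫ V ◁ c.evaluation' = (λ_ V).hom ≫ (ρ_ V).inv :=
      c.evaluation_coevaluation'
    rw [← mate_leftUnitor (V := V) V', ← mate_rightUnitor_inv (V := V) V', ← mate_comp,
      ← mate_associator (U := V) (V := V) (W := V),
      ← mate_whiskerLeft (V' ⊗ V') (𝟙_ C) V' (U := V) c.evaluation',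
      ← mate_whiskerRight (𝟙_ C) (V' ⊗ V') V' (U := V) c.coevaluation', ← mate_comp,
      ← mate_comp, ← h, Category.assoc]

/-- The canonical isomorphism `V' ⟶ V` of a dual with a self-dual object. -/
def toSelf {V : C} (V' : C) [ExactPairing V V'] (c : ExactPairing V V) : V' ⟶ V :=
  @mate C _ _ V V V V' c _ (𝟙 V)

theorem toSelf_evaluation {V : C} (V' : C) [ExactPairing V V'] (c : ExactPairing V V) :
    toSelf V' c ▷ V ≫ c.evaluation' = ε_ V V' := by
  refine (@mate_evaluation C _ _ V V V V' c _ (𝟙 V)).trans ?_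
  rw [whiskerLeft_id, Category.id_comp]

theorem coevaluation_toSelf {V : C} (V' : C) [ExactPairing V V'] (c : ExactPairing V V) :
    η_ V V' ≫ V ◁ toSelf V' c = c.coevaluation' := by
  refine (@coevaluation_mate C _ _ V V V V' c _ (𝟙 V)).trans ?_
  rw [id_whiskerRight, Category.comp_id]
  rfl

/-- The transpose `W ⟶ V` of `f : V ⟶ W` for dualities of `V` and `W` with themselves. -/
abbrev transpose {V W : C} (c : ExactPairing V V) (d : ExactPairing W W) (f : V ⟶ W) : W ⟶ V :=
  @mate C _ _ V W V W c d f

theorem mate_toSelf {V W : C} (V' W' : C) [ExactPairing V V'] [ExactPairing W W']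
    (c : ExactPairing V V) (d : ExactPairing W W) (f : V ⟶ W) :
    mate V' W' f ≫ toSelf V' c = toSelf W' d ≫ transpose c d f := by
  have h₁ := @mate_comp C _ _ V V W V V' W' c _ _ (𝟙 V) f
  have h₂ := @mate_comp C _ _ V W W V W W' c d _ f (𝟙 W)
  rw [Category.id_comp] at h₁
  rw [Category.comp_id] at h₂
  exact h₁.symm.trans h₂

/-- Dualizing twice, with respect to the dual self-dualities, is transposition followed by
dualizing. -/
theorem mate_transpose {V W : C} (V' W' : C) [ExactPairing V V'] [ExactPairing W W']
    (c : ExactPairing V V) (d : ExactPairing W W) (f : V ⟶ W) :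
    @mate C _ _ W' V' W' V' (dualSelfPairing W' d) (dualSelfPairing V' c) (mate V' W' f) =
      mate W' V' (transpose c d f) := by
  refine @mate_unique C _ _ W' V' W' V' (dualSelfPairing W' d) (dualSelfPairing V' c) _ _ ?_
  have h : d.coevaluation' ≫ W ◁ transpose c d f = c.coevaluation' ≫ f ▷ V :=
    @coevaluation_mate C _ _ V W V W c d f
  change mate W' V' (transpose c d f) ▷ W' ≫ mate (𝟙_ C) (W' ⊗ W') d.coevaluation' =
    V' ◁ mate V' W' f ≫ mate (𝟙_ C) (V' ⊗ V') c.coevaluation'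
  rw [← mate_whiskerLeft W' V' W' (U := W) (transpose c d f),
    ← mate_whiskerRight V' W' V' (U := V) f, ← mate_comp,
    ← mate_comp, h]

end SelfDuality

section Antipode

variable {C : Type u} [Category.{v} C] [MonoidalCategory C] [BraidedCategory C]

/-- Duality turned around by the braiding. -/
@[reducible]
def swapPairing (V V' : C) [ExactPairing V V'] : ExactPairing V' V :=
  @BraidedCategory.exactPairing_swap C _ _ (reverseBraiding C) V V' _

/-- The canonical isomorphism `V ⟶ V'` of a self-dual object with a dual. -/
def ofSelf {V : C} (V' : C) [ExactPairing V V'] (c : ExactPairing V V) : V ⟶ V' :=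
  @mate C _ _ V' V' V' V (dualSelfPairing V' c) (swapPairing V V') (𝟙 V')

theorem ofSelf_evaluation {V : C} (V' : C) [ExactPairing V V'] (c : ExactPairing V V) :
    (β_ V' V).hom ≫ ofSelf V' c ▷ V' ≫ mate (𝟙_ C) (V' ⊗ V') c.coevaluation' = ε_ V V' := by
  have h := @mate_evaluation C _ _ V' V' V' V (dualSelfPairing V' c) (swapPairing V V') (𝟙 V')
  rw [whiskerLeft_id, Category.id_comp] at h
  rw [← Iso.eq_inv_comp]
  exact h

theorem coevaluation_ofSelf {V : C} (V' : C) [ExactPairing V V'] (c : ExactPairing V V) :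
    η_ V V' ≫ (β_ V V').hom ≫ V' ◁ ofSelf V' c = mate (V' ⊗ V') (𝟙_ C) c.evaluation' := by
  have h := @coevaluation_mate C _ _ V' V' V' V (dualSelfPairing V' c) (swapPairing V V') (𝟙 V')
  rw [id_whiskerRight, Category.comp_id] at h
  rw [← Category.assoc]
  exact h

theorem ofSelf_mate {V W : C} (V' W' : C) [ExactPairing V V'] [ExactPairing W W']
    (c : ExactPairing V V) (d : ExactPairing W W) (f : V ⟶ W) :
    ofSelf V' c ≫ mate W' V' (transpose c d f) = f ≫ ofSelf W' d := by
  have hf : @mate C _ _ W' V' W V (swapPairing W W') (swapPairing V V') (mate V' W' f) = f := by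
    refine @mate_unique C _ _ W' V' W V (swapPairing W W') (swapPairing V V') _ _ ?_
    change f ▷ W' ≫ (β_ W' W).inv ≫ ε_ W W' = V ◁ mate V' W' f ≫ (β_ V' V).inv ≫ ε_ V V'
    rw [BraidedCategory.braiding_inv_naturality_left_assoc,
      BraidedCategory.braiding_inv_naturality_right_assoc, mate_evaluation]
  have h₁ := @mate_comp C _ _ W' V' V' W' V' V (dualSelfPairing W' d) (dualSelfPairing V' c)
    (swapPairing V V') (mate V' W' f) (𝟙 V')
  have h₂ := @mate_comp C _ _ W' W' V' W' W V (dualSelfPairing W' d) (swapPairing W W')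
    (swapPairing V V') (𝟙 W') (mate V' W' f)
  rw [Category.comp_id, mate_transpose] at h₁
  rw [Category.id_comp, hf] at h₂
  exact h₁.symm.trans h₂

/-- The antipode on `V' ⊗ V` given by a duality of `V` with itself. -/
def selfAntipode {V : C} (V' : C) [ExactPairing V V'] (c : ExactPairing V V) : V' ⊗ V ⟶ V' ⊗ V :=
  (β_ V' V).hom ≫ (ofSelf V' c ⊗ₘ toSelf V' c)

/-- The antipode is compatible with the dinaturality relation for `f` when the target satisfies
that for the transpose of `f`. -/
theorem selfAntipode_dinatural {V W Q : C} (V' W' : C) [ExactPairing V V'] [ExactPairing W W']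
    (c : ExactPairing V V) (d : ExactPairing W W) (f : V ⟶ W) (p : V' ⊗ V ⟶ Q) (q : W' ⊗ W ⟶ Q)
    (h : mate W' V' (transpose c d f) ▷ W ≫ q = V' ◁ transpose c d f ≫ p) :
    mate V' W' f ▷ V ≫ selfAntipode V' c ≫ p = W' ◁ f ≫ selfAntipode W' d ≫ q := by
  unfold selfAntipode
  simp only [Category.assoc]
  rw [BraidedCategory.braiding_naturality_left_assoc,
    BraidedCategory.braiding_naturality_right_assoc, whiskerLeft_comp_tensorHom_assoc,
    whiskerRight_comp_tensorHom_assoc, mate_toSelf V' W' c d, ← ofSelf_mate V' W' c d,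
    ← tensorHom_comp_whiskerLeft_assoc, ← tensorHom_comp_whiskerRight_assoc, h]

/-- The left convolution of the antipode with the identity, before any relation is imposed: it is
the dual of the pairing, multiplied by an isomorphism. Invariance of the pairing turns it into the
counit. -/
theorem insertCoev_selfAntipode_left {V : C} (V' : C) [ExactPairing V V'] (c : ExactPairing V V) :
    insertCoev V' V V V' ≫ selfAntipode V' c ▷ (V' ⊗ V) ≫ crossMul V' V V' V =
      toSelf V' c ▷ V ≫ (λ_ _).inv ≫ mate (V' ⊗ V') (𝟙_ C) c.evaluation' ▷ (V ⊗ V) := by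
  unfold selfAntipode
  rw [comp_whiskerRight, Category.assoc, ← coevaluation_ofSelf]
  have hn : (ofSelf V' c ⊗ₘ toSelf V' c) ▷ V' ≫ (β_ (V' ⊗ V) V').hom =
      (β_ (V ⊗ V') V').hom ≫ V' ◁ (ofSelf V' c ⊗ₘ toSelf V' c) :=
    BraidedCategory.braiding_naturality_left _ _
  have hη : V' ◁ η_ V V' ≫ (β_ V' (V ⊗ V')).hom = (β_ V' (𝟙_ C)).hom ≫ η_ V V' ▷ V' :=
    BraidedCategory.braiding_naturality_right _ _
  calc _ = 𝟙 _ ⊗≫ V' ◁ η_ V V' ▷ V ⊗≫ (β_ V' V).hom ▷ (V' ⊗ V) ⊗≫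
        ((ofSelf V' c ⊗ₘ toSelf V' c) ▷ V' ≫ (β_ (V' ⊗ V) V').hom) ▷ V ⊗≫ 𝟙 _ := by
        rw [insertCoev_eq, crossMul_eq]; monoidal
    _ = 𝟙 _ ⊗≫ (V' ◁ η_ V V' ≫ (β_ V' (V ⊗ V')).hom) ▷ V ⊗≫ (β_ V V').hom ▷ V' ▷ V ⊗≫
        V' ◁ (ofSelf V' c ⊗ₘ toSelf V' c) ▷ V ⊗≫ 𝟙 _ := by
        rw [hn, BraidedCategory.braiding_tensor_left_hom V V' V',
          BraidedCategory.braiding_tensor_right_hom V' V V']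
        monoidal
    _ = 𝟙 _ ⊗≫ (((η_ V V' ≫ (β_ V V').hom ≫ V' ◁ ofSelf V' c) ▷ V') ≫
          (V' ⊗ V') ◁ toSelf V' c) ▷ V ⊗≫ 𝟙 _ := by
        rw [hη, braiding_tensorUnit_right, MonoidalCategory.tensorHom_def]; monoidal
    _ = _ := by
        rw [← whisker_exchange]; monoidal

/-- The right convolution of the antipode with the identity, before any relation is imposed: it is
the copairing. Invariance of the copairing turns it into the counit. -/
theorem insertCoev_selfAntipode_right {V : C} (V' : C) [ExactPairing V V']
    (c : ExactPairing V V) :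
    insertCoev V' V V V' ≫ (V' ⊗ V) ◁ selfAntipode V' c ≫ crossMul V' V V' V =
      ((β_ V' V).hom ≫ ofSelf V' c ▷ V') ≫ (ρ_ _).inv ≫ (V' ⊗ V') ◁ c.coevaluation' := by
  unfold selfAntipode
  rw [whiskerLeft_comp, Category.assoc, ← coevaluation_toSelf V' c]
  have hn : (V' ⊗ V) ◁ ofSelf V' c ≫ (β_ (V' ⊗ V) V').hom =
      (β_ (V' ⊗ V) V).hom ≫ ofSelf V' c ▷ (V' ⊗ V) :=
    BraidedCategory.braiding_naturality_right _ _
  have hη : η_ V V' ▷ V ≫ (β_ (V ⊗ V') V).hom = (β_ (𝟙_ C) V).hom ≫ V ◁ η_ V V' :=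
    BraidedCategory.braiding_naturality_left _ _
  calc _ = 𝟙 _ ⊗≫ V' ◁ η_ V V' ▷ V ⊗≫ (V' ⊗ V) ◁ (β_ V' V).hom ⊗≫
        ((V' ⊗ V) ◁ ofSelf V' c ≫ (β_ (V' ⊗ V) V').hom) ▷ V' ⊗≫
        (V' ⊗ V' ⊗ V) ◁ toSelf V' c ⊗≫ 𝟙 _ := by
        rw [insertCoev_eq, crossMul_eq, MonoidalCategory.tensorHom_def]
        calc _ = 𝟙 _ ⊗≫ V' ◁ η_ V V' ▷ V ⊗≫ (V' ⊗ V) ◁ (β_ V' V).hom ⊗≫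
              (V' ⊗ V) ◁ ofSelf V' c ▷ V' ⊗≫ (((V' ⊗ V) ⊗ V') ◁ toSelf V' c ≫
                (β_ (V' ⊗ V) V').hom ▷ V) ⊗≫ 𝟙 _ := by monoidal
          _ = _ := by rw [whisker_exchange]; monoidal
    _ = 𝟙 _ ⊗≫ V' ◁ (η_ V V' ▷ V ≫ (β_ (V ⊗ V') V).hom) ⊗≫ (β_ V' V).hom ▷ (V ⊗ V') ⊗≫
          ofSelf V' c ▷ (V' ⊗ V ⊗ V') ⊗≫ (V' ⊗ V' ⊗ V) ◁ toSelf V' c ⊗≫ 𝟙 _ := by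
        rw [hn, BraidedCategory.braiding_tensor_left_hom V' V V,
          BraidedCategory.braiding_tensor_left_hom V V' V]
        monoidal
    _ = 𝟙 _ ⊗≫ (((V' ⊗ V) ◁ η_ V V' ≫ (β_ V' V).hom ▷ (V ⊗ V')) ≫ ofSelf V' c ▷ V' ▷ (V ⊗ V')) ⊗≫
          (V' ⊗ V' ⊗ V) ◁ toSelf V' c ⊗≫ 𝟙 _ := by
        rw [hη, braiding_tensorUnit_left]; monoidal
    _ = 𝟙 _ ⊗≫ (β_ V' V).hom ⊗≫ ((V ⊗ V') ◁ η_ V V' ≫ ofSelf V' c ▷ V' ▷ (V ⊗ V')) ⊗≫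
          (V' ⊗ V' ⊗ V) ◁ toSelf V' c ⊗≫ 𝟙 _ := by
        rw [whisker_exchange]; monoidal
    _ = _ := by rw [whisker_exchange]; monoidal

end Antipode

section Powers

variable {C : Type u} [Category.{v} C] [MonoidalCategory C]

/-! ### Tensor powers -/

section Dual
variable (X D : C) [ExactPairing X D]

/-- The nested coevaluation and evaluation of `X^{⊗n}` satisfy the zigzag identities. -/
theorem coev_ev_zigzag (n : ℕ) :
    (dpow D n ◁ coev X D n ≫ (α_ _ _ _).inv ≫ ev X D n ▷ dpow D n =
        (ρ_ (dpow D n)).hom ≫ (λ_ (dpow D n)).inv) ∧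
      (coev X D n ▷ tpow X n ≫ (α_ _ _ _).hom ≫ tpow X n ◁ ev X D n =
        (λ_ (tpow X n)).hom ≫ (ρ_ (tpow X n)).inv) := by
  induction n with
  | zero => constructor <;> (dsimp only [coev, ev, tpow, dpow]; monoidal)
  | succ n ih =>
    let _ : ExactPairing (tpow X n) (dpow D n) := ⟨coev X D n, ev X D n, ih.1, ih.2⟩
    have hη : coev X D (n + 1) = η_ (tpow X n ⊗ X) (D ⊗ dpow D n) := by
      have step : ∀ {A B : C} (k : 𝟙_ C ⟶ A ⊗ B), k ≫ A ◁ (λ_ B).inv ≫ A ◁ (η_ X D ▷ B) ≫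
          A ◁ (α_ X D B).hom ≫ (α_ A X (D ⊗ B)).inv = k ⊗≫ (A ◁ η_ X D) ▷ B ⊗≫ 𝟙 _ := by
        intro A B k
        monoidal
      exact step _
    have h₁ := ExactPairing.coevaluation_evaluation (tpow X n ⊗ X) (D ⊗ dpow D n)
    have h₂ := ExactPairing.evaluation_coevaluation (tpow X n ⊗ X) (D ⊗ dpow D n)
    rw [← hη] at h₁ h₂
    exact ⟨h₁, h₂⟩

/-- The nested duality between `X^{⊗ n}` and `D^{⊗ n}`. -/
instance powPairing (n : ℕ) : ExactPairing (tpow X n) (dpow D n) where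
  coevaluation' := coev X D n
  evaluation' := ev X D n
  coevaluation_evaluation' := (coev_ev_zigzag X D n).1
  evaluation_coevaluation' := (coev_ev_zigzag X D n).2

theorem evaluation_pow (n : ℕ) : ε_ (tpow X n) (dpow D n) = ev X D n := rfl

variable {X} in
/-- The regroupings of powers of `X` and of `D` are compatible with the nested evaluations. Hence
they are dual to each other, see `mate_tpowAdd_hom`. -/
theorem dpowAdd_tpowAdd_ev (m n : ℕ) :
    ((dpowAdd D m n).hom ⊗ₘ (tpowAdd X m n).hom) ≫ ev X D (m + n) =
      ε_ (tpow X m ⊗ tpow X n) (dpow D n ⊗ dpow D m) := by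
  change _ = nest (ev X D n) (ev X D m)
  induction n with
  | zero =>
    have step : ∀ {A B : C} (e : A ⊗ B ⟶ 𝟙_ C), ((λ_ A).hom ⊗ₘ (ρ_ B).hom) ≫ e =
        nest (λ_ (𝟙_ C)).hom e := by
      intro A B e
      rw [nest, MonoidalCategory.tensorHom_def]
      monoidal
    exact step (ev X D m)
  | succ n ih =>
    have step : ∀ {A A₂ A₃ B B₂ B₃ : C} (a : A ⊗ A₂ ⟶ A₃) (b : B₂ ⊗ B ⟶ B₃) (e : A₂ ⊗ B₂ ⟶ 𝟙_ C)
        (e₂ : A ⊗ B ⟶ 𝟙_ C) (e₃ : A₃ ⊗ B₃ ⟶ 𝟙_ C), (a ⊗ₘ b) ≫ e₃ =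
          nest e₂ e →
        (((α_ D A A₂).hom ≫ D ◁ a) ⊗ₘ ((α_ B₂ B X).inv ≫ b ▷ X)) ≫
          nest (ε_ X D) e₃ = nest (nest (ε_ X D) e₂) e := by
      intro A A₂ A₃ B B₂ B₃ a b e e₂ e₃ h
      simp only [nest, MonoidalCategory.tensorHom_def] at h ⊢
      calc _ = 𝟙 _ ⊗≫ D ◁ ((a ▷ _ ≫ _ ◁ b) ≫ e₃) ▷ X ⊗≫ ε_ X D := by monoidal
        _ = _ := by rw [h]; monoidal
    exact step _ _ _ _ _ ih

theorem mate_tpowAdd_hom (m n : ℕ) :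
    mate (dpow D n ⊗ dpow D m) (dpow D (m + n)) (tpowAdd X m n).hom = (dpowAdd D m n).inv := by
  refine mate_unique ?_
  rw [← dpowAdd_tpowAdd_ev, MonoidalCategory.tensorHom_def', ← evaluation_pow, Category.assoc,
    whisker_exchange_assoc, inv_hom_whiskerRight_assoc]

theorem mate_tpowAdd_inv (m n : ℕ) :
    mate (dpow D (m + n)) (dpow D n ⊗ dpow D m) (tpowAdd X m n).inv = (dpowAdd D m n).hom := by
  rw [← cancel_mono (dpowAdd D m n).inv, Iso.hom_inv_id, ← mate_tpowAdd_hom X D, mate_inv_hom]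

end Dual

section Coherence

variable (X : C)

theorem tpowAdd_assoc (l m n : ℕ) :
    (tpowAdd X l m).hom ▷ tpow X n ≫ (tpowAdd X (l + m) n).hom =
      (α_ _ _ _).hom ≫ tpow X l ◁ (tpowAdd X m n).hom ≫ (tpowAdd X l (m + n)).hom ≫
        eqToHom (congrArg (tpow X) (Nat.add_assoc l m n).symm) := by
  induction n with
  | zero =>
    have step : ∀ {A B P : C} (a : A ⊗ B ⟶ P), a ▷ 𝟙_ C ≫ (ρ_ P).hom =
        (α_ A B (𝟙_ C)).hom ≫ A ◁ (ρ_ B).hom ≫ a ≫ 𝟙 P := by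
      intro A B P a
      monoidal
    exact step _
  | succ n ih =>
    have step : ∀ {A B E P Q S T : C} {a : A ⊗ B ⟶ P} {b : P ⊗ E ⟶ Q} {c : B ⊗ E ⟶ S}
        {d : A ⊗ S ⟶ T} {w : T ⟶ Q} {w' : T ⊗ X ⟶ Q ⊗ X}, w ▷ X = w' →
        a ▷ E ≫ b = (α_ A B E).hom ≫ A ◁ c ≫ d ≫ w →
        a ▷ (E ⊗ X) ≫ (α_ P E X).inv ≫ b ▷ X = (α_ A B (E ⊗ X)).hom ≫
          A ◁ ((α_ B E X).inv ≫ c ▷ X) ≫ ((α_ A S X).inv ≫ d ▷ X) ≫ w' := by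
      rintro A B E P Q S T a b c d w _ rfl h
      calc _ = (α_ _ _ _).inv ≫ (a ▷ E ≫ b) ▷ X := by monoidal
        _ = _ := by rw [h]; monoidal
    exact step (eqToHom_whiskerRight _ _) ih

theorem dpowAdd_assoc (D : C) (l m n : ℕ) :
    dpow D n ◁ (dpowAdd D l m).hom ≫ (dpowAdd D (l + m) n).hom =
      (α_ _ _ _).inv ≫ (dpowAdd D m n).hom ▷ dpow D l ≫ (dpowAdd D l (m + n)).hom ≫
        eqToHom (congrArg (dpow D) (Nat.add_assoc l m n).symm) := by
  induction n with
  | zero =>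
    have step : ∀ {A B P : C} (a : B ⊗ A ⟶ P), 𝟙_ C ◁ a ≫ (λ_ P).hom =
        (α_ (𝟙_ C) B A).inv ≫ (λ_ B).hom ▷ A ≫ a ≫ 𝟙 P := by
      intro A B P a
      monoidal
    exact step _
  | succ n ih =>
    have step : ∀ {A B E P Q S T : C} {a : B ⊗ A ⟶ P} {b : E ⊗ P ⟶ Q} {c : E ⊗ B ⟶ S}
        {d : S ⊗ A ⟶ T} {w : T ⟶ Q} {w' : D ⊗ T ⟶ D ⊗ Q}, D ◁ w = w' →
        E ◁ a ≫ b = (α_ E B A).inv ≫ c ▷ A ≫ d ≫ w →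
        (D ⊗ E) ◁ a ≫ (α_ D E P).hom ≫ D ◁ b = (α_ (D ⊗ E) B A).inv ≫
          ((α_ D E B).hom ≫ D ◁ c) ▷ A ≫ ((α_ D S A).hom ≫ D ◁ d) ≫ w' := by
      rintro A B E P Q S T a b c d w _ rfl h
      calc _ = (α_ _ _ _).hom ≫ D ◁ (E ◁ a ≫ b) := by monoidal
        _ = _ := by rw [h]; monoidal
    exact step (whiskerLeft_eqToHom _ _) ih

theorem tpowAdd_zero_left (n : ℕ) :
    (tpowAdd X 0 n).hom = (λ_ (tpow X n)).hom ≫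
      eqToHom (congrArg (tpow X) (Nat.zero_add n).symm) := by
  induction n with
  | zero =>
    have step : (ρ_ (𝟙_ C)).hom = (λ_ (𝟙_ C)).hom ≫ 𝟙 _ := by
      rw [Category.comp_id, unitors_equal]
    exact step
  | succ n ih =>
    have step : ∀ {A B : C} {a : 𝟙_ C ⊗ A ⟶ B} {w : A ⟶ B} {w' : A ⊗ X ⟶ B ⊗ X}, w ▷ X = w' →
        a = (λ_ A).hom ≫ w → (α_ (𝟙_ C) A X).inv ≫ a ▷ X = (λ_ (A ⊗ X)).hom ≫ w' := by
      rintro A B a w _ rfl rfl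
      monoidal
    exact step (eqToHom_whiskerRight _ _) ih

theorem dpowAdd_zero_left (D : C) (n : ℕ) :
    (dpowAdd D 0 n).hom = (ρ_ (dpow D n)).hom ≫
      eqToHom (congrArg (dpow D) (Nat.zero_add n).symm) := by
  induction n with
  | zero =>
    have step : (λ_ (𝟙_ C)).hom = (ρ_ (𝟙_ C)).hom ≫ 𝟙 _ := by
      rw [Category.comp_id, unitors_equal]
    exact step
  | succ n ih =>
    have step : ∀ {A B : C} {a : A ⊗ 𝟙_ C ⟶ B} {w : A ⟶ B} {w' : D ⊗ A ⟶ D ⊗ B}, D ◁ w = w' →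
        a = (ρ_ A).hom ≫ w → (α_ D A (𝟙_ C)).hom ≫ D ◁ a = (ρ_ (D ⊗ A)).hom ≫ w' := by
      rintro A B a w _ rfl rfl
      monoidal
    exact step (whiskerLeft_eqToHom _ _) ih

/-- `X ⊗ X^{⊗ n} ≅ X^{⊗ (n + 1)}`. -/
def tpowCons : ∀ n : ℕ, X ⊗ tpow X n ≅ tpow X (n + 1)
  | 0 => ρ_ X ≪≫ (λ_ X).symm
  | n + 1 => (α_ X (tpow X n) X).symm ≪≫ whiskerRightIso (tpowCons n) X

/-- Moving one factor across the bracket: `(X^{⊗m} ⊗ X) ⊗ X^{⊗n}` and `X^{⊗m} ⊗ (X ⊗ X^{⊗n})` are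
regrouped in the same way. -/
theorem tpowAdd_tpowCons (m n : ℕ) :
    (α_ (tpow X m) X (tpow X n)).hom ≫ tpow X m ◁ (tpowCons X n).hom ≫
        (tpowAdd X m (n + 1)).hom =
      (tpowAdd X (m + 1) n).hom ≫
        eqToHom (congrArg (tpow X) (show m + 1 + n = m + (n + 1) by omega)) := by
  induction n with
  | zero =>
    have step : ∀ A : C, (α_ A X (𝟙_ C)).hom ≫ A ◁ ((ρ_ X).hom ≫ (λ_ X).inv) ≫
        (α_ A (𝟙_ C) X).inv ≫ (ρ_ A).hom ▷ X = (ρ_ (A ⊗ X)).hom ≫ 𝟙 _ := by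
      intro A
      monoidal
    exact step _
  | succ n ih =>
    have step : ∀ {A B E P Q : C} {a : X ⊗ B ⟶ E} {b : A ⊗ E ⟶ P} {c : (A ⊗ X) ⊗ B ⟶ Q}
        {w : Q ⟶ P} {w' : Q ⊗ X ⟶ P ⊗ X}, w ▷ X = w' →
        (α_ A X B).hom ≫ A ◁ a ≫ b = c ≫ w →
        (α_ A X (B ⊗ X)).hom ≫ A ◁ ((α_ X B X).inv ≫ a ▷ X) ≫ (α_ A E X).inv ≫ b ▷ X =
          ((α_ (A ⊗ X) B X).inv ≫ c ▷ X) ≫ w' := by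
      rintro A B E P Q a b c w _ rfl h
      calc _ = (α_ _ _ _).inv ≫ ((α_ A X B).hom ≫ A ◁ a ≫ b) ▷ X := by monoidal
        _ = _ := by rw [h]; monoidal
    exact step (eqToHom_whiskerRight _ _) ih

theorem tpowCons_tpowAdd (m n : ℕ) :
    (α_ X (tpow X m) (tpow X n)).inv ≫ (tpowCons X m).hom ▷ tpow X n ≫ (tpowAdd X (m + 1) n).hom =
      X ◁ (tpowAdd X m n).hom ≫ (tpowCons X (m + n)).hom ≫
        eqToHom (congrArg (tpow X) (show m + n + 1 = m + 1 + n by omega)) := by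
  induction n with
  | zero =>
    have step : ∀ {A B : C} (a : X ⊗ A ⟶ B), (α_ X A (𝟙_ C)).inv ≫ a ▷ 𝟙_ C ≫ (ρ_ B).hom =
        X ◁ (ρ_ A).hom ≫ a ≫ 𝟙 _ := by
      intro A B a
      monoidal
    exact step _
  | succ n ih =>
    have step : ∀ {A B E P Q S : C} {a : X ⊗ A ⟶ E} {b : E ⊗ B ⟶ P} {c : A ⊗ B ⟶ Q}
        {d : X ⊗ Q ⟶ S} {w : S ⟶ P} {w' : S ⊗ X ⟶ P ⊗ X}, w ▷ X = w' →
        (α_ X A B).inv ≫ a ▷ B ≫ b = X ◁ c ≫ d ≫ w →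
        (α_ X A (B ⊗ X)).inv ≫ a ▷ (B ⊗ X) ≫ (α_ E B X).inv ≫ b ▷ X =
          X ◁ ((α_ A B X).inv ≫ c ▷ X) ≫ ((α_ X Q X).inv ≫ d ▷ X) ≫ w' := by
      rintro A B E P Q S a b c d w _ rfl h
      calc _ = 𝟙 _ ⊗≫ ((α_ X A B).inv ≫ a ▷ B ≫ b) ▷ X := by monoidal
        _ = _ := by rw [h]; monoidal
    exact step (eqToHom_whiskerRight _ _) ih

end Coherence
end Powers

section PowerExchange

variable {C : Type u} [Category.{v} C] [MonoidalCategory C]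

/-! ### Exchange morphisms of tensor powers -/

section
variable {X : C} (R : X ⊗ X ⟶ X ⊗ X)

theorem extRight_succ {W Y : C} (r : W ⊗ Y ⟶ Y ⊗ W) (n : ℕ) :
    extRight r (n + 1) = exchangeTensor (extRight r n) r := rfl

theorem Rpow_succ (m n : ℕ) :
    Rpow R (m + 1) n = tensorExchange (Rpow R m n) (extRight R n) := rfl

theorem isIso_tensorExchange {A B Y : C} (a : A ⊗ Y ⟶ Y ⊗ A) (b : B ⊗ Y ⟶ Y ⊗ B) [IsIso a]
    [IsIso b] : IsIso (tensorExchange a b) := by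
  unfold tensorExchange
  infer_instance

theorem isIso_exchangeTensor {V A B : C} (a : V ⊗ A ⟶ A ⊗ V) (b : V ⊗ B ⟶ B ⊗ V) [IsIso a]
    [IsIso b] : IsIso (exchangeTensor a b) := by
  unfold exchangeTensor
  infer_instance

theorem isIso_exchangeUnit (V : C) : IsIso (exchangeUnit V) := by
  unfold exchangeUnit
  infer_instance

theorem isIso_unitExchange (Y : C) : IsIso (unitExchange Y) := by
  unfold unitExchange
  infer_instance

instance isIso_extRight {W Y : C} (r : W ⊗ Y ⟶ Y ⊗ W) [IsIso r] : ∀ n, IsIso (extRight r n)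
  | 0 => isIso_exchangeUnit W
  | n + 1 => by
    have := isIso_extRight r n
    exact isIso_exchangeTensor (extRight r n) r

instance isIso_extRightDual {W Y : C} (r : W ⊗ Y ⟶ Y ⊗ W) [IsIso r] :
    ∀ n, IsIso (extRightDual r n)
  | 0 => isIso_exchangeUnit W
  | n + 1 => by
    have := isIso_extRightDual r n
    exact isIso_exchangeTensor r (extRightDual r n)

instance isIso_extLeft {W Y : C} (r : W ⊗ Y ⟶ Y ⊗ W) [IsIso r] : ∀ n, IsIso (extLeft r n)
  | 0 => isIso_unitExchange Y
  | n + 1 => by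
    have := isIso_extLeft r n
    exact isIso_tensorExchange (extLeft r n) r

instance [IsIso R] (m n : ℕ) : IsIso (Rpow R m n) := by
  unfold Rpow; infer_instance

/-- The hexagon identity in the first variable, for the regrouping of tensor powers. -/
theorem Rpow_add_left (m n k : ℕ) :
    NatExchange (tensorExchange (Rpow R m k) (Rpow R n k)) (Rpow R (m + n) k)
      (tpowAdd X m n).hom := by
  induction n with
  | zero => exact NatExchange.rightUnitor (Rpow R m k)
  | succ n ih =>
    exact (NatExchange.symm (f := α_ (tpow X m) (tpow X n) X)
      (NatExchange.associator (Rpow R m k) (Rpow R n k) (extRight R k))).comp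
        (ih.whiskerRight (extRight R k))

theorem extRight_add {W : C} (r : W ⊗ X ⟶ X ⊗ W) (n k : ℕ) :
    ExchangeNat (exchangeTensor (extRight r n) (extRight r k)) (extRight r (n + k))
      (tpowAdd X n k).hom := by
  induction k with
  | zero => exact ExchangeNat.rightUnitor (extRight r n)
  | succ k ih =>
    exact (ExchangeNat.symm (f := α_ (tpow X n) (tpow X k) X)
      (ExchangeNat.associator (extRight r n) (extRight r k) r)).comp (ih.whiskerRight r)

/-- The hexagon identity in the second variable, for the regrouping of tensor powers. -/
theorem Rpow_add_right (m n k : ℕ) :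
    ExchangeNat (exchangeTensor (Rpow R m n) (Rpow R m k)) (Rpow R m (n + k))
      (tpowAdd X n k).hom := by
  induction m with
  | zero =>
    have h := exchangeNat_unit (tpowAdd X n k).hom
    rw [← exchangeTensor_unitExchange] at h
    exact h
  | succ m ih =>
    have h := ih.tensorExchange (extRight_add R n k)
    rw [← exchangeTensor_tensorExchange] at h
    exact h

end

/-! ### The generators of the relations -/

section
variable {X : C}

/-- `R` on the last two factors of `X^{⊗ (i + 2)}`. -/
def braidAt (R : X ⊗ X ⟶ X ⊗ X) (i : ℕ) : tpow X (i + 2) ⟶ tpow X (i + 2) :=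
  (α_ (tpow X i) X X).hom ≫ tpow X i ◁ R ≫ (α_ (tpow X i) X X).inv

/-- A pairing on the last two factors of `X^{⊗ (i + 2)}`. -/
def capAt (c : X ⊗ X ⟶ 𝟙_ C) (i : ℕ) : tpow X (i + 2) ⟶ tpow X i :=
  (α_ (tpow X i) X X).hom ≫ tpow X i ◁ c ≫ (ρ_ (tpow X i)).hom

/-- A copairing inserted after `X^{⊗ i}`. -/
def cupAt (k : 𝟙_ C ⟶ X ⊗ X) (i : ℕ) : tpow X i ⟶ tpow X (i + 2) :=
  (ρ_ (tpow X i)).inv ≫ tpow X i ◁ k ≫ (α_ (tpow X i) X X).inv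

/-- The morphisms `1 ⊗ g ⊗ 1` between tensor powers of `X`, where `g` is `R` or the pairing or
copairing of a duality of `X` with itself in the class `K`. -/
inductive Gen (R : X ⊗ X ⟶ X ⊗ X) (K : ExactPairing X X → Prop) :
    ∀ {a b : ℕ}, (tpow X a ⟶ tpow X b) → Prop
  | braid (i : ℕ) : Gen R K (braidAt R i)
  | cap (c : ExactPairing X X) (hc : K c) (i : ℕ) : Gen R K (capAt c.evaluation' i)
  | cup (c : ExactPairing X X) (hc : K c) (i : ℕ) : Gen R K (cupAt c.coevaluation' i)
  | whisk {a b : ℕ} (f : tpow X a ⟶ tpow X b) (hf : Gen R K f) :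
      Gen R K (a := a + 1) (b := b + 1) (f ▷ X)

/-- Composites of generators that only pass through tensor powers with exponent in `P`. -/
inductive Word (R : X ⊗ X ⟶ X ⊗ X) (K : ExactPairing X X → Prop) (P : ℕ → Prop) :
    ∀ {a b : ℕ}, (tpow X a ⟶ tpow X b) → Prop
  | eq {a b : ℕ} (h : a = b) (ha : P a) : Word R K P (eqToHom (congrArg (tpow X) h))
  | gen {a b : ℕ} {f : tpow X a ⟶ tpow X b} (hf : Gen R K f) (ha : P a) (hb : P b) : Word R K P f
  | comp {a b d : ℕ} {f : tpow X a ⟶ tpow X b} {g : tpow X b ⟶ tpow X d} (hf : Word R K P f)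
      (hg : Word R K P g) : Word R K P (f ≫ g)

variable {R : X ⊗ X ⟶ X ⊗ X} {K : ExactPairing X X → Prop}

section Natural

theorem BraidEq.natExchange (hR : BraidEq R) :
    NatExchange (tensorExchange R R) (tensorExchange R R) R := by
  unfold BraidEq at hR
  unfold NatExchange tensorExchange
  simp only [Category.assoc]
  rw [← cancel_epi (α_ X X X).inv, hR, Iso.inv_hom_id_assoc]

theorem BraidEq.exchangeNat (hR : BraidEq R) :
    ExchangeNat (exchangeTensor R R) (exchangeTensor R R) R := by
  unfold BraidEq at hR
  unfold ExchangeNat exchangeTensor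
  simp only [Category.assoc]
  rw [← cancel_mono (α_ X X X).hom]
  simp only [Category.assoc]
  rw [Iso.inv_hom_id, Category.comp_id, hR]

theorem Flows.natExchange {c : X ⊗ X ⟶ 𝟙_ C} (hc : Flows R c) :
    NatExchange (tensorExchange R R) (unitExchange X) c := by
  unfold NatExchange tensorExchange unitExchange
  rw [← Category.assoc (c ▷ X), ← hc.2]
  simp

theorem Flows.exchangeNat {c : X ⊗ X ⟶ 𝟙_ C} (hc : Flows R c) :
    ExchangeNat (exchangeTensor R R) (exchangeUnit X) c := by
  unfold ExchangeNat exchangeTensor exchangeUnit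
  rw [← Category.assoc (X ◁ c), ← hc.1]
  simp

theorem natExchange_extRight {A B : C} {f : A ⟶ B} {a : A ⊗ X ⟶ X ⊗ A} {b : B ⊗ X ⟶ X ⊗ B}
    (h : NatExchange a b f) (n : ℕ) : NatExchange (extRight a n) (extRight b n) f := by
  induction n with
  | zero =>
    change NatExchange (exchangeUnit A) (exchangeUnit B) f
    unfold NatExchange exchangeUnit
    simp
  | succ n ih => exact ih.exchangeTensor h

theorem extRight_tensorExchange {A B : C} (a : A ⊗ X ⟶ X ⊗ A) (b : B ⊗ X ⟶ X ⊗ B) (n : ℕ) :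
    extRight (tensorExchange a b) n = tensorExchange (extRight a n) (extRight b n) := by
  induction n with
  | zero => exact (tensorExchange_exchangeUnit A B).symm
  | succ n ih => rw [extRight_succ, ih, exchangeTensor_tensorExchange]; rfl

theorem extRight_unitExchange (n : ℕ) :
    extRight (unitExchange X) n = unitExchange (tpow X n) := by
  induction n with
  | zero => exact exchangeUnit_unit
  | succ n ih => rw [extRight_succ, ih, exchangeTensor_unitExchange]; rfl

/-- `R_{-, X^{⊗ n}}` is natural with respect to the generators. -/
theorem Gen.natExchange [IsIso R] (hR : BraidEq R)
    (hK : ∀ c, K c → Flows R c.evaluation') {a b : ℕ} {f : tpow X a ⟶ tpow X b} (hf : Gen R K f)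
    (n : ℕ) : NatExchange (Rpow R a n) (Rpow R b n) f := by
  induction hf with
  | braid i =>
    have h := natExchange_extRight hR.natExchange n
    rw [extRight_tensorExchange] at h
    exact (NatExchange.associator (Rpow R i n) (extRight R n) (extRight R n)).comp
      ((h.whiskerLeft (Rpow R i n)).comp (NatExchange.symm (f := α_ (tpow X i) X X)
        (NatExchange.associator (Rpow R i n) (extRight R n) (extRight R n))))
  | cap c hc i =>
    have h := natExchange_extRight (hK c hc).natExchange n
    rw [extRight_tensorExchange, extRight_unitExchange] at h
    exact (NatExchange.associator (Rpow R i n) (extRight R n) (extRight R n)).comp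
      ((h.whiskerLeft (Rpow R i n)).comp (NatExchange.rightUnitor (Rpow R i n)))
  | cup c hc i =>
    have h := natExchange_extRight (hK c hc).natExchange n
    rw [extRight_tensorExchange, extRight_unitExchange] at h
    -- compatibility with the copairing follows from that with the pairing, the exchange morphisms
    -- being invertible
    have h' := @NatExchange.coevaluation C _ _ _ X X c _ _ _ h
    exact (NatExchange.symm (f := ρ_ (tpow X i)) (NatExchange.rightUnitor (Rpow R i n))).comp
      ((h'.whiskerLeft (Rpow R i n)).comp (NatExchange.symm (f := α_ (tpow X i) X X)
        (NatExchange.associator (Rpow R i n) (extRight R n) (extRight R n))))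
  | whisk f _ ih => exact ih.whiskerRight (extRight R n)

/-- The counterpart of `Gen.natExchange` in the second variable, for the exchange with one copy of
`X`. -/
theorem Gen.exchangeNat_one [IsIso R] (hR : BraidEq R)
    (hK : ∀ c, K c → Flows R c.evaluation') {a b : ℕ} {f : tpow X a ⟶ tpow X b} (hf : Gen R K f) :
    ExchangeNat (extRight R a) (extRight R b) f := by
  induction hf with
  | braid i =>
    exact (ExchangeNat.associator (extRight R i) R R).comp
      ((hR.exchangeNat.whiskerLeft (extRight R i)).comp (ExchangeNat.symm (f := α_ (tpow X i) X X)
        (ExchangeNat.associator (extRight R i) R R)))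
  | cap c hc i =>
    exact (ExchangeNat.associator (extRight R i) R R).comp
      (((hK c hc).exchangeNat.whiskerLeft (extRight R i)).comp
        (ExchangeNat.rightUnitor (extRight R i)))
  | cup c hc i =>
    have h' := @ExchangeNat.coevaluation C _ _ _ X X c _ _ _ (hK c hc).exchangeNat
    exact (ExchangeNat.symm (f := ρ_ (tpow X i)) (ExchangeNat.rightUnitor (extRight R i))).comp
      ((h'.whiskerLeft (extRight R i)).comp (ExchangeNat.symm (f := α_ (tpow X i) X X)
        (ExchangeNat.associator (extRight R i) R R)))
  | whisk f _ ih => exact ih.whiskerRight R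

/-- `R_{X^{⊗ n}, -}` is natural with respect to the generators. -/
theorem Gen.exchangeNat [IsIso R] (hR : BraidEq R)
    (hK : ∀ c, K c → Flows R c.evaluation') {a b : ℕ} {f : tpow X a ⟶ tpow X b} (hf : Gen R K f)
    (n : ℕ) : ExchangeNat (Rpow R n a) (Rpow R n b) f := by
  induction n with
  | zero => exact exchangeNat_unit f
  | succ n ih => exact ih.tensorExchange (exchangeNat_one hR hK hf)

end Natural

/-! ### Words in the generators -/

theorem Word.mono {P Q : ℕ → Prop} (h : ∀ a, P a → Q a) {a b : ℕ} {f : tpow X a ⟶ tpow X b}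
    (hf : Word R K P f) : Word R K Q f := by
  induction hf with
  | eq e ha => exact .eq e (h _ ha)
  | gen hf ha hb => exact .gen hf (h _ ha) (h _ hb)
  | comp _ _ ihf ihg => exact ihf.comp ihg

theorem Word.whisk {P Q : ℕ → Prop} (h : ∀ a, P a → Q (a + 1)) {a b : ℕ}
    {f : tpow X a ⟶ tpow X b} (hf : Word R K P f) :
    Word R K Q (a := a + 1) (b := b + 1) (f ▷ X) := by
  induction hf with
  | eq e ha =>
    have := Word.eq (R := R) (K := K) (congrArg (· + 1) e) (h _ ha)
    rw [eqToHom_whiskerRight]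
    exact this
  | gen hf ha hb => exact .gen (.whisk _ hf) (h _ ha) (h _ hb)
  | comp _ _ ihf ihg => rw [comp_whiskerRight]; exact ihf.comp ihg

theorem Word.tpowRight (k : ℕ) {P Q : ℕ → Prop} (h : ∀ a, P a → Q (a + k)) {a b : ℕ}
    {f : tpow X a ⟶ tpow X b} (hf : Word R K P f) :
    Word R K Q ((tpowAdd X a k).inv ≫ f ▷ tpow X k ≫ (tpowAdd X b k).hom) := by
  induction k generalizing Q with
  | zero =>
    have : (ρ_ (tpow X a)).inv ≫ f ▷ 𝟙_ C ≫ (ρ_ (tpow X b)).hom = f := by simp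
    exact Eq.mpr (congrArg _ this) (hf.mono h)
  | succ k ih =>
    have step : ∀ {A B E P Q : C} (e : A ⊗ E ≅ P) (e' : B ⊗ E ≅ Q) (f : A ⟶ B),
        (e.inv ▷ X ≫ (α_ A E X).hom) ≫ f ▷ (E ⊗ X) ≫ (α_ B E X).inv ≫ e'.hom ▷ X =
          (e.inv ≫ f ▷ E ≫ e'.hom) ▷ X := by
      intro A B E P Q e e' f
      monoidal
    exact Eq.mpr (congrArg (Word R K Q (a := a + k + 1) (b := b + k + 1))
      (step (tpowAdd X a k) (tpowAdd X b k) f)) ((ih (Q := fun j => Q (j + 1)) h).whisk fun _ => id)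

section Pad
variable {Z : C}

/-- Padding the generator `A ◁ R` on the left by `Z` gives the same generator with `A` replaced by
`Z ⊗ A`, up to regrouping. The next two lemmas say the same for pairings and copairings. -/
theorem pad_braidAt (R : X ⊗ X ⟶ X ⊗ X) {A B : C} (e : Z ⊗ A ≅ B) :
    (((e.inv ▷ X ≫ (α_ Z A X).hom)) ▷ X ≫ (α_ Z (A ⊗ X) X).hom) ≫
        Z ◁ ((α_ A X X).hom ≫ A ◁ R ≫ (α_ A X X).inv) ≫
          (α_ Z (A ⊗ X) X).inv ≫ ((α_ Z A X).inv ≫ e.hom ▷ X) ▷ X =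
      (α_ B X X).hom ≫ B ◁ R ≫ (α_ B X X).inv := by
  calc _ = 𝟙 _ ⊗≫ (e.inv ▷ (X ⊗ X) ≫ (Z ⊗ A) ◁ R) ⊗≫ e.hom ▷ (X ⊗ X) ⊗≫ 𝟙 _ := by monoidal
    _ = 𝟙 _ ⊗≫ B ◁ R ⊗≫ (e.inv ≫ e.hom) ▷ (X ⊗ X) ⊗≫ 𝟙 _ := by
      rw [← whisker_exchange]; monoidal
    _ = _ := by rw [e.inv_hom_id]; monoidal

theorem pad_capAt (c : X ⊗ X ⟶ 𝟙_ C) {A B : C} (e : Z ⊗ A ≅ B) :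
    (((e.inv ▷ X ≫ (α_ Z A X).hom)) ▷ X ≫ (α_ Z (A ⊗ X) X).hom) ≫
        Z ◁ ((α_ A X X).hom ≫ A ◁ c ≫ (ρ_ A).hom) ≫ e.hom =
      (α_ B X X).hom ≫ B ◁ c ≫ (ρ_ B).hom := by
  calc _ = 𝟙 _ ⊗≫ (e.inv ▷ (X ⊗ X) ≫ (Z ⊗ A) ◁ c) ⊗≫ e.hom := by monoidal
    _ = 𝟙 _ ⊗≫ B ◁ c ⊗≫ (e.inv ≫ e.hom) := by
      rw [← whisker_exchange]; monoidal
    _ = _ := by rw [e.inv_hom_id]; monoidal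

theorem pad_cupAt (k : 𝟙_ C ⟶ X ⊗ X) {A B : C} (e : Z ⊗ A ≅ B) :
    e.inv ≫ Z ◁ ((ρ_ A).inv ≫ A ◁ k ≫ (α_ A X X).inv) ≫
          (α_ Z (A ⊗ X) X).inv ≫ ((α_ Z A X).inv ≫ e.hom ▷ X) ▷ X =
      (ρ_ B).inv ≫ B ◁ k ≫ (α_ B X X).inv := by
  calc _ = 𝟙 _ ⊗≫ (e.inv ▷ (𝟙_ C) ≫ (Z ⊗ A) ◁ k) ⊗≫ e.hom ▷ (X ⊗ X) ⊗≫ 𝟙 _ := by monoidal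
    _ = 𝟙 _ ⊗≫ B ◁ k ⊗≫ (e.inv ≫ e.hom) ▷ (X ⊗ X) ⊗≫ 𝟙 _ := by
      rw [← whisker_exchange]; monoidal
    _ = _ := by rw [e.inv_hom_id]; monoidal

theorem pad_whisk {A B E F : C} (f : A ⟶ E) (e : Z ⊗ A ≅ B) (e' : Z ⊗ E ≅ F) :
    (e.inv ▷ X ≫ (α_ Z A X).hom) ≫ Z ◁ (f ▷ X) ≫ (α_ Z E X).inv ≫ e'.hom ▷ X =
      (e.inv ≫ Z ◁ f ≫ e'.hom) ▷ X := by
  monoidal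

end Pad

/-- Tensoring a generator with a power of `X` on the left gives a generator. -/
theorem Gen.tpowLeft (k : ℕ) {a b : ℕ} {f : tpow X a ⟶ tpow X b} (hf : Gen R K f) :
    Gen R K ((tpowAdd X k a).inv ≫ tpow X k ◁ f ≫ (tpowAdd X k b).hom) := by
  induction hf with
  | braid i =>
    exact Eq.mpr (congrArg (Gen R K (a := k + i + 2) (b := k + i + 2))
      (pad_braidAt R (tpowAdd X k i))) (.braid _)
  | cap c hc i =>
    exact Eq.mpr (congrArg (Gen R K (a := k + i + 2) (b := k + i))
      (pad_capAt c.evaluation' (tpowAdd X k i))) (.cap c hc _)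
  | cup c hc i =>
    exact Eq.mpr (congrArg (Gen R K (a := k + i) (b := k + i + 2))
      (pad_cupAt c.coevaluation' (tpowAdd X k i))) (.cup c hc _)
  | @whisk a b f _ ih =>
    exact Eq.mpr (congrArg (Gen R K (a := k + a + 1) (b := k + b + 1))
      (pad_whisk f (tpowAdd X k a) (tpowAdd X k b))) ih.whisk

theorem Gen.cons {a b : ℕ} {f : tpow X a ⟶ tpow X b} (hf : Gen R K f) :
    Gen R K ((tpowCons X a).inv ≫ X ◁ f ≫ (tpowCons X b).hom) := by
  induction hf with
  | braid i =>
    exact Eq.mpr (congrArg (Gen R K (a := i + 1 + 2) (b := i + 1 + 2))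
      (pad_braidAt R (tpowCons X i))) (.braid _)
  | cap c hc i =>
    exact Eq.mpr (congrArg (Gen R K (a := i + 1 + 2) (b := i + 1))
      (pad_capAt c.evaluation' (tpowCons X i))) (.cap c hc _)
  | cup c hc i =>
    exact Eq.mpr (congrArg (Gen R K (a := i + 1) (b := i + 1 + 2))
      (pad_cupAt c.coevaluation' (tpowCons X i))) (.cup c hc _)
  | @whisk a b f _ ih =>
    exact Eq.mpr (congrArg (Gen R K (a := a + 1 + 1) (b := b + 1 + 1))
      (pad_whisk f (tpowCons X a) (tpowCons X b))) ih.whisk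

theorem Word.tpowLeft (k : ℕ) {P Q : ℕ → Prop} (h : ∀ a, P a → Q (k + a)) {a b : ℕ}
    {f : tpow X a ⟶ tpow X b} (hf : Word R K P f) :
    Word R K Q ((tpowAdd X k a).inv ≫ tpow X k ◁ f ≫ (tpowAdd X k b).hom) := by
  induction hf with
  | eq e ha =>
    subst e
    have := Word.eq (R := R) (K := K) rfl (h _ ha)
    simpa using this
  | gen hf ha hb => exact .gen (hf.tpowLeft k) (h _ ha) (h _ hb)
  | @comp a b d f g _ _ ihf ihg =>
    have := ihf.comp ihg
    simpa using this

theorem Word.cons {P Q : ℕ → Prop} (h : ∀ a, P a → Q (a + 1)) {a b : ℕ}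
    {f : tpow X a ⟶ tpow X b} (hf : Word R K P f) :
    Word R K Q ((tpowCons X a).inv ≫ X ◁ f ≫ (tpowCons X b).hom) := by
  induction hf with
  | eq e ha =>
    subst e
    have := Word.eq (R := R) (K := K) rfl (h _ ha)
    simpa using this
  | gen hf ha hb => exact .gen hf.cons (h _ ha) (h _ hb)
  | @comp a b d f g _ _ ihf ihg =>
    have := ihf.comp ihg
    simpa using this

/-- `R_{X, X^{⊗n}}` is a composite of generators. -/
theorem word_extRight (n : ℕ) :
    Word R K (· = n + 1) (a := n + 1) (b := n + 1) ((tpowCons X n).inv ≫ extRight R n) := by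
  induction n with
  | zero =>
    have : ((λ_ X).hom ≫ (ρ_ X).inv) ≫ (ρ_ X).hom ≫ (λ_ X).inv = 𝟙 (tpow X 1) := by
      rw [Category.assoc, Iso.inv_hom_id_assoc]; exact Iso.hom_inv_id _
    exact Eq.mpr (congrArg (Word R K (· = 1) (a := 1) (b := 1)) this) (.eq rfl rfl)
  | succ n ih =>
    have step : ∀ {A B : C} (e : X ⊗ A ≅ B) (r : X ⊗ A ⟶ A ⊗ X),
        (e.inv ▷ X ≫ (α_ X A X).hom) ≫ (α_ X A X).inv ≫ r ▷ X ≫ (α_ A X X).hom ≫ A ◁ R ≫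
          (α_ A X X).inv = (e.inv ≫ r) ▷ X ≫ (α_ A X X).hom ≫ A ◁ R ≫ (α_ A X X).inv := by
      intro A B e r
      monoidal
    exact Eq.mpr (congrArg (Word R K (· = n + 2) (a := n + 2) (b := n + 2))
      (step (tpowCons X n) (extRight R n)))
        ((ih.whisk (by intro a h; omega)).comp (.gen (.braid n) rfl rfl))

/-- `R_{X^{⊗m}, X^{⊗n}}` is a composite of generators. Targets dinatural along the generators are
therefore dinatural along it, which is what the exchange law of the coquasitriangular structure
amounts to. -/
theorem word_Rpow (m n : ℕ) :
    Word R K (· = m + n) ((tpowAdd X m n).inv ≫ Rpow R m n ≫ (tpowAdd X n m).hom) := by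
  induction m with
  | zero =>
    have : (tpowAdd X 0 n).inv ≫ ((λ_ (tpow X n)).hom ≫ (ρ_ (tpow X n)).inv) ≫
        (ρ_ (tpow X n)).hom = eqToHom (congrArg (tpow X) (Nat.zero_add n)) := by
      have step : ∀ {A B : C} (e : 𝟙_ C ⊗ A ≅ B) (w : A ⟶ B) (w' : B ⟶ A),
          e.hom = (λ_ A).hom ≫ w → w ≫ w' = 𝟙 A →
            e.inv ≫ ((λ_ A).hom ≫ (ρ_ A).inv) ≫ (ρ_ A).hom = w' := by
        intro A B e w w' h h'
        rw [Iso.inv_comp_eq, h, Category.assoc, Category.assoc, h', Iso.inv_hom_id]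
      exact step (tpowAdd X 0 n) _ _ (tpowAdd_zero_left X n) (eqToHom_trans _ _)
    exact Eq.mpr (congrArg _ this) (.eq (Nat.zero_add n) rfl)
  | succ m ih =>
    have h₁ : Word R K (· = m + 1 + n) (eqToHom (congrArg (tpow X)
        (show m + 1 + n = m + (n + 1) by omega)) ≫ (tpowAdd X m (n + 1)).inv ≫
          tpow X m ◁ ((tpowCons X n).inv ≫ extRight R n) ≫ (tpowAdd X m (n + 1)).hom) :=
      (Word.eq (P := (· = m + 1 + n)) (by omega) rfl).comp
        ((word_extRight n).tpowLeft (Q := (· = m + 1 + n)) m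
        (by intro a h; omega))
    have h₂ := h₁.comp (ih.whisk (Q := (· = m + 1 + n)) (by intro a h; omega))
    have step : ∀ {A B E F P Q S : C} (e : (A ⊗ X) ⊗ B ≅ P) (e' : A ⊗ E ≅ Q) (w : P ⟶ Q)
        (t : X ⊗ B ≅ E) (s : X ⊗ B ⟶ B ⊗ X) (d : A ⊗ B ≅ S) (g : B ⊗ A ⟶ F) (r : A ⊗ B ⟶ B ⊗ A)
        (q : A ⊗ (B ⊗ X) ⟶ S ⊗ X),
        (α_ A X B).hom ≫ A ◁ t.hom ≫ e'.hom = e.hom ≫ w → q = (α_ _ _ _).inv ≫ d.hom ▷ X →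
        e.inv ≫ ((α_ A X B).hom ≫ A ◁ s ≫ (α_ A B X).inv ≫ r ▷ X ≫ (α_ B A X).hom) ≫
          (α_ B A X).inv ≫ g ▷ X =
        (w ≫ e'.inv ≫ A ◁ (t.inv ≫ s) ≫ q) ≫ (d.inv ≫ r ≫ g) ▷ X := by
      rintro A B E F P Q S e e' w t s d g r q h rfl
      rw [Iso.inv_comp_eq]
      simp only [← Category.assoc]
      rw [← h]
      simp
    refine Eq.mpr (congrArg (Word R K (· = m + 1 + n) (a := m + 1 + n) (b := n + m + 1)) ?_) h₂
    exact step (tpowAdd X (m + 1) n) (tpowAdd X m (n + 1)) _ (tpowCons X n) (extRight R n)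
      (tpowAdd X m n) (tpowAdd X n m).hom (Rpow R m n) _ (tpowAdd_tpowCons X m n) rfl

end
end PowerExchange

section PowerDual

variable {C : Type u} [Category.{v} C] [MonoidalCategory C]

/-! ### Exchange of tensor powers with dual tensor powers -/

section
variable {X : C} (D : C) [ExactPairing X D] (R : X ⊗ X ⟶ X ⊗ X)

/-- The evaluation `D^{⊗n} ⊗ X^{⊗n} ⟶ 𝟙` is compatible with the exchange with `X`, where the
exchange with `D` is the inverse of the rotation of `R`. -/
theorem exchangeNat_ev_one [IsIso (rotate D R)] (n : ℕ) :
    ExchangeNat (exchangeTensor (extRightDual (inv (rotate D R)) n) (extRight R n))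
      (exchangeUnit X) (ev X D n) := by
  induction n with
  | zero =>
    have h := ExchangeNat.rightUnitor (exchangeUnit X)
    rw [← unitors_equal] at h
    exact h
  | succ n ih =>
    have h : ExchangeNat (exchangeTensor (inv (rotate D R)) R) (exchangeUnit X) (ε_ X D) :=
      exchangeNat_evaluation (IsIso.inv_hom_id _)
    exact ExchangeNat.nest (A := tpow X n) (A' := dpow D n) ih h

/-- The evaluation slides through `R_{X^{⊗ m}, D^{⊗ n}}` and `R_{X^{⊗ m}, X^{⊗ n}}`. -/
theorem exchangeNat_ev [IsIso (rotate D R)] (m n : ℕ) :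
    ExchangeNat (exchangeTensor (RDpow D R m n) (Rpow R m n)) (exchangeUnit (tpow X m))
      (ε_ (tpow X n) (dpow D n)) := by
  induction m with
  | zero =>
    have h := exchangeNat_unit (ε_ (tpow X n) (dpow D n))
    rw [← exchangeTensor_unitExchange, ← exchangeUnit_unit] at h
    exact h
  | succ m ih => exact ih.tensorExchange_evaluation (exchangeNat_ev_one D R n)

/-- `R_{X^{⊗m}, D^{⊗n}}` is inverse to the rotation of `R_{X^{⊗m}, X^{⊗n}}`. -/
theorem RDpow_rotateExchange [IsIso (rotate D R)] (m n : ℕ) :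
    RDpow D R m n ≫ rotateExchange (dpow D n) (Rpow R m n) = 𝟙 _ :=
  comp_rotateExchange (exchangeNat_ev D R m n)

instance [IsIso (rotate D R)] (m n : ℕ) : IsIso (RDpow D R m n) := by
  unfold RDpow; infer_instance

theorem rotateExchange_RDpow [IsIso (rotate D R)] (m n : ℕ) :
    rotateExchange (dpow D n) (Rpow R m n) ≫ RDpow D R m n = 𝟙 _ := by
  rw [← cancel_epi (RDpow D R m n), reassoc_of% @RDpow_rotateExchange, Category.comp_id]

end

/-! ### Self-duality of tensor powers -/

section
variable {X : C}

/-- The duality of `X^{⊗ n}` with itself given by a duality of `X` with itself, with nested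
evaluation. -/
@[reducible]
def selfPair (c : ExactPairing X X) : ∀ n : ℕ, ExactPairing (tpow X n) (tpow X n)
  | 0 => exactPairingUnit
  | n + 1 => @exactPairingCongrRight C _ _ (tpow X n ⊗ X) (tpow X (n + 1)) (X ⊗ tpow X n)
      (@ExactPairing.tensor C _ _ (tpow X n) X (tpow X n) X (selfPair c n) c) (tpowCons X n).symm

variable {R : X ⊗ X ⟶ X ⊗ X}

/-- A pairing compatible with `R` makes `R` its own transpose. -/
theorem Flows.nest_comp [IsIso R] {c : X ⊗ X ⟶ 𝟙_ C} (hc : Flows R c) :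
    R ▷ (X ⊗ X) ≫ nest c c = (X ⊗ X) ◁ R ≫ nest c c := by
  have h₁ : R ▷ X ≫ (α_ X X X).hom ≫ X ◁ c ≫ (ρ_ X).hom =
      (α_ X X X).hom ≫ X ◁ inv R ≫ (α_ X X X).inv ≫ c ▷ X ≫ (λ_ X).hom := by
    rw [← hc.2, Iso.inv_hom_id_assoc, ← whiskerLeft_comp_assoc, IsIso.inv_hom_id, whiskerLeft_id,
      Category.id_comp, Iso.hom_inv_id_assoc]
  have h₂ : X ◁ R ≫ (α_ X X X).inv ≫ c ▷ X ≫ (λ_ X).hom =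
      (α_ X X X).inv ≫ inv R ▷ X ≫ (α_ X X X).hom ≫ X ◁ c ≫ (ρ_ X).hom := by
    rw [← hc.1, Iso.hom_inv_id_assoc, ← comp_whiskerRight_assoc, IsIso.inv_hom_id, id_whiskerRight,
      Category.id_comp, Iso.inv_hom_id_assoc]
  unfold nest
  calc _ = 𝟙 _ ⊗≫ (R ▷ X ≫ (α_ X X X).hom ≫ X ◁ c ≫ (ρ_ X).hom) ▷ X ⊗≫ c := by monoidal
    _ = 𝟙 _ ⊗≫ X ◁ inv R ▷ X ⊗≫ (c ▷ (X ⊗ X) ≫ 𝟙_ C ◁ c) ⊗≫ 𝟙 _ := by rw [h₁]; monoidal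
    _ = 𝟙 _ ⊗≫ X ◁ ((α_ X X X).inv ≫ inv R ▷ X ≫ (α_ X X X).hom ≫ X ◁ c ≫ (ρ_ X).hom) ⊗≫ c := by
      rw [← whisker_exchange]; monoidal
    _ = _ := by rw [← h₂]; monoidal

section Pad

/-- The dual of a morphism with respect to other duals, expressed through the comparison
isomorphisms of the duals. -/
theorem mate_eq_of_evaluation {V W V₁ W₁ V₂ W₂ : C} (p : ExactPairing V V₁) (q : ExactPairing W W₁)
    [ExactPairing V V₂] [ExactPairing W W₂] (e : V₁ ≅ V₂) (d : W₁ ≅ W₂)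
    (he : p.evaluation' = e.hom ▷ V ≫ ε_ V V₂) (hd : q.evaluation' = d.hom ▷ W ≫ ε_ W W₂)
    (f : V ⟶ W) : @mate C _ _ V W V₁ W₁ p q f = d.hom ≫ mate V₂ W₂ f ≫ e.inv := by
  refine @mate_unique C _ _ V W V₁ W₁ p q _ _ ?_
  change _ ≫ p.evaluation' = _ ≫ q.evaluation'
  rw [he, hd, whisker_exchange_assoc, ← mate_evaluation V₂ W₂]
  simp

theorem coevaluation_nest {X : C} [ExactPairing X X] :
    mate (X ⊗ X) (𝟙_ C) (ε_ X X) = η_ X X := by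
  refine mate_unique ?_
  have h : ε_ (𝟙_ C) (𝟙_ C) = (ρ_ (𝟙_ C)).hom := rfl
  rw [h, ExactPairing.tensor_evaluation]
  calc _ = 𝟙 _ ⊗≫ (η_ X X ▷ X ⊗≫ X ◁ ε_ X X) ▷ X ⊗≫ ε_ X X := by monoidal
    _ = _ := by rw [ExactPairing.evaluation_coevaluation'']; monoidal

theorem nest_coevaluation {X : C} [ExactPairing X X] :
    mate (𝟙_ C) (X ⊗ X) (η_ X X) = ε_ X X := by
  refine mate_unique ?_
  have h : ε_ (𝟙_ C) (𝟙_ C) = (ρ_ (𝟙_ C)).hom := rfl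
  rw [h, ExactPairing.tensor_evaluation]
  symm
  calc _ = 𝟙 _ ⊗≫ X ◁ (X ◁ η_ X X ⊗≫ ε_ X X ▷ X) ⊗≫ ε_ X X := by monoidal
    _ = _ := by rw [ExactPairing.coevaluation_evaluation'']; monoidal

/-- Transposes under the nested self-duality of `(V ⊗ X) ⊗ X`: a morphism acting on the last two
factors becomes its transpose acting on the first two. -/
theorem mate_pad_braid {V X : C} [ExactPairing V V] [ExactPairing X X] (R : X ⊗ X ⟶ X ⊗ X)
    (hR : mate (X ⊗ X) (X ⊗ X) R = R) :
    mate (X ⊗ (X ⊗ V)) (X ⊗ (X ⊗ V)) ((α_ V X X).hom ≫ V ◁ R ≫ (α_ V X X).inv) =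
      (α_ X X V).inv ≫ R ▷ V ≫ (α_ X X V).hom := by
  rw [mate_comp (X ⊗ (X ⊗ V)) ((X ⊗ X) ⊗ V) (X ⊗ (X ⊗ V)),
    mate_comp ((X ⊗ X) ⊗ V) ((X ⊗ X) ⊗ V) (X ⊗ (X ⊗ V)), mate_associator, mate_associator_inv,
    mate_whiskerLeft, hR, Category.assoc]

theorem mate_pad_cap {V X : C} [ExactPairing V V] [ExactPairing X X] :
    mate (X ⊗ (X ⊗ V)) V ((α_ V X X).hom ≫ V ◁ ε_ X X ≫ (ρ_ V).hom) =
      (λ_ V).inv ≫ η_ X X ▷ V ≫ (α_ X X V).hom := by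
  rw [mate_comp (X ⊗ (X ⊗ V)) ((X ⊗ X) ⊗ V) V,
    mate_comp ((X ⊗ X) ⊗ V) (𝟙_ C ⊗ V) V, mate_associator, mate_rightUnitor,
    mate_whiskerLeft, coevaluation_nest, Category.assoc]

theorem mate_pad_cup {V X : C} [ExactPairing V V] [ExactPairing X X] :
    mate V (X ⊗ (X ⊗ V)) ((ρ_ V).inv ≫ V ◁ η_ X X ≫ (α_ V X X).inv) =
      (α_ X X V).inv ≫ ε_ X X ▷ V ≫ (λ_ V).hom := by
  rw [mate_comp V (𝟙_ C ⊗ V) (X ⊗ (X ⊗ V)),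
    mate_comp (𝟙_ C ⊗ V) ((X ⊗ X) ⊗ V) (X ⊗ (X ⊗ V)), mate_associator_inv, mate_rightUnitor_inv,
    mate_whiskerLeft, nest_coevaluation, Category.assoc]

end Pad

variable {K : ExactPairing X X → Prop}

variable (X) in
/-- `X ⊗ (X ⊗ X^{⊗ n}) ≅ X^{⊗ (n + 2)}`. -/
def tpowConsTwo (n : ℕ) : X ⊗ (X ⊗ tpow X n) ≅ tpow X (n + 2) :=
  whiskerLeftIso X (tpowCons X n) ≪≫ tpowCons X (n + 1)

/-- The morphism `R` acting on the first two factors is a generator. The next two lemmas say the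
same for copairings and pairings. -/
theorem Gen.braid_head (n : ℕ) :
    Gen R K ((tpowConsTwo X n).inv ≫ ((α_ X X (tpow X n)).inv ≫ R ▷ tpow X n ≫
      (α_ X X (tpow X n)).hom) ≫ (tpowConsTwo X n).hom) := by
  induction n with
  | zero =>
    have step : (((ρ_ X ≪≫ (λ_ X).symm).inv ▷ X ≫ (α_ X (𝟙_ C) X).hom) ≫
        X ◁ (ρ_ X ≪≫ (λ_ X).symm).inv) ≫ ((α_ X X (𝟙_ C)).inv ≫ R ▷ 𝟙_ C ≫
        (α_ X X (𝟙_ C)).hom) ≫ X ◁ (ρ_ X ≪≫ (λ_ X).symm).hom ≫ (α_ X (𝟙_ C) X).inv ≫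
        (ρ_ X ≪≫ (λ_ X).symm).hom ▷ X = (α_ (𝟙_ C) X X).hom ≫ 𝟙_ C ◁ R ≫ (α_ (𝟙_ C) X X).inv := by
      simp only [Iso.trans_hom, Iso.trans_inv, Iso.symm_hom, Iso.symm_inv]
      monoidal
    exact Eq.mpr (congrArg (Gen R K (a := 2) (b := 2)) step) (.braid 0)
  | succ n ih =>
    have step : ∀ {A B E : C} (t₁ : X ⊗ A ≅ B) (t₂ : X ⊗ B ≅ E),
        ((t₂.inv ▷ X ≫ (α_ X B X).hom) ≫ X ◁ (t₁.inv ▷ X ≫ (α_ X A X).hom)) ≫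
          ((α_ X X (A ⊗ X)).inv ≫ R ▷ (A ⊗ X) ≫ (α_ X X (A ⊗ X)).hom) ≫
            X ◁ ((α_ X A X).inv ≫ t₁.hom ▷ X) ≫ (α_ X B X).inv ≫ t₂.hom ▷ X =
        ((t₂.inv ≫ X ◁ t₁.inv) ≫ ((α_ X X A).inv ≫ R ▷ A ≫ (α_ X X A).hom) ≫
          X ◁ t₁.hom ≫ t₂.hom) ▷ X := by
      intro A B E t₁ t₂
      monoidal
    exact Eq.mpr (congrArg (Gen R K (a := n + 2 + 1) (b := n + 2 + 1))
      (step (tpowCons X n) (tpowCons X (n + 1)))) ih.whisk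

theorem Gen.cup_head (c : ExactPairing X X) (hc : K c) (n : ℕ) :
    Gen R K (((λ_ (tpow X n)).inv ≫ c.coevaluation' ▷ tpow X n ≫
      (α_ X X (tpow X n)).hom) ≫ (tpowConsTwo X n).hom) := by
  induction n with
  | zero =>
    have step : ∀ k : 𝟙_ C ⟶ X ⊗ X, ((λ_ (𝟙_ C)).inv ≫ k ▷ 𝟙_ C ≫
        (α_ X X (𝟙_ C)).hom) ≫ X ◁ (ρ_ X ≪≫ (λ_ X).symm).hom ≫ (α_ X (𝟙_ C) X).inv ≫
        (ρ_ X ≪≫ (λ_ X).symm).hom ▷ X = (ρ_ (𝟙_ C)).inv ≫ 𝟙_ C ◁ k ≫ (α_ (𝟙_ C) X X).inv := by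
      intro k
      simp only [Iso.trans_hom, Iso.symm_hom]
      monoidal
    exact Eq.mpr (congrArg (Gen R K (a := 0) (b := 2)) (step c.coevaluation')) (.cup c hc 0)
  | succ n ih =>
    have step : ∀ {A B E : C} (k : 𝟙_ C ⟶ X ⊗ X) (t₁ : X ⊗ A ≅ B) (t₂ : X ⊗ B ≅ E),
          ((λ_ (A ⊗ X)).inv ≫ k ▷ (A ⊗ X) ≫ (α_ X X (A ⊗ X)).hom) ≫
            X ◁ ((α_ X A X).inv ≫ t₁.hom ▷ X) ≫ (α_ X B X).inv ≫ t₂.hom ▷ X =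
        (((λ_ A).inv ≫ k ▷ A ≫ (α_ X X A).hom) ≫
          X ◁ t₁.hom ≫ t₂.hom) ▷ X := by
      intro A B E k t₁ t₂
      monoidal
    exact Eq.mpr (congrArg (Gen R K (a := n + 1) (b := n + 2 + 1))
      (step c.coevaluation' (tpowCons X n) (tpowCons X (n + 1)))) ih.whisk

theorem Gen.cap_head (c : ExactPairing X X) (hc : K c) (n : ℕ) :
    Gen R K ((tpowConsTwo X n).inv ≫ (α_ X X (tpow X n)).inv ≫ c.evaluation' ▷ tpow X n ≫
      (λ_ (tpow X n)).hom) := by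
  induction n with
  | zero =>
    have step : ∀ k : X ⊗ X ⟶ 𝟙_ C, (((ρ_ X ≪≫ (λ_ X).symm).inv ▷ X ≫ (α_ X (𝟙_ C) X).hom) ≫
        X ◁ (ρ_ X ≪≫ (λ_ X).symm).inv) ≫ (α_ X X (𝟙_ C)).inv ≫ k ▷ 𝟙_ C ≫
        (λ_ (𝟙_ C)).hom = (α_ (𝟙_ C) X X).hom ≫ 𝟙_ C ◁ k ≫ (ρ_ (𝟙_ C)).hom := by
      intro k
      simp only [Iso.trans_inv, Iso.symm_inv]
      monoidal
    exact Eq.mpr (congrArg (Gen R K (a := 2) (b := 0)) (step c.evaluation')) (.cap c hc 0)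
  | succ n ih =>
    have step : ∀ {A B E : C} (k : X ⊗ X ⟶ 𝟙_ C) (t₁ : X ⊗ A ≅ B) (t₂ : X ⊗ B ≅ E),
        ((t₂.inv ▷ X ≫ (α_ X B X).hom) ≫ X ◁ (t₁.inv ▷ X ≫ (α_ X A X).hom)) ≫
          (α_ X X (A ⊗ X)).inv ≫ k ▷ (A ⊗ X) ≫ (λ_ (A ⊗ X)).hom =
        ((t₂.inv ≫ X ◁ t₁.inv) ≫ (α_ X X A).inv ≫ k ▷ A ≫ (λ_ A).hom) ▷ X := by
      intro A B E k t₁ t₂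
      monoidal
    exact Eq.mpr (congrArg (Gen R K (a := n + 2 + 1) (b := n + 1))
      (step c.evaluation' (tpowCons X n) (tpowCons X (n + 1)))) ih.whisk

theorem selfPair_add_two_evaluation (c : ExactPairing X X) (n : ℕ) :
    (selfPair c (n + 2)).evaluation' = (tpowConsTwo X n).inv ▷ ((tpow X n ⊗ X) ⊗ X) ≫
      nest c.evaluation' (nest c.evaluation' (selfPair c n).evaluation') := by
  have step : ∀ {A B E F : C} (t₁ : X ⊗ A ≅ B) (t₂ : X ⊗ B ≅ E) (k : X ⊗ X ⟶ 𝟙_ C)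
      (s : (X ⊗ A) ⊗ (F ⊗ X) ⟶ 𝟙_ C),
      t₂.inv ▷ ((F ⊗ X) ⊗ X) ≫ nest k (t₁.inv ▷ (F ⊗ X) ≫ s) =
        (t₂.inv ≫ X ◁ t₁.inv) ▷ ((F ⊗ X) ⊗ X) ≫ nest k s := by
    intro A B E F t₁ t₂ k s
    unfold nest
    monoidal
  exact step (tpowCons X n) (tpowCons X (n + 1)) c.evaluation'
    (nest c.evaluation' (selfPair c n).evaluation')

/-- The transpose of a generator for the self-dualities of the tensor powers is a generator. -/
theorem Gen.transpose [IsIso R] (c : ExactPairing X X) (hc : Flows R c.evaluation') {a b : ℕ}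
    {f : tpow X a ⟶ tpow X b} (hf : Gen R (· = c) f) :
    Gen R (· = c) (transpose (selfPair c a) (selfPair c b) f) := by
  induction hf with
  | braid i =>
    let _ := selfPair c i
    have h := mate_eq_of_evaluation (V := (tpow X i ⊗ X) ⊗ X) (W := (tpow X i ⊗ X) ⊗ X)
      (selfPair c (i + 2)) (selfPair c (i + 2))
      (V₂ := X ⊗ (X ⊗ tpow X i)) (W₂ := X ⊗ (X ⊗ tpow X i)) (tpowConsTwo X i).symm
      (tpowConsTwo X i).symm (selfPair_add_two_evaluation c i) (selfPair_add_two_evaluation c i)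
      (braidAt R i)
    have h' := mate_pad_braid (V := tpow X i) R (mate_unique hc.nest_comp)
    exact Eq.mpr (congrArg _ (h.trans (congrArg (fun t => _ ≫ t ≫ _) h'))) (Gen.braid_head i)
  | cap d hd i =>
    subst hd
    let _ := selfPair d i
    have h := mate_eq_of_evaluation (V := (tpow X i ⊗ X) ⊗ X) (selfPair d (i + 2)) (selfPair d i)
      (V₂ := X ⊗ (X ⊗ tpow X i)) (W₂ := tpow X i) (tpowConsTwo X i).symm
      (Iso.refl _) (selfPair_add_two_evaluation d i) (by simp; rfl)
      (capAt d.evaluation' i)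
    have h' := mate_pad_cap (V := tpow X i) (X := X)
    refine Eq.mpr (congrArg _ (h.trans ?_)) (Gen.cup_head (R := R) (K := (· = d)) d rfl i)
    rw [Iso.refl_hom, Category.id_comp]
    exact congrArg (fun t => t ≫ _) h'
  | cup d hd i =>
    subst hd
    let _ := selfPair d i
    have h := mate_eq_of_evaluation (W := (tpow X i ⊗ X) ⊗ X) (selfPair d i) (selfPair d (i + 2))
      (V₂ := tpow X i) (W₂ := X ⊗ (X ⊗ tpow X i)) (Iso.refl _) (tpowConsTwo X i).symm
      (by simp; rfl) (selfPair_add_two_evaluation d i)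
      (cupAt d.coevaluation' i)
    have h' := mate_pad_cup (V := tpow X i) (X := X)
    refine Eq.mpr (congrArg _ (h.trans ?_)) (Gen.cap_head (R := R) (K := (· = d)) d rfl i)
    rw [Iso.refl_inv, Category.comp_id]
    exact congrArg (fun t => _ ≫ t) h'
  | @whisk a b f _ ih =>
    let _ := selfPair c a
    let _ := selfPair c b
    have h := mate_eq_of_evaluation (V := tpow X a ⊗ X) (W := tpow X b ⊗ X)
      (selfPair c (a + 1)) (selfPair c (b + 1))
      (V₂ := X ⊗ tpow X a) (W₂ := X ⊗ tpow X b) (tpowCons X a).symm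
      (tpowCons X b).symm rfl rfl (f ▷ X)
    have h' := mate_whiskerRight (U := X) (tpow X a) (tpow X b) X f
    exact Eq.mpr (congrArg _ (h.trans (congrArg (fun t => _ ≫ t ≫ _) h'))) ih.cons

/-- The evaluation of the self-duality of `X^{⊗ n}` is a composite of generators. -/
theorem word_selfPair_evaluation (c : ExactPairing X X) (hc : K c) (n : ℕ) :
    Word R K (· ≤ n + n) (b := 0) ((tpowAdd X n n).inv ≫ (selfPair c n).evaluation') := by
  induction n with
  | zero =>
    have : (ρ_ (𝟙_ C)).inv ≫ (ρ_ (𝟙_ C)).hom = 𝟙 (tpow X 0) := Iso.inv_hom_id _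
    exact Eq.mpr (congrArg (Word R K (· ≤ 0) (a := 0) (b := 0)) this) (.eq rfl (le_refl 0))
  | succ n ih =>
    have h₁ := (ih.cons (Q := (· ≤ n + n + 1)) (by intro a h; omega)).whisk
      (Q := (· ≤ n + 1 + (n + 1))) (by intro a h; omega)
    have h₂ : Word R K (· ≤ n + 1 + (n + 1)) (eqToHom (congrArg (tpow X)
      (show n + 1 + (n + 1) = n + n + 1 + 1 by omega))) := .eq (by omega) le_rfl
    have h₃ := (h₂.comp h₁).comp (.gen (.cap c hc 0) (by omega) (by omega))
    have step : ∀ {A B E P Q : C} (t : X ⊗ A ≅ B) (e : B ⊗ A ≅ P) (d : A ⊗ A ≅ E)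
        (w : P ⟶ Q) (v : Q ⟶ P) (t' : X ⊗ E ≅ Q) (s : A ⊗ A ⟶ 𝟙_ C) (k : X ⊗ X ⟶ 𝟙_ C)
        (w' : P ⊗ X ⟶ Q ⊗ X), w ▷ X = w' → v ≫ w = 𝟙 Q →
        (α_ X A A).inv ≫ t.hom ▷ A ≫ e.hom = X ◁ d.hom ≫ t'.hom ≫ v →
        (e.inv ▷ X ≫ (α_ B A X).hom) ≫ t.inv ▷ (A ⊗ X) ≫ nest k s =
          (w' ≫ (t'.inv ≫ X ◁ (d.inv ≫ s) ≫ (ρ_ X ≪≫ (λ_ X).symm).hom) ▷ X) ≫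
            (α_ (𝟙_ C) X X).hom ≫ 𝟙_ C ◁ k ≫ (ρ_ (𝟙_ C)).hom := by
      rintro A B E P Q t e d w v t' s k _ rfl hv h
      have h' : w ≫ t'.inv ≫ X ◁ d.inv = e.inv ≫ t.inv ▷ A ≫ (α_ X A A).hom := by
        have he : e.hom = t.inv ▷ A ≫ (α_ X A A).hom ≫ X ◁ d.hom ≫ t'.hom ≫ v := by
          rw [← h]; simp
        rw [Iso.eq_inv_comp, he]
        simp only [Category.assoc]
        rw [reassoc_of% hv]
        simp
      unfold nest
      simp only [Iso.trans_hom, Iso.symm_hom]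
      symm
      calc _ = 𝟙 _ ⊗≫ (w ≫ t'.inv ≫ X ◁ d.inv) ▷ X ⊗≫ X ◁ s ▷ X ⊗≫ k := by monoidal
        _ = _ := by rw [h']; monoidal
    refine Eq.mpr (congrArg (Word R K (· ≤ n + 1 + (n + 1)) (a := n + 1 + (n + 1)) (b := 0)) ?_) h₃
    exact step (tpowCons X n) (tpowAdd X (n + 1) n) (tpowAdd X n n) (eqToHom (congrArg (tpow X)
      (show n + 1 + n = n + n + 1 by omega))) _ (tpowCons X (n + n)) _ _ _
      (eqToHom_whiskerRight _ _) (eqToHom_trans _ _) (tpowCons_tpowAdd X n n)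

/-- The coevaluation of the self-duality of `X^{⊗ n}` is a composite of generators. -/
theorem word_selfPair_coevaluation (c : ExactPairing X X) (hc : K c) (n : ℕ) :
    Word R K (· ≤ n + n) (a := 0) ((selfPair c n).coevaluation' ≫ (tpowAdd X n n).hom) := by
  induction n with
  | zero =>
    have : (ρ_ (𝟙_ C)).inv ≫ (ρ_ (𝟙_ C)).hom = 𝟙 (tpow X 0) := Iso.inv_hom_id _
    exact Eq.mpr (congrArg (Word R K (· ≤ 0) (a := 0) (b := 0)) this) (.eq rfl (le_refl 0))
  | succ n ih =>
    have h₁ :=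
      (Word.gen (R := R) (P := (· ≤ n + 2)) (.cup c hc n) (by omega) (by omega)).tpowRight n
      (Q := (· ≤ n + 1 + (n + 1))) (by intro a h; omega)
    have h₂ : Word R K (· ≤ n + 1 + (n + 1)) (eqToHom (congrArg (tpow X)
      (show n + 2 + n = n + 1 + (n + 1) by omega))) := .eq (by omega) (by omega)
    have h₃ := ((ih.mono (Q := (· ≤ n + 1 + (n + 1))) (by intro a h; omega)).comp h₁).comp h₂
    have step : ∀ {A B P Q S : C} (t : X ⊗ A ⟶ B) (e : (A ⊗ X) ⊗ B ⟶ P) (d : A ⊗ A ≅ Q)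
        (w : S ⟶ P) (g : ((A ⊗ X) ⊗ X) ⊗ A ⟶ S) (s : 𝟙_ C ⟶ A ⊗ A) (k : 𝟙_ C ⟶ X ⊗ X),
        (α_ (A ⊗ X) X A).hom ≫ (A ⊗ X) ◁ t ≫ e = g ≫ w →
        ((s ⊗≫ (A ◁ k) ▷ A ⊗≫ 𝟙 _) ≫ (A ⊗ X) ◁ t) ≫ e =
          ((s ≫ d.hom) ≫ d.inv ≫ ((ρ_ A).inv ≫ A ◁ k ≫ (α_ A X X).inv) ▷ A ≫ g) ≫ w := by
      intro A B P Q S t e d w g s k h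
      simp only [Category.assoc]
      rw [← h]
      simp only [Iso.hom_inv_id_assoc]
      monoidal
    refine Eq.mpr (congrArg (Word R K (· ≤ n + 1 + (n + 1)) (a := 0) (b := n + 1 + (n + 1))) ?_) h₃
    exact step (tpowCons X n).hom (tpowAdd X (n + 1) (n + 1)).hom (tpowAdd X n n) _ _ _ _
      (tpowAdd_tpowCons X (n + 1) n)

end
end PowerDual

section Transport

variable {C : Type u} [Category.{v} C] [MonoidalCategory C]

/-! ### Transport of matrix coefficients along isomorphisms -/

/-- The isomorphism of coefficient coalgebras given by an isomorphism `e : V ≅ W`. -/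
def coeffMap {V W : C} (V' W' : C) [ExactPairing V V'] [ExactPairing W W'] (e : V ≅ W) :
    V' ⊗ V ⟶ W' ⊗ W := mate W' V' e.inv ⊗ₘ e.hom

theorem mate_coeffMap {V W : C} (V' W' : C) [ExactPairing V V'] [ExactPairing W W'] (e : V ≅ W) :
    mate V' W' e.hom ▷ V ≫ coeffMap V' W' e = W' ◁ e.hom := by
  rw [coeffMap, whiskerRight_comp_tensorHom, mate_hom_inv, id_tensorHom]

theorem coeffMap_eq {V W : C} (V' W' : C) [ExactPairing V V'] [ExactPairing W W'] (e : V ≅ W) :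
    coeffMap V' W' e = mate W' V' e.inv ▷ V ≫ W' ◁ e.hom := by
  rw [coeffMap, MonoidalCategory.tensorHom_def]

/-- A family of morphisms that is dinatural along `e` is compatible with `coeffMap e`. -/
theorem coeffMap_comp {V W Z : C} (V' W' : C) [ExactPairing V V'] [ExactPairing W W'] (e : V ≅ W)
    {p : V' ⊗ V ⟶ Z} {q : W' ⊗ W ⟶ Z} (h : mate V' W' e.hom ▷ V ≫ p = W' ◁ e.hom ≫ q) :
    coeffMap V' W' e ≫ q = p := by
  rw [coeffMap_eq, Category.assoc, ← h, ← comp_whiskerRight_assoc, mate_inv_hom, id_whiskerRight,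
    Category.id_comp]

theorem coeffMap_evaluation {V W : C} (V' W' : C) [ExactPairing V V'] [ExactPairing W W']
    (e : V ≅ W) : coeffMap V' W' e ≫ ε_ W W' = ε_ V V' :=
  coeffMap_comp V' W' e (mate_evaluation V' W' e.hom)

theorem coeffMap_insertCoev {V W : C} (V' W' : C) [ExactPairing V V'] [ExactPairing W W']
    (e : V ≅ W) : coeffMap V' W' e ≫ insertCoev W' W W W' =
      insertCoev V' V V V' ≫ (coeffMap V' W' e ⊗ₘ coeffMap V' W' e) := by
  refine coeffMap_comp V' W' e ?_
  have h : mate V' W' e.hom ▷ V ≫ coeffMap V' W' e = W' ◁ e.hom ≫ 𝟙 _ := by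
    rw [mate_coeffMap, Category.comp_id]
  rw [insertCoev_dinatural h, id_tensorHom_id, Category.comp_id]

/-- Dinaturality along `f` can be checked after conjugating `f` by isomorphisms. -/
theorem coeffMap_dinatural {V W T S Z : C} (V' W' T' S' : C) [ExactPairing V V']
    [ExactPairing W W'] [ExactPairing T T'] [ExactPairing S S'] (e : V ≅ T) (d : W ≅ S)
    {f : V ⟶ W} {g : T ⟶ S} (hg : g = e.inv ≫ f ≫ d.hom) {p : T' ⊗ T ⟶ Z} {q : S' ⊗ S ⟶ Z}
    (h : mate T' S' g ▷ T ≫ p = S' ◁ g ≫ q) :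
    mate V' W' f ▷ V ≫ coeffMap V' T' e ≫ p = W' ◁ f ≫ coeffMap W' S' d ≫ q := by
  have h₁ : mate V' W' f ≫ mate T' V' e.inv = mate S' W' d.inv ≫ mate T' S' g := by
    rw [← mate_comp, ← mate_comp, hg]; simp
  have h₂ : f ≫ d.hom = e.hom ≫ g := by rw [hg]; simp
  rw [coeffMap, coeffMap, whiskerRight_comp_tensorHom_assoc, whiskerLeft_comp_tensorHom_assoc, h₁,
    h₂, ← tensorHom_comp_whiskerRight_assoc, ← tensorHom_comp_whiskerLeft_assoc, h]

end Transport

section BraidedTransport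

variable {C : Type u} [Category.{v} C] [MonoidalCategory C] [BraidedCategory C]

theorem crossPairing_dinatural_left {V U W : C} (V' U' W' : C) [ExactPairing V V']
    [ExactPairing U U'] [ExactPairing W W'] {a : V ⊗ W ⟶ W ⊗ V} {b : U ⊗ W ⟶ W ⊗ U} {f : V ⟶ U}
    (h : NatExchange a b f) : (mate V' U' f ▷ V) ▷ (W' ⊗ W) ≫ crossPairing V' W' a =
      (U' ◁ f) ▷ (W' ⊗ W) ≫ crossPairing U' W' b := by
  rw [crossPairing_eq_innerPairing, crossPairing_eq_innerPairing]
  refine innerPairing_dinatural_left V' U' W ?_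
  rw [BraidedCategory.braiding_naturality_left_assoc, rotateExchange_natural h, Category.assoc]

theorem crossPairing_dinatural_right {V W U : C} (V' W' U' : C) [ExactPairing V V']
    [ExactPairing U U'] [ExactPairing W W'] {a : V ⊗ W ⟶ W ⊗ V} {b : V ⊗ U ⟶ U ⊗ V} {f : W ⟶ U}
    (h : ExchangeNat a b f) : (V' ⊗ V) ◁ (mate W' U' f ▷ W) ≫ crossPairing V' W' a =
      (V' ⊗ V) ◁ (U' ◁ f) ≫ crossPairing V' U' b := by
  rw [crossPairing_eq_innerPairing, crossPairing_eq_innerPairing]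
  refine innerPairing_dinatural_right V' U W ?_
  rw [BraidedCategory.braiding_naturality_right_assoc, rotateExchange_mate h, Category.assoc]

theorem crossPairing_coeffMap_left {V U W : C} (V' U' W' : C) [ExactPairing V V']
    [ExactPairing U U'] [ExactPairing W W'] {a : V ⊗ W ⟶ W ⊗ V} {b : U ⊗ W ⟶ W ⊗ U} (e : V ≅ U)
    (h : NatExchange a b e.hom) :
    coeffMap V' U' e ▷ (W' ⊗ W) ≫ crossPairing U' W' b = crossPairing V' W' a := by
  rw [coeffMap_eq, comp_whiskerRight, Category.assoc, ← crossPairing_dinatural_left V' U' W' h,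
    ← comp_whiskerRight_assoc, ← comp_whiskerRight, mate_inv_hom, id_whiskerRight, id_whiskerRight,
    Category.id_comp]

theorem crossPairing_coeffMap_right {V W U : C} (V' W' U' : C) [ExactPairing V V']
    [ExactPairing U U'] [ExactPairing W W'] {a : V ⊗ W ⟶ W ⊗ V} {b : V ⊗ U ⟶ U ⊗ V} (e : W ≅ U)
    (h : ExchangeNat a b e.hom) :
    (V' ⊗ V) ◁ coeffMap W' U' e ≫ crossPairing V' U' b = crossPairing V' W' a := by
  rw [coeffMap_eq, whiskerLeft_comp, Category.assoc, ← crossPairing_dinatural_right V' W' U' h,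
    ← whiskerLeft_comp_assoc, ← comp_whiskerRight, mate_inv_hom, id_whiskerRight, whiskerLeft_id,
    Category.id_comp]

end BraidedTransport

section CoeffPow

variable {C : Type u} [Category.{v} C] [MonoidalCategory C] (X D : C)

/-! ### The bialgebra `A(X)` -/

/-- `D^{⊗ n} ⊗ X^{⊗ n}` as a reducible abbreviation: the object `A_n(X)`, in the form to which
the lemmas on matrix coefficients apply syntactically. -/
abbrev coeffPow (n : ℕ) : C := dpow D n ⊗ tpow X n

theorem eqToHom_coeffPow {m n : ℕ} (h : m = n) : eqToHom (congrArg (coeffPow X D) h) =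
    (eqToHom (congrArg (dpow D) h) ⊗ₘ eqToHom (congrArg (tpow X) h)) := by
  subst h
  simp

/-- The unit of `A(X)`. -/
def coeffOne : 𝟙_ C ⟶ coeffPow X D 0 := (λ_ (𝟙_ C)).inv

variable [ExactPairing X D]

/-- The regrouping of matrix coefficients is the tensor product of the regroupings of both factors.
-/
theorem coeffMap_tpowAdd (m n : ℕ) :
    coeffMap (dpow D n ⊗ dpow D m) (dpow D (m + n)) (tpowAdd X m n) =
      ((dpowAdd D m n).hom ⊗ₘ (tpowAdd X m n).hom) := by
  rw [coeffMap, mate_tpowAdd_inv]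

variable {X D} in
/-- A family that is dinatural for the generators `Gen R K` is dinatural for all words in them. -/
theorem Word.dinat {R : X ⊗ X ⟶ X ⊗ X} {K : ExactPairing X X → Prop} {P : ℕ → Prop} {Z : C}
    (p : ∀ k, P k → (coeffPow X D k ⟶ Z))
    (hp : ∀ {a b : ℕ} {f : tpow X a ⟶ tpow X b}, Gen R K f → ∀ (ha : P a) (hb : P b),
      mate (dpow D a) (dpow D b) f ▷ tpow X a ≫ p a ha = dpow D b ◁ f ≫ p b hb)
    {a b : ℕ} {f : tpow X a ⟶ tpow X b} (hf : Word R K P f) :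
    ∃ (ha : P a) (hb : P b),
      mate (dpow D a) (dpow D b) f ▷ tpow X a ≫ p a ha = dpow D b ◁ f ≫ p b hb := by
  induction hf with
  | eq e ha =>
    subst e
    refine ⟨ha, ha, ?_⟩
    rw [eqToHom_refl, mate_id, id_whiskerRight, whiskerLeft_id]
  | gen hf ha hb => exact ⟨ha, hb, hp hf ha hb⟩
  | @comp a b d f g _ _ ihf ihg =>
    obtain ⟨ha, hb, h₁⟩ := ihf
    obtain ⟨_, hd, h₂⟩ := ihg
    refine ⟨ha, hd, ?_⟩
    rw [mate_comp (dpow D a) (dpow D b) (dpow D d), comp_whiskerRight, Category.assoc, h₁,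
      ← whisker_exchange_assoc, h₂, whiskerLeft_comp, Category.assoc]

variable [BraidedCategory C]

/-- The multiplication of `A(X)`. -/
def coeffMul (m n : ℕ) : coeffPow X D m ⊗ coeffPow X D n ⟶ coeffPow X D (m + n) :=
  crossMul (dpow D m) (tpow X m) (dpow D n) (tpow X n) ≫
    coeffMap (dpow D n ⊗ dpow D m) (dpow D (m + n)) (tpowAdd X m n)

theorem AX.mul_eq (m n : ℕ) : AX.mul X D m n = coeffMul X D m n := by
  rw [coeffMul, coeffMap_tpowAdd, AX.mul, crossMul]
  simp only [Category.assoc]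
  rfl

theorem coeffMul_assoc (l m n : ℕ) :
    coeffMul X D l m ▷ coeffPow X D n ≫ coeffMul X D (l + m) n =
      (α_ _ _ _).hom ≫ coeffPow X D l ◁ coeffMul X D m n ≫ coeffMul X D l (m + n) ≫
        eqToHom (congrArg (coeffPow X D) (Nat.add_assoc l m n).symm) := by
  have h := crossMul_assoc (dpow D l) (tpow X l) (dpow D m) (tpow X m) (dpow D n) (tpow X n)
  have h₁ := crossMul_natural (dpowAdd D l m).hom (tpowAdd X l m).hom (𝟙 (dpow D n)) (𝟙 (tpow X n))
  have h₂ := crossMul_natural (𝟙 (dpow D l)) (𝟙 (tpow X l)) (dpowAdd D m n).hom (tpowAdd X m n).hom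
  simp only [tensorHom_id, id_tensorHom, id_whiskerRight] at h₁ h₂
  rw [eqToHom_coeffPow X D (Nat.add_assoc l m n).symm]
  simp only [coeffMul, coeffMap_tpowAdd]
  rw [comp_whiskerRight, Category.assoc]
  rw [reassoc_of% h₁, whiskerLeft_comp, Category.assoc, Category.assoc, reassoc_of% h₂,
    ← reassoc_of% h]
  simp only [MonoidalCategory.tensorHom_comp_tensorHom]
  rw [tpowAdd_assoc, dpowAdd_assoc]

theorem coeffOne_mul (n : ℕ) : coeffOne X D ▷ coeffPow X D n ≫ coeffMul X D 0 n =
    (λ_ (coeffPow X D n)).hom ≫ eqToHom (congrArg (coeffPow X D) (Nat.zero_add n).symm) := by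
  have step : ∀ {P Q P₁ Q₁ : C} (p : P ⟶ P₁) (q : Q ⟶ Q₁),
      (λ_ (𝟙_ C)).inv ▷ (P ⊗ Q) ≫ crossMul (𝟙_ C) (𝟙_ C) P Q ≫
        ((ρ_ P).hom ≫ p ⊗ₘ (λ_ Q).hom ≫ q) = (λ_ (P ⊗ Q)).hom ≫ (p ⊗ₘ q) := by
    intro P Q P₁ Q₁ p q
    rw [← MonoidalCategory.tensorHom_comp_tensorHom, ← reassoc_of% (crossMul_one_left P Q)]
  rw [coeffMul, coeffMap_tpowAdd, tpowAdd_zero_left, dpowAdd_zero_left,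
    eqToHom_coeffPow X D (Nat.zero_add n).symm]
  exact step _ _

theorem coeffMul_one (n : ℕ) : coeffPow X D n ◁ coeffOne X D ≫ coeffMul X D n 0 =
    (ρ_ (coeffPow X D n)).hom := by
  rw [coeffMul, coeffMap_tpowAdd]
  exact crossMul_one_right (dpow D n) (tpow X n)

/-- The comultiplication of `A(X)`. -/
abbrev coeffComul (n : ℕ) : coeffPow X D n ⟶ coeffPow X D n ⊗ coeffPow X D n :=
  insertCoev (dpow D n) (tpow X n) (tpow X n) (dpow D n)

/-- The counit of `A(X)`. -/
abbrev coeffCounit (n : ℕ) : coeffPow X D n ⟶ 𝟙_ C := ε_ (tpow X n) (dpow D n)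

theorem coeffMul_comul (m n : ℕ) : coeffMul X D m n ≫ coeffComul X D (m + n) =
    (coeffComul X D m ⊗ₘ coeffComul X D n) ≫
      tensorμ (coeffPow X D m) (coeffPow X D m) (coeffPow X D n) (coeffPow X D n) ≫
        (coeffMul X D m n ⊗ₘ coeffMul X D m n) := by
  have h := crossMul_comul (V := tpow X m) (W := tpow X n) (dpow D m) (dpow D n)
  rw [coeffMul, ← MonoidalCategory.tensorHom_comp_tensorHom, Category.assoc,
    coeffMap_insertCoev, reassoc_of% h]

theorem coeffMul_counit (m n : ℕ) : coeffMul X D m n ≫ coeffCounit X D (m + n) =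
    (coeffCounit X D m ⊗ₘ coeffCounit X D n) ≫ (λ_ (𝟙_ C)).hom := by
  have h := coeffMap_evaluation (dpow D n ⊗ dpow D m) (dpow D (m + n)) (tpowAdd X m n)
  rw [coeffMul, Category.assoc, h, crossMul_counit (dpow D m) (dpow D n)]

end CoeffPow

section CoeffCoalg

variable {C : Type u} [Category.{v} C] [MonoidalCategory C] (X D : C) [ExactPairing X D]

theorem coeffOne_comul : coeffOne X D ≫ coeffComul X D 0 =
    (λ_ (𝟙_ C)).inv ≫ (coeffOne X D ⊗ₘ coeffOne X D) := by
  have step : (λ_ (𝟙_ C)).inv ≫ 𝟙_ C ◁ (λ_ (𝟙_ C)).inv ≫ 𝟙_ C ◁ ((λ_ (𝟙_ C)).inv ▷ 𝟙_ C) ≫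
      𝟙_ C ◁ (α_ (𝟙_ C) (𝟙_ C) (𝟙_ C)).hom ≫ (α_ (𝟙_ C) (𝟙_ C) (𝟙_ C ⊗ 𝟙_ C)).inv =
      (λ_ (𝟙_ C)).inv ≫ ((λ_ (𝟙_ C)).inv ⊗ₘ (λ_ (𝟙_ C)).inv) := by
    rw [MonoidalCategory.tensorHom_def]
    monoidal
  exact step

theorem coeffOne_counit : coeffOne X D ≫ coeffCounit X D 0 = 𝟙 _ := Iso.inv_hom_id _

end CoeffCoalg

/-! ### Spaces presented by generators and relations -/

section Presentations

variable {C : Type u} [Category.{v} C] [MonoidalCategory C] {X D : C} [ExactPairing X D]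
  {J : Type} [SmallCategory J]

/-- A presentation of the space `F` as a quotient of `A(X)`: each `F.obj j` receives morphisms `π`
from the `A_k(X)` with `le k j`, that is `k = j` for graded and `k ≤ j` for filtered spaces. They are
dinatural with respect to the generators `Gen R K`, and `F.obj j` is the universal object with this
property, also after applying a right exact functor. The graded and the filtered quotients of
the theorem are both of this form. -/
structure Presentation (D : C) [ExactPairing X D] [MonoidalCategory J] (R : X ⊗ X ⟶ X ⊗ X)
    (K : ExactPairing X X → Prop) (F : J ⥤ C) where
  le : ℕ → J → Prop
  π : ∀ {k : ℕ} {j : J}, le k j → (coeffPow X D k ⟶ F.obj j)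
  le_map : ∀ {k : ℕ} {i j : J}, le k i → (i ⟶ j) → le k j
  π_map : ∀ {k : ℕ} {i j : J} (h : le k i) (f : i ⟶ j), π h ≫ F.map f = π (le_map h f)
  le_unit : le 0 (𝟙_ J)
  le_tensor : ∀ {k l : ℕ} {i j : J}, le k i → le l j → le (k + l) (i ⊗ j)
  dinat : ∀ {a b : ℕ} {f : tpow X a ⟶ tpow X b}, Gen R K f → ∀ {j : J} (ha : le a j) (hb : le b j),
    mate (dpow D a) (dpow D b) f ▷ tpow X a ≫ π ha = dpow D b ◁ f ≫ π hb
  desc : ∀ (G : C ⥤ C) [PreservesFiniteColimits G] (j : J) {Z : C}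
    (g : ∀ k, le k j → (G.obj (coeffPow X D k) ⟶ Z)),
    (∀ {a b : ℕ} {f : tpow X a ⟶ tpow X b}, Gen R K f → ∀ (ha : le a j) (hb : le b j),
      G.map (mate (dpow D a) (dpow D b) f ▷ tpow X a) ≫ g a ha =
        G.map (dpow D b ◁ f) ≫ g b hb) →
    ∃ t : G.obj (F.obj j) ⟶ Z, ∀ k (h : le k j), G.map (π h) ≫ t = g k h
  ext : ∀ (G : C ⥤ C) [PreservesFiniteColimits G] (j : J) {Z : C} (s t : G.obj (F.obj j) ⟶ Z),
    (∀ k (h : le k j), G.map (π h) ≫ s = G.map (π h) ≫ t) → s = t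

namespace Presentation

variable [MonoidalCategory J] {R : X ⊗ X ⟶ X ⊗ X} {K : ExactPairing X X → Prop} {F : J ⥤ C}
  (P : Presentation D R K F)

theorem eqToHom_π {k l : ℕ} (e : k = l) {j : J} (h : P.le l j) :
    eqToHom (congrArg (coeffPow X D) e) ≫ P.π h = P.π (e ▸ h) := by
  subst e
  simp

/-- The projections to `F.obj j` are jointly epimorphic. -/
theorem π_hom_ext {j : J} {Z : C} {s t : F.obj j ⟶ Z}
    (H : ∀ k (h : P.le k j), P.π h ≫ s = P.π h ≫ t) : s = t :=
  P.ext (𝟭 C) j s t H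

/-- The projections are dinatural along composites of generators. -/
theorem dinat_word {Q : ℕ → Prop} {j : J} (hQ : ∀ k, Q k → P.le k j) {a b : ℕ}
    {f : tpow X a ⟶ tpow X b} (hf : Word R K Q f) (ha : P.le a j) (hb : P.le b j) :
    mate (dpow D a) (dpow D b) f ▷ tpow X a ≫ P.π ha = dpow D b ◁ f ≫ P.π hb := by
  obtain ⟨_, _, h⟩ := Word.dinat (D := D) (P := fun k => P.le k j) (fun k h => P.π h)
    (fun hf ha hb => P.dinat hf ha hb) (hf.mono hQ)
  exact h

section Descent

variable [∀ Z : C, PreservesFiniteColimits (tensorLeft Z)]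
  [∀ Z : C, PreservesFiniteColimits (tensorRight Z)]

/-- Pairs of projections are jointly epimorphic, by right exactness of the tensor product in each
variable. -/
theorem ext₂ {i j : J} {Z : C} {s t : F.obj i ⊗ F.obj j ⟶ Z}
    (H : ∀ k l (h : P.le k i) (h' : P.le l j), (P.π h ⊗ₘ P.π h') ≫ s = (P.π h ⊗ₘ P.π h') ≫ t) :
    s = t := by
  refine P.ext (tensorLeft (F.obj i)) j s t fun l h' =>
    P.ext (tensorRight (coeffPow X D l)) i _ _ fun k h => ?_
  have := H k l h h'
  rw [MonoidalCategory.tensorHom_def, Category.assoc, Category.assoc] at this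
  exact this

theorem ext₃ {i j m : J} {Z : C} {s t : (F.obj i ⊗ F.obj j) ⊗ F.obj m ⟶ Z}
    (H : ∀ k l n (h : P.le k i) (h' : P.le l j) (h'' : P.le n m),
      ((P.π h ⊗ₘ P.π h') ⊗ₘ P.π h'') ≫ s = ((P.π h ⊗ₘ P.π h') ⊗ₘ P.π h'') ≫ t) : s = t := by
  refine P.ext (tensorLeft (F.obj i ⊗ F.obj j)) m s t fun n h'' => ?_
  have key : ∀ k (h : P.le k i) l (h' : P.le l j),
      (P.π h ▷ coeffPow X D l ▷ coeffPow X D n) ≫ ((F.obj i ◁ P.π h') ▷ coeffPow X D n) ≫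
        (F.obj i ⊗ F.obj j) ◁ P.π h'' ≫ s =
      (P.π h ▷ coeffPow X D l ▷ coeffPow X D n) ≫ ((F.obj i ◁ P.π h') ▷ coeffPow X D n) ≫
        (F.obj i ⊗ F.obj j) ◁ P.π h'' ≫ t := by
    intro k h l h'
    have := H k l n h h' h''
    rw [MonoidalCategory.tensorHom_def, MonoidalCategory.tensorHom_def, comp_whiskerRight] at this
    simpa only [Category.assoc] using this
  refine P.ext (tensorLeft (F.obj i) ⋙ tensorRight (coeffPow X D n)) j _ _ fun l h' =>
    P.ext (tensorRight (coeffPow X D l) ⋙ tensorRight (coeffPow X D n)) i _ _ fun k h =>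
      key k h l h'

/-- A family of morphisms out of `A_k(X) ⊗ A_l(X)` that is dinatural in each factor descends to
the quotient. -/
theorem desc₂ {i j : J} {Z : C}
    (g : ∀ k l, P.le k i → P.le l j → (coeffPow X D k ⊗ coeffPow X D l ⟶ Z))
    (hl : ∀ {a b : ℕ} {f : tpow X a ⟶ tpow X b}, Gen R K f →
      ∀ (ha : P.le a i) (hb : P.le b i) (l : ℕ) (h : P.le l j),
        (mate (dpow D a) (dpow D b) f ▷ tpow X a) ▷ coeffPow X D l ≫ g a l ha h =
          (dpow D b ◁ f) ▷ coeffPow X D l ≫ g b l hb h)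
    (hr : ∀ {a b : ℕ} {f : tpow X a ⟶ tpow X b}, Gen R K f →
      ∀ (ha : P.le a j) (hb : P.le b j) (k : ℕ) (h : P.le k i),
        coeffPow X D k ◁ (mate (dpow D a) (dpow D b) f ▷ tpow X a) ≫ g k a h ha =
          coeffPow X D k ◁ (dpow D b ◁ f) ≫ g k b h hb) :
    ∃ t : F.obj i ⊗ F.obj j ⟶ Z,
      ∀ k l (h : P.le k i) (h' : P.le l j), (P.π h ⊗ₘ P.π h') ≫ t = g k l h h' := by
  have key : ∀ l (h' : P.le l j), ∃ t : F.obj i ⊗ coeffPow X D l ⟶ Z,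
      ∀ k (h : P.le k i), P.π h ▷ coeffPow X D l ≫ t = g k l h h' := fun l h' =>
    P.desc (tensorRight (coeffPow X D l)) i (fun k h => g k l h h')
      fun hf ha hb => hl hf ha hb l h'
  choose t ht using key
  obtain ⟨s, hs⟩ := P.desc (tensorLeft (F.obj i)) j t fun {a b f} hf ha hb => by
    refine P.ext (tensorRight (dpow D b ⊗ tpow X a)) i _ _ fun k h => ?_
    have := hr hf ha hb k h
    rw [← ht, ← ht, whisker_exchange_assoc, whisker_exchange_assoc] at this
    exact this
  refine ⟨s, fun k l h h' => ?_⟩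
  rw [MonoidalCategory.tensorHom_def, Category.assoc, ← ht l h' k h]
  exact congrArg (_ ≫ ·) (hs l h')

end Descent

section Coalgebra

theorem exists_comul (j : J) : ∃ t : F.obj j ⟶ F.obj j ⊗ F.obj j,
    ∀ k (h : P.le k j), P.π h ≫ t = coeffComul X D k ≫ (P.π h ⊗ₘ P.π h) :=
  P.desc (𝟭 C) j (fun k h => coeffComul X D k ≫ (P.π h ⊗ₘ P.π h))
    fun hf ha hb => insertCoev_dinatural (P.dinat hf ha hb)

theorem exists_counit (j : J) : ∃ t : F.obj j ⟶ 𝟙_ C,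
    ∀ k (h : P.le k j), P.π h ≫ t = coeffCounit X D k :=
  P.desc (𝟭 C) j (fun k _ => coeffCounit X D k)
    fun {a b f} _ _ _ => mate_evaluation (dpow D a) (dpow D b) f

/-- The comultiplication induced by that of `A(X)`. -/
noncomputable def comul (j : J) : F.obj j ⟶ F.obj j ⊗ F.obj j := (P.exists_comul j).choose

theorem π_comul {k : ℕ} {j : J} (h : P.le k j) :
    P.π h ≫ P.comul j = coeffComul X D k ≫ (P.π h ⊗ₘ P.π h) :=
  (P.exists_comul j).choose_spec k h

/-- The counit induced by that of `A(X)`. -/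
noncomputable def counit (j : J) : F.obj j ⟶ 𝟙_ C := (P.exists_counit j).choose

theorem π_counit {k : ℕ} {j : J} (h : P.le k j) : P.π h ≫ P.counit j = coeffCounit X D k :=
  (P.exists_counit j).choose_spec k h

/-- The coalgebra structure induced by that of `A(X)`. -/
noncomputable def coalg : Coalg F where
  comul := P.comul
  counit := P.counit
  comul_natural f := P.π_hom_ext fun k h => by
    rw [reassoc_of% (P.π_map h f), P.π_comul, reassoc_of% (P.π_comul h),
      MonoidalCategory.tensorHom_comp_tensorHom, P.π_map h f]
  counit_natural f := P.π_hom_ext fun k h => by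
    rw [reassoc_of% (P.π_map h f), P.π_counit, P.π_counit]
  comul_assoc j := P.π_hom_ext fun k h => by
    have h₁ := insertCoev_coassoc (tpow X k) (dpow D k)
    rw [reassoc_of% (P.π_comul h), reassoc_of% (P.π_comul h), tensorHom_comp_whiskerRight_assoc,
      tensorHom_comp_whiskerLeft, P.π_comul, ← whiskerRight_comp_tensorHom_assoc,
      ← whiskerLeft_comp_tensorHom, associator_naturality, reassoc_of% h₁]
  counit_comul j := P.π_hom_ext fun k h => by
    have h₁ := insertCoev_counit_left (tpow X k) (dpow D k)
    rw [reassoc_of% (P.π_comul h), tensorHom_comp_whiskerRight, P.π_counit,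
      MonoidalCategory.tensorHom_def, reassoc_of% h₁, leftUnitor_inv_naturality]
  comul_counit j := P.π_hom_ext fun k h => by
    have h₁ := insertCoev_counit_right (tpow X k) (dpow D k)
    rw [reassoc_of% (P.π_comul h), tensorHom_comp_whiskerLeft, P.π_counit,
      MonoidalCategory.tensorHom_def', reassoc_of% h₁, rightUnitor_inv_naturality]

end Coalgebra

section Algebra

variable [BraidedCategory C] [∀ Z : C, PreservesFiniteColimits (tensorLeft Z)]
  [∀ Z : C, PreservesFiniteColimits (tensorRight Z)]

/-- The multiplication of `A(X)` descends, since tensoring a generator with a power of `X` on either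
side gives a generator. -/
theorem exists_mul (i j : J) : ∃ t : F.obj i ⊗ F.obj j ⟶ F.obj (i ⊗ j),
    ∀ k l (h : P.le k i) (h' : P.le l j),
      (P.π h ⊗ₘ P.π h') ≫ t = coeffMul X D k l ≫ P.π (P.le_tensor h h') := by
  refine P.desc₂ _ (fun {a b f} hf ha hb l h => ?_) (fun {a b f} hf ha hb k h => ?_)
  · have hw := P.dinat_word (Q := fun m => P.le m (i ⊗ j)) (fun _ => id)
      (Word.tpowRight l (P := fun m => P.le m i) (fun m hm => P.le_tensor hm h)
        (.gen hf ha hb)) (P.le_tensor ha h) (P.le_tensor hb h)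
    rw [coeffMul, coeffMul, Category.assoc, Category.assoc,
      reassoc_of% (mate_crossMul_left (dpow D a) (dpow D b) (dpow D l) (tpow X l) f),
      reassoc_of% (crossMul_left (dpow D b) (dpow D l) (tpow X l) f)]
    exact congrArg (_ ≫ ·) (coeffMap_dinatural _ _ _ _ (tpowAdd X a l) (tpowAdd X b l) rfl hw)
  · have hw := P.dinat_word (Q := fun m => P.le m (i ⊗ j)) (fun _ => id)
      (Word.tpowLeft k (P := fun m => P.le m j) (fun m hm => P.le_tensor h hm)
        (.gen hf ha hb)) (P.le_tensor h ha) (P.le_tensor h hb)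
    rw [coeffMul, coeffMul, Category.assoc, Category.assoc,
      reassoc_of% (mate_crossMul_right (dpow D k) (tpow X k) (dpow D a) (dpow D b) f),
      reassoc_of% (crossMul_right (dpow D k) (tpow X k) (dpow D b) f)]
    exact congrArg (_ ≫ ·) (coeffMap_dinatural _ _ _ _ (tpowAdd X k a) (tpowAdd X k b) rfl hw)

/-- The multiplication induced by that of `A(X)`. -/
noncomputable def mul (i j : J) : F.obj i ⊗ F.obj j ⟶ F.obj (i ⊗ j) := (P.exists_mul i j).choose

theorem π_mul {k l : ℕ} {i j : J} (h : P.le k i) (h' : P.le l j) :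
    (P.π h ⊗ₘ P.π h') ≫ P.mul i j = coeffMul X D k l ≫ P.π (P.le_tensor h h') :=
  (P.exists_mul i j).choose_spec k l h h'

/-- The algebra structure induced by that of `A(X)`. -/
noncomputable def alg : Alg F where
  one := coeffOne X D ≫ P.π P.le_unit
  mul := P.mul
  mul_natural f g := P.ext₂ fun k l h h' => by
    rw [MonoidalCategory.tensorHom_comp_tensorHom_assoc, P.π_map, P.π_map, P.π_mul,
      reassoc_of% (P.π_mul h h'), P.π_map]
  mul_assoc i j m := P.ext₃ fun k l n h h' h'' => by
    rw [tensorHom_comp_whiskerRight_assoc, P.π_mul, ← whiskerRight_comp_tensorHom_assoc,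
      reassoc_of% (P.π_mul (P.le_tensor h h') h''), P.π_map, associator_naturality_assoc,
      tensorHom_comp_whiskerLeft_assoc, P.π_mul, ← whiskerLeft_comp_tensorHom_assoc, P.π_mul,
      reassoc_of% (coeffMul_assoc X D k l n), P.eqToHom_π (Nat.add_assoc k l n).symm]
  one_mul i := P.ext (tensorLeft (𝟙_ C)) i _ _ fun k h => by
    change 𝟙_ C ◁ P.π h ≫ (_ ≫ _) ▷ _ ≫ P.mul _ _ ≫ _ = 𝟙_ C ◁ P.π h ≫ _
    rw [← MonoidalCategory.tensorHom_def'_assoc, ← whiskerRight_comp_tensorHom_assoc,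
      reassoc_of% (P.π_mul P.le_unit h), P.π_map, reassoc_of% (coeffOne_mul X D k),
      P.eqToHom_π (Nat.zero_add k).symm, leftUnitor_naturality]
  mul_one i := P.ext (tensorRight (𝟙_ C)) i _ _ fun k h => by
    change P.π h ▷ 𝟙_ C ≫ _ ◁ (_ ≫ _) ≫ P.mul _ _ ≫ _ = P.π h ▷ 𝟙_ C ≫ _
    rw [← MonoidalCategory.tensorHom_def_assoc, ← whiskerLeft_comp_tensorHom_assoc,
      reassoc_of% (P.π_mul h P.le_unit), P.π_map, reassoc_of% (coeffMul_one X D k),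
      rightUnitor_naturality]

theorem isBialg : IsBialg P.coalg P.alg where
  mul_comul i j := P.ext₂ fun k l h h' => by
    change _ ≫ P.mul i j ≫ P.comul (i ⊗ j) = _ ≫ (P.comul i ⊗ₘ P.comul j) ≫ _
    rw [reassoc_of% (P.π_mul h h'), P.π_comul, MonoidalCategory.tensorHom_comp_tensorHom_assoc,
      P.π_comul, P.π_comul, reassoc_of% (coeffMul_comul X D k l),
      ← MonoidalCategory.tensorHom_comp_tensorHom_assoc, tensorμ_natural_assoc]
    change _ = _ ≫ _ ≫ _ ≫ (P.mul i j ⊗ₘ P.mul i j)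
    rw [MonoidalCategory.tensorHom_comp_tensorHom, MonoidalCategory.tensorHom_comp_tensorHom,
      P.π_mul]
  mul_counit i j := P.ext₂ fun k l h h' => by
    change _ ≫ P.mul i j ≫ P.counit (i ⊗ j) = _ ≫ (P.counit i ⊗ₘ P.counit j) ≫ _
    rw [reassoc_of% (P.π_mul h h'), P.π_counit, MonoidalCategory.tensorHom_comp_tensorHom_assoc,
      P.π_counit, P.π_counit, coeffMul_counit]
  one_comul := by
    change (_ ≫ _) ≫ P.comul _ = _ ≫ (_ ≫ _ ⊗ₘ _ ≫ _)
    rw [Category.assoc, P.π_comul, reassoc_of% (coeffOne_comul X D),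
      MonoidalCategory.tensorHom_comp_tensorHom]
  one_counit := by
    change (_ ≫ _) ≫ P.counit _ = _
    rw [Category.assoc, P.π_counit, coeffOne_counit]

end Algebra

section Pairings

variable [∀ Z : C, PreservesFiniteColimits (tensorLeft Z)]
  [∀ Z : C, PreservesFiniteColimits (tensorRight Z)]

/-- A family of pairings of the `A_k(X)` which is dinatural in both arguments. -/
structure DinatPairing (D : C) [ExactPairing X D] (R : X ⊗ X ⟶ X ⊗ X)
    (K : ExactPairing X X → Prop) where
  app : ∀ k l, coeffPow X D k ⊗ coeffPow X D l ⟶ 𝟙_ C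
  dinat_left : ∀ {a b : ℕ} {f : tpow X a ⟶ tpow X b}, Gen R K f → ∀ l,
    (mate (dpow D a) (dpow D b) f ▷ tpow X a) ▷ coeffPow X D l ≫ app a l =
      (dpow D b ◁ f) ▷ coeffPow X D l ≫ app b l
  dinat_right : ∀ {a b : ℕ} {f : tpow X a ⟶ tpow X b}, Gen R K f → ∀ k,
    coeffPow X D k ◁ (mate (dpow D a) (dpow D b) f ▷ tpow X a) ≫ app k a =
      coeffPow X D k ◁ (dpow D b ◁ f) ≫ app k b

theorem exists_pairing (p : DinatPairing D R K) (i j : J) : ∃ t : F.obj i ⊗ F.obj j ⟶ 𝟙_ C,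
    ∀ k l (h : P.le k i) (h' : P.le l j), (P.π h ⊗ₘ P.π h') ≫ t = p.app k l :=
  P.desc₂ (fun k l _ _ => p.app k l) (fun hf _ _ l _ => p.dinat_left hf l)
    (fun hf _ _ k _ => p.dinat_right hf k)

/-- The pairing induced on the quotient by a dinatural family. -/
noncomputable def pairing (p : DinatPairing D R K) : Pairing F where
  app i j := (P.exists_pairing p i j).choose
  natural f g := P.ext₂ fun k l h h' => by
    rw [MonoidalCategory.tensorHom_comp_tensorHom_assoc, P.π_map, P.π_map,
      (P.exists_pairing p _ _).choose_spec, (P.exists_pairing p _ _).choose_spec]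

theorem π_pairing (p : DinatPairing D R K) {k l : ℕ} {i j : J} (h : P.le k i) (h' : P.le l j) :
    (P.π h ⊗ₘ P.π h') ≫ (P.pairing p).app i j = p.app k l :=
  (P.exists_pairing p i j).choose_spec k l h h'

end Pairings

end Presentation

end Presentations

/-! ### The coquasitriangular structure of a presented space -/

section Nest

variable {C : Type u} [Category.{v} C] [MonoidalCategory C]

theorem tensorHom_nest {A B E G A₁ B₁ E₁ G₁ : C} (f : A ⟶ A₁) (g : B ⟶ B₁) (h : E ⟶ E₁)
    (k : G ⟶ G₁) (a : A₁ ⊗ G₁ ⟶ 𝟙_ C) (b : B₁ ⊗ E₁ ⟶ 𝟙_ C) :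
    ((f ⊗ₘ g) ⊗ₘ (h ⊗ₘ k)) ≫ nest a b = nest ((f ⊗ₘ k) ≫ a) ((g ⊗ₘ h) ≫ b) := by
  unfold nest
  simp only [MonoidalCategory.tensorHom_def]
  calc _ = 𝟙 _ ⊗≫ f ▷ ((B ⊗ E) ⊗ G) ⊗≫ A₁ ◁ (g ▷ E ≫ B₁ ◁ h) ▷ G ⊗≫
        A₁ ◁ ((B₁ ⊗ E₁) ◁ k ≫ b ▷ G₁) ⊗≫ a := by monoidal
    _ = 𝟙 _ ⊗≫ (f ▷ ((B ⊗ E) ⊗ G) ≫ A₁ ◁ (((g ▷ E ≫ B₁ ◁ h) ≫ b) ▷ G)) ⊗≫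
        A₁ ◁ (𝟙_ C ◁ k) ⊗≫ a := by rw [whisker_exchange]; monoidal
    _ = _ := by rw [← whisker_exchange]; monoidal

end Nest

section Inverse

variable {C : Type u} [Category.{v} C] [MonoidalCategory C]

theorem NatExchange.inv_comm {A B Y : C} {a : A ⊗ Y ⟶ Y ⊗ A} {b : B ⊗ Y ⟶ Y ⊗ B} {f : A ⟶ B}
    [IsIso a] [IsIso b] (h : NatExchange a b f) : Y ◁ f ≫ inv b = inv a ≫ f ▷ Y := by
  unfold NatExchange at h
  rw [IsIso.comp_inv_eq, Category.assoc, h, IsIso.inv_hom_id_assoc]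

theorem ExchangeNat.inv_comm {V A B : C} {a : V ⊗ A ⟶ A ⊗ V} {b : V ⊗ B ⟶ B ⊗ V} {f : A ⟶ B}
    [IsIso a] [IsIso b] (h : ExchangeNat a b f) : f ▷ V ≫ inv b = inv a ≫ V ◁ f := by
  unfold ExchangeNat at h
  rw [IsIso.comp_inv_eq, Category.assoc, h, IsIso.inv_hom_id_assoc]

end Inverse

section Units

variable {C : Type u} [Category.{v} C] [MonoidalCategory C]

theorem tensorHom_comp_rightUnitor {A B E Z : C} (f : A ⟶ B) (g : B ⟶ E) (r : Z ⟶ 𝟙_ C) :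
    (f ≫ g ⊗ₘ r) ≫ (ρ_ E).hom = (f ⊗ₘ r) ≫ (ρ_ B).hom ≫ g := by
  rw [← tensorHom_comp_whiskerRight_assoc, rightUnitor_naturality]

theorem tensorHom_comp_leftUnitor {A B E Z : C} (f : A ⟶ B) (g : B ⟶ E) (r : Z ⟶ 𝟙_ C) :
    (r ⊗ₘ f ≫ g) ≫ (λ_ E).hom = (r ⊗ₘ f) ≫ (λ_ B).hom ≫ g := by
  rw [← tensorHom_comp_whiskerLeft_assoc, leftUnitor_naturality]

theorem Rpow_zero_right {X : C} (R : X ⊗ X ⟶ X ⊗ X) (m : ℕ) :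
    Rpow R m 0 = exchangeUnit (tpow X m) := by
  induction m with
  | zero => exact exchangeUnit_unit.symm
  | succ m ih => rw [Rpow_succ, ih]; exact tensorExchange_exchangeUnit (tpow X m) X

variable [BraidedCategory C]

theorem unit_crossPairing {W W' : C} (e : W' ⊗ W ⟶ 𝟙_ C) :
    (λ_ (𝟙_ C)).inv ▷ (W' ⊗ W) ≫ tensorμ (𝟙_ C) (𝟙_ C) W' W ≫ (𝟙_ C ⊗ W') ◁ unitExchange W ≫
      nest (λ_ (𝟙_ C)).hom e = (λ_ (W' ⊗ W)).hom ≫ e := by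
  rw [tensorμ_eq]
  unfold nest unitExchange
  rw [braiding_tensorUnit_left]
  monoidal

theorem crossPairing_unit {V V' : C} (e : V' ⊗ V ⟶ 𝟙_ C) :
    (V' ⊗ V) ◁ (λ_ (𝟙_ C)).inv ≫ tensorμ V' V (𝟙_ C) (𝟙_ C) ≫ (V' ⊗ 𝟙_ C) ◁ exchangeUnit V ≫
      nest e (λ_ (𝟙_ C)).hom = (ρ_ (V' ⊗ V)).hom ≫ e := by
  rw [tensorμ_eq]
  unfold nest exchangeUnit
  rw [braiding_tensorUnit_right]
  monoidal

end Units

namespace Presentation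

section Products

variable {C : Type u} [Category.{v} C] [MonoidalCategory C] {X D : C} [ExactPairing X D]
  {R : X ⊗ X ⟶ X ⊗ X} {K : ExactPairing X X → Prop} {J : Type} [SmallCategory J]
  [MonoidalCategory J] {F : J ⥤ C} (P : Presentation D R K F)

theorem π_counitPairing {k l : ℕ} {i j : J} (h : P.le k i) (h' : P.le l j) :
    (P.π h ⊗ₘ P.π h') ≫ counitPairing P.coalg i j =
      (coeffCounit X D k ⊗ₘ coeffCounit X D l) ≫ (λ_ (𝟙_ C)).hom := by
  change _ ≫ (P.counit i ⊗ₘ P.counit j) ≫ _ = _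
  rw [MonoidalCategory.tensorHom_comp_tensorHom_assoc, P.π_counit, P.π_counit]

variable [∀ Z : C, PreservesFiniteColimits (tensorLeft Z)]
  [∀ Z : C, PreservesFiniteColimits (tensorRight Z)]

theorem π_conv₂ (p q : DinatPairing D R K) {k l : ℕ} {i j : J} (h : P.le k i) (h' : P.le l j) :
    (P.π h ⊗ₘ P.π h') ≫ conv₂ P.coalg (P.pairing p) (P.pairing q) i j =
      (coeffComul X D k ⊗ₘ coeffComul X D l) ≫ nest (p.app k l) (q.app k l) := by
  change _ ≫ (P.comul i ⊗ₘ P.comul j) ≫ _ = _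
  rw [MonoidalCategory.tensorHom_comp_tensorHom_assoc, P.π_comul, P.π_comul,
    ← MonoidalCategory.tensorHom_comp_tensorHom_assoc, tensorHom_nest, P.π_pairing, P.π_pairing]

theorem π_conv [BraidedCategory C] (p q : DinatPairing D R K) {k l : ℕ} {i j : J}
    (h : P.le k i) (h' : P.le l j) :
    (P.π h ⊗ₘ P.π h') ≫ conv P.coalg (P.pairing p) (P.pairing q) i j =
      (coeffComul X D k ⊗ₘ coeffComul X D l) ≫
        tensorμ (coeffPow X D k) (coeffPow X D k) (coeffPow X D l) (coeffPow X D l) ≫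
          (p.app k l ⊗ₘ q.app k l) ≫ (λ_ (𝟙_ C)).hom := by
  change _ ≫ (P.comul i ⊗ₘ P.comul j) ≫ _ = _
  rw [MonoidalCategory.tensorHom_comp_tensorHom_assoc, P.π_comul, P.π_comul,
    ← MonoidalCategory.tensorHom_comp_tensorHom_assoc, tensorμ_natural_assoc,
    MonoidalCategory.tensorHom_comp_tensorHom_assoc, P.π_pairing, P.π_pairing]

variable [BraidedCategory C]

/-- The algebra structure induced by that of `A(X)` formed with the inverse braiding. -/
noncomputable def algBar : Alg F :=
  @Presentation.alg C _ _ X D _ J _ _ R K F P (reverseBraiding C) _ _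

/-- The opposite of the multiplication `algBar`, computed on representatives: it is the
multiplication of `A(X)` followed by the braiding on powers of `X` and by the inverse braiding on
powers of `D`. -/
theorem π_opMul [BraidedCategory J] {k l : ℕ} {i j : J} (h : P.le k i) (h' : P.le l j)
    (h'' : P.le (l + k) (i ⊗ j)) :
    (P.π h ⊗ₘ P.π h') ≫ opMul P.algBar i j =
      (crossMul (dpow D k) (tpow X k) (dpow D l) (tpow X l) ≫
        ((β_ (dpow D k) (dpow D l)).inv ⊗ₘ (β_ (tpow X k) (tpow X l)).hom)) ≫
          coeffMap (dpow D k ⊗ dpow D l) (dpow D (l + k)) (tpowAdd X l k) ≫ P.π h'' := by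
  have h₁ := @π_mul C _ _ X D _ J _ _ R K F P (reverseBraiding C) _ _ l k j i h' h
  have h₂ : @coeffMul C _ _ X D _ (reverseBraiding C) l k =
    @crossMul C _ _ (reverseBraiding C) (dpow D l) (tpow X l) (dpow D k) (tpow X k) ≫
      coeffMap (dpow D k ⊗ dpow D l) (dpow D (l + k)) (tpowAdd X l k) := rfl
  have h₃ := braiding_crossMul_reverse (dpow D k) (tpow X k) (dpow D l) (tpow X l)
  rw [opMul, BraidedCategory.braiding_naturality_assoc]
  change _ ≫ _ ≫ @mul C _ _ X D _ J _ _ R K F P (reverseBraiding C) _ _ j i ≫ _ = _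
  rw [reassoc_of% h₁, P.π_map, h₂, Category.assoc, reassoc_of% h₃, Category.assoc]

end Products

variable {C : Type u} [Category.{v} C] [MonoidalCategory C] [BraidedCategory C] {X : C} (D : C)
  [ExactPairing X D] {R : X ⊗ X ⟶ X ⊗ X} [IsIso R] {K : ExactPairing X X → Prop}

/-- The pairing `ρ` as a dinatural family. -/
def dinatPairing (hR : BraidEq R) (hK : ∀ c, K c → Flows R c.evaluation') :
    DinatPairing D R K where
  app k l := crossPairing (dpow D k) (dpow D l) (Rpow R k l)
  dinat_left {a b _} hf l :=
    crossPairing_dinatural_left (dpow D a) (dpow D b) (dpow D l) (hf.natExchange hR hK l)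
  dinat_right {a b _} hf k :=
    crossPairing_dinatural_right (dpow D k) (dpow D a) (dpow D b) (hf.exchangeNat hR hK k)

/-- The convolution inverse of `ρ` as a dinatural family. -/
noncomputable def dinatPairingInv (hR : BraidEq R) (hK : ∀ c, K c → Flows R c.evaluation') :
    DinatPairing D R K where
  app k l := crossMul (dpow D k) (tpow X k) (dpow D l) (tpow X l) ≫
    coeffPairing (V := tpow X k ⊗ tpow X l) (dpow D l ⊗ dpow D k)
      ((β_ (tpow X k) (tpow X l)).hom ≫ inv (Rpow R k l))
  dinat_left {a b f} hf l := by
    rw [reassoc_of% (mate_crossMul_left (dpow D a) (dpow D b) (dpow D l) (tpow X l) f),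
      reassoc_of% (crossMul_left (dpow D b) (dpow D l) (tpow X l) f)]
    refine congrArg (_ ≫ ·) (coeffPairing_dinatural _ _ ?_)
    rw [BraidedCategory.braiding_naturality_left_assoc, (hf.natExchange hR hK l).inv_comm,
      Category.assoc]
  dinat_right {a b f} hf k := by
    rw [reassoc_of% (mate_crossMul_right (dpow D k) (tpow X k) (dpow D a) (dpow D b) f),
      reassoc_of% (crossMul_right (dpow D k) (tpow X k) (dpow D b) f)]
    refine congrArg (_ ≫ ·) (coeffPairing_dinatural _ _ ?_)
    rw [BraidedCategory.braiding_naturality_right_assoc, (hf.exchangeNat hR hK k).inv_comm,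
      Category.assoc]

instance isIso_rotateExchange_Rpow [IsIso (rotate D R)] (m n : ℕ) :
    IsIso (rotateExchange (dpow D n) (Rpow R m n)) :=
  ⟨RDpow D R m n, rotateExchange_RDpow D R m n, RDpow_rotateExchange D R m n⟩

/-- The inverse of `ρ` for the second product as a dinatural family. -/
noncomputable def dinatPairingSecond [IsIso (rotate D R)] (hR : BraidEq R)
    (hK : ∀ c, K c → Flows R c.evaluation') : DinatPairing D R K where
  app k l := innerPairing (dpow D k) (tpow X l)
    (RDpow D R k l ≫ (β_ (tpow X k) (dpow D l)).inv)
  dinat_left {a b f} hf l := by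
    refine innerPairing_dinatural_left (dpow D a) (dpow D b) (tpow X l) ?_
    have h := rotateExchange_natural (Y' := dpow D l) (hf.natExchange hR hK l)
    have h' : f ▷ dpow D l ≫ RDpow D R b l = RDpow D R a l ≫ dpow D l ◁ f := by
      rw [← cancel_epi (rotateExchange (dpow D l) (Rpow R a l)), ← reassoc_of% h,
        rotateExchange_RDpow,
        Category.comp_id, reassoc_of% @rotateExchange_RDpow]
    rw [reassoc_of% h', Category.assoc, BraidedCategory.braiding_inv_naturality_right]
  dinat_right {a b f} hf k := by
    refine innerPairing_dinatural_right (dpow D k) (tpow X b) (tpow X a) ?_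
    have h := rotateExchange_mate (Y' := dpow D a) (Z' := dpow D b) (hf.exchangeNat hR hK k)
    have h' : tpow X k ◁ mate (dpow D a) (dpow D b) f ≫ RDpow D R k a =
        RDpow D R k b ≫ mate (dpow D a) (dpow D b) f ▷ tpow X k := by
      rw [← cancel_epi (rotateExchange (dpow D b) (Rpow R k b)), ← reassoc_of% h,
        rotateExchange_RDpow,
        Category.comp_id, reassoc_of% @rotateExchange_RDpow]
    rw [reassoc_of% h', Category.assoc, BraidedCategory.braiding_inv_naturality_left]

variable [∀ Z : C, PreservesFiniteColimits (tensorLeft Z)]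
  [∀ Z : C, PreservesFiniteColimits (tensorRight Z)]
  {D} {J : Type} [SmallCategory J] [MonoidalCategory J] {F : J ⥤ C} (P : Presentation D R K F)

/-- Under `crossPairing_eq_coeffPairing` the convolution of pairings is the composition of
endomorphisms of `X^{⊗k} ⊗ X^{⊗l}`, so that inverse exchange morphisms give inverse pairings. -/
theorem isConvInverse (hR : BraidEq R) (hK : ∀ c, K c → Flows R c.evaluation') :
    IsConvInverse P.coalg (P.pairing (dinatPairing D hR hK))
      (P.pairing (dinatPairingInv D hR hK)) := by
  intro i j
  have h₀ : ∀ k l : ℕ, crossMul (dpow D k) (tpow X k) (dpow D l) (tpow X l) ≫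
      coeffPairing (V := tpow X k ⊗ tpow X l) (dpow D l ⊗ dpow D k) (𝟙 _) =
        (coeffCounit X D k ⊗ₘ coeffCounit X D l) ≫ (λ_ (𝟙_ C)).hom := by
    intro k l
    rw [coeffPairing, whiskerLeft_id, Category.id_comp]
    exact crossMul_counit (dpow D k) (dpow D l)
  constructor
  · refine P.ext₂ fun k l h h' => ?_
    rw [P.π_conv, P.π_counitPairing]
    dsimp only [dinatPairing, dinatPairingInv]
    rw [crossPairing_eq_coeffPairing, comul_crossMul_coeffPairing, ← h₀]
    simp
  · refine P.ext₂ fun k l h h' => ?_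
    rw [P.π_conv, P.π_counitPairing]
    dsimp only [dinatPairing, dinatPairingInv]
    rw [crossPairing_eq_coeffPairing, comul_crossMul_coeffPairing, ← h₀]
    simp

/-- Under `crossPairing_eq_innerPairing` the second product of pairings is the composition of
endomorphisms of `X^{⊗k} ⊗ D^{⊗l}`; here the rotation of `R_{X^{⊗k}, X^{⊗l}}` is inverted. -/
theorem isSecondInverse [IsIso (rotate D R)] (hR : BraidEq R)
    (hK : ∀ c, K c → Flows R c.evaluation') :
    IsSecondInverse P.coalg (P.pairing (dinatPairing D hR hK))
      (P.pairing (dinatPairingSecond D hR hK)) := by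
  intro i j
  constructor
  · refine P.ext₂ fun k l h h' => ?_
    rw [P.π_conv₂, P.π_counitPairing]
    dsimp only [dinatPairing, dinatPairingSecond]
    rw [crossPairing_eq_innerPairing, insertCoev_innerPairing (dpow D k) (dpow D l)]
    simp [RDpow_rotateExchange, innerPairing_id]
  · refine P.ext₂ fun k l h h' => ?_
    rw [P.π_conv₂, P.π_counitPairing]
    dsimp only [dinatPairing, dinatPairingSecond]
    rw [crossPairing_eq_innerPairing, insertCoev_innerPairing (dpow D k) (dpow D l)]
    simp [reassoc_of% @rotateExchange_RDpow, innerPairing_id]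

/-- The pairing is multiplicative in the first variable: this is the hexagon identity in that
variable. -/
theorem opMul_pairing [BraidedCategory J] (hR : BraidEq R) (hK : ∀ c, K c → Flows R c.evaluation')
    (i j m : J) :
    opMul P.algBar i j ▷ F.obj m ≫ (P.pairing (dinatPairing D hR hK)).app (i ⊗ j) m =
      (F.obj i ⊗ F.obj j) ◁ P.coalg.comul m ≫
        nest ((P.pairing (dinatPairing D hR hK)).app i m)
          ((P.pairing (dinatPairing D hR hK)).app j m) := by
  refine P.ext₃ fun k l n h h' h'' => ?_
  have hl : P.le (l + k) (i ⊗ j) := by rw [Nat.add_comm]; exact P.le_tensor h h'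
  have key := opMul_crossPairing (dpow D k) (dpow D l) (dpow D n) (Rpow R k n) (Rpow R l n)
  rw [tensorHom_comp_whiskerRight_assoc, P.π_opMul h h' hl]
  change _ = _ ≫ _ ◁ P.comul m ≫ _
  rw [tensorHom_comp_whiskerLeft_assoc, P.π_comul, ← whiskerLeft_comp_tensorHom_assoc,
    tensorHom_nest, P.π_pairing, P.π_pairing, ← Category.assoc (_ ≫ _) (coeffMap _ _ _) (P.π hl),
    ← whiskerRight_comp_tensorHom_assoc, P.π_pairing, comp_whiskerRight, Category.assoc]
  dsimp only [dinatPairing]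
  rw [crossPairing_coeffMap_left _ _ _ (tpowAdd X l k) (Rpow_add_left R l k n)]
  exact key

/-- The pairing is multiplicative in the second variable: this is the hexagon identity in that
variable. -/
theorem pairing_mul (hR : BraidEq R) (hK : ∀ c, K c → Flows R c.evaluation') (i j m : J) :
    F.obj i ◁ P.alg.mul j m ≫ (P.pairing (dinatPairing D hR hK)).app i (j ⊗ m) =
      P.coalg.comul i ▷ (F.obj j ⊗ F.obj m) ≫
        nest ((P.pairing (dinatPairing D hR hK)).app i m)
          ((P.pairing (dinatPairing D hR hK)).app i j) := by
  rw [← cancel_epi (α_ (F.obj i) (F.obj j) (F.obj m)).hom]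
  refine P.ext₃ fun k l n h h' h'' => ?_
  have key := crossPairing_mul (dpow D k) (dpow D l) (dpow D n) (Rpow R k l) (Rpow R k n)
  rw [associator_naturality_assoc, associator_naturality_assoc]
  refine congrArg (_ ≫ ·) ?_
  change _ ≫ _ ◁ P.mul j m ≫ _ = _ ≫ P.comul i ▷ _ ≫ _
  rw [tensorHom_comp_whiskerRight_assoc, P.π_comul, ← whiskerRight_comp_tensorHom_assoc,
    tensorHom_nest, P.π_pairing, P.π_pairing, tensorHom_comp_whiskerLeft_assoc, P.π_mul,
    ← whiskerLeft_comp_tensorHom_assoc, P.π_pairing, coeffMul, whiskerLeft_comp, Category.assoc]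
  dsimp only [dinatPairing]
  rw [crossPairing_coeffMap_right _ _ _ (tpowAdd X l n) (Rpow_add_right R k l n)]
  exact key

/-- The exchange law between the two multiplications. Its two sides are the two ways of letting
`R_{X^{⊗k}, X^{⊗l}}` act on the matrix coefficients of `X^{⊗k} ⊗ X^{⊗l}`, hence agree because the
projections are dinatural along this morphism. -/
theorem interchange [BraidedCategory J] (hR : BraidEq R)
    (hK : ∀ c, K c → Flows R c.evaluation') (i j : J) :
    (P.coalg.comul i ⊗ₘ P.coalg.comul j) ≫ tensorμ (F.obj i) (F.obj i) (F.obj j) (F.obj j) ≫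
        (opMul P.algBar i j ⊗ₘ (P.pairing (dinatPairing D hR hK)).app i j) ≫
          (ρ_ (F.obj (i ⊗ j))).hom =
      (P.coalg.comul i ⊗ₘ P.coalg.comul j) ≫ tensorμ (F.obj i) (F.obj i) (F.obj j) (F.obj j) ≫
        ((P.pairing (dinatPairing D hR hK)).app i j ⊗ₘ P.alg.mul i j) ≫
          (λ_ (F.obj (i ⊗ j))).hom := by
  refine P.ext₂ fun k l h h' => ?_
  have hl : P.le (l + k) (i ⊗ j) := by rw [Nat.add_comm]; exact P.le_tensor h h'
  have hw := P.dinat_word (j := i ⊗ j) (by rintro m rfl; exact P.le_tensor h h')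
    (word_Rpow (R := R) (K := K) k l) (P.le_tensor h h') hl
  have key := coeffMap_dinatural (dpow D l ⊗ dpow D k) (dpow D k ⊗ dpow D l) (dpow D (k + l))
    (dpow D (l + k)) (tpowAdd X k l) (tpowAdd X l k) rfl hw
  have h₁ := comul_interchange_left (dpow D k) (dpow D l) (Rpow R k l)
  have h₂ := comul_interchange_right (dpow D k) (dpow D l) (Rpow R k l)
  change _ ≫ (P.comul i ⊗ₘ P.comul j) ≫ _ =
    _ ≫ (P.comul i ⊗ₘ P.comul j) ≫ _ ≫ (_ ⊗ₘ P.mul i j) ≫ _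
  rw [MonoidalCategory.tensorHom_comp_tensorHom_assoc,
    MonoidalCategory.tensorHom_comp_tensorHom_assoc, P.π_comul, P.π_comul,
    ← MonoidalCategory.tensorHom_comp_tensorHom_assoc,
    ← MonoidalCategory.tensorHom_comp_tensorHom_assoc, tensorμ_natural_assoc, tensorμ_natural_assoc,
    MonoidalCategory.tensorHom_comp_tensorHom_assoc,
    MonoidalCategory.tensorHom_comp_tensorHom_assoc, P.π_pairing, P.π_mul, P.π_opMul h h' hl,
    tensorHom_comp_rightUnitor (_ ≫ _), coeffMul,
    Category.assoc (crossMul _ _ _ _) (coeffMap _ _ _),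
    tensorHom_comp_leftUnitor (crossMul _ _ _ _)]
  dsimp only [dinatPairing]
  rw [reassoc_of% h₁, reassoc_of% h₂, key]

theorem one_pairing (hR : BraidEq R) (hK : ∀ c, K c → Flows R c.evaluation') (j : J) :
    P.algBar.one ▷ F.obj j ≫ (P.pairing (dinatPairing D hR hK)).app (𝟙_ J) j =
      (λ_ (F.obj j)).hom ≫ P.coalg.counit j := by
  refine P.ext (tensorLeft (𝟙_ C)) j _ _ fun k h => ?_
  change 𝟙_ C ◁ P.π h ≫ (_ ≫ _) ▷ _ ≫ _ = 𝟙_ C ◁ P.π h ≫ _ ≫ P.counit j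
  rw [← MonoidalCategory.tensorHom_def'_assoc, ← whiskerRight_comp_tensorHom_assoc,
    P.π_pairing, leftUnitor_naturality_assoc, P.π_counit]
  exact unit_crossPairing (ε_ (tpow X k) (dpow D k))

theorem pairing_one (hR : BraidEq R) (hK : ∀ c, K c → Flows R c.evaluation') (i : J) :
    F.obj i ◁ P.alg.one ≫ (P.pairing (dinatPairing D hR hK)).app i (𝟙_ J) =
      (ρ_ (F.obj i)).hom ≫ P.coalg.counit i := by
  refine P.ext (tensorRight (𝟙_ C)) i _ _ fun k h => ?_
  change P.π h ▷ 𝟙_ C ≫ _ ◁ (_ ≫ _) ≫ _ = P.π h ▷ 𝟙_ C ≫ _ ≫ P.counit i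
  rw [← MonoidalCategory.tensorHom_def_assoc, ← whiskerLeft_comp_tensorHom_assoc,
    P.π_pairing, rightUnitor_naturality_assoc, P.π_counit]
  dsimp only [dinatPairing]
  rw [crossPairing, Rpow_zero_right]
  exact crossPairing_unit (ε_ (tpow X k) (dpow D k))

/-- The coquasitriangular bialgebra structure induced by that of `A(X)`. -/
noncomputable def coquasiBialg [BraidedCategory J] (hR : BraidEq R)
    (hK : ∀ c, K c → Flows R c.evaluation') :
    CoquasiBialg F where
  coalg := P.coalg
  alg := P.alg
  algBar := P.algBar
  isBialg := P.isBialg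
  isBialgBar := @Presentation.isBialg C _ _ X D _ J _ _ R K F P (reverseBraiding C) _ _
  pairing := P.pairing (dinatPairing D hR hK)
  opMul_pairing := P.opMul_pairing hR hK
  pairing_mul := P.pairing_mul hR hK
  one_pairing := P.one_pairing hR hK
  pairing_one := P.pairing_one hR hK
  invertible := ⟨_, P.isConvInverse hR hK⟩
  interchange := P.interchange hR hK

end Presentation

/-! ### The antipode of a filtered space -/

section

variable {C : Type u} [Category.{v} C] [MonoidalCategory C] (X D : C) [ExactPairing X D]

/-- The unit of `C`, as its own dual, is the tensor power of exponent `0`. -/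
theorem coeffMap_unit :
    coeffMap (V := 𝟙_ C) (W := tpow X 0) (𝟙_ C) (dpow D 0) (Iso.refl (𝟙_ C)) = 𝟙 (𝟙_ C ⊗ 𝟙_ C) := by
  have h : mate (V := tpow X 0) (W := 𝟙_ C) (dpow D 0) (𝟙_ C) (𝟙 (𝟙_ C)) = 𝟙 (𝟙_ C) := by
    have step : 𝟙 (𝟙_ C) ▷ 𝟙_ C ≫ (λ_ (𝟙_ C)).hom = 𝟙_ C ◁ 𝟙 (𝟙_ C) ≫ (ρ_ (𝟙_ C)).hom := by
      monoidal
    exact mate_unique (V := tpow X 0) (W := 𝟙_ C) (V' := dpow D 0) (W' := 𝟙_ C) step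
  have step : ∀ m : 𝟙_ C ⟶ 𝟙_ C, m = 𝟙 _ → (m ⊗ₘ 𝟙 (𝟙_ C)) = 𝟙 (𝟙_ C ⊗ 𝟙_ C) := by
    rintro _ rfl
    simp
  exact step _ h

end

namespace Presentation

variable {C : Type u} [Category.{v} C] [MonoidalCategory C] [BraidedCategory C] {X D : C}
  [ExactPairing X D] {R : X ⊗ X ⟶ X ⊗ X} [IsIso R] {c : ExactPairing X X} {F : ℕ ⥤ C}
  (P : Presentation D R (· = c) F)

/-- The antipode of the self-dual object `X^{⊗k}` exchanges the two sides of a relation and replaces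
the generator by its transpose, which is again a generator (`Gen.transpose`); so it descends. -/
theorem exists_antipode (hc : Flows R c.evaluation') (j : ℕ) : ∃ t : F.obj j ⟶ F.obj j,
    ∀ k (h : P.le k j), P.π h ≫ t = selfAntipode (dpow D k) (selfPair c k) ≫ P.π h :=
  P.desc (𝟭 C) j (fun k h => selfAntipode (dpow D k) (selfPair c k) ≫ P.π h)
    fun hf ha hb => selfAntipode_dinatural _ _ _ _ _ _ _ (P.dinat (hf.transpose c hc) hb ha)

/-- The antipode induced on a filtered space. -/
noncomputable def antipodeHom (hc : Flows R c.evaluation') : F ⟶ F where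
  app j := (P.exists_antipode hc j).choose
  naturality i j f := P.π_hom_ext fun k h => by
    rw [reassoc_of% (P.π_map h f), (P.exists_antipode hc j).choose_spec,
      reassoc_of% ((P.exists_antipode hc i).choose_spec k h), P.π_map]

theorem π_antipodeHom (hc : Flows R c.evaluation') {k j : ℕ} (h : P.le k j) :
    P.π h ≫ (P.antipodeHom hc).app j = selfAntipode (dpow D k) (selfPair c k) ≫ P.π h :=
  (P.exists_antipode hc j).choose_spec k h

variable [∀ Z : C, PreservesFiniteColimits (tensorLeft Z)]
  [∀ Z : C, PreservesFiniteColimits (tensorRight Z)]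

/-- The antipode of a filtered space. -/
noncomputable def antipode (hc : Flows R c.evaluation')
    (hle : ∀ {k n : ℕ}, P.le k n ↔ k ≤ n) : Antipode P.coalg P.alg where
  S := P.antipodeHom hc
  antipode_left n := P.π_hom_ext fun k h => by
    have h₀ : P.le 0 (n + n) := hle.2 (Nat.zero_le _)
    have hw := P.dinat_word (j := n + n)
      (fun m hm => hle.2 (hm.trans (Nat.add_le_add (hle.1 h) (hle.1 h))))
      (word_selfPair_evaluation (R := R) (K := (· = c)) c rfl k) (P.le_tensor h h) h₀
    have key := coeffMap_dinatural (dpow D k ⊗ dpow D k) (𝟙_ C) (dpow D (k + k)) (dpow D 0)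
      (tpowAdd X k k) (S := tpow X 0) (Iso.refl (𝟙_ C)) (f := (selfPair c k).evaluation')
      (by rw [Iso.refl_hom]; exact congrArg (_ ≫ ·) (Category.comp_id _).symm) hw
    have h₁ := insertCoev_selfAntipode_left (dpow D k) (selfPair c k)
    have h₂ := toSelf_evaluation (dpow D k) (selfPair c k)
    change _ ≫ P.comul n ≫ _ ≫ P.mul n n = _ ≫ P.counit n ≫ (_ ≫ _) ≫ _
    rw [reassoc_of% (P.π_comul h), tensorHom_comp_whiskerRight_assoc, P.π_antipodeHom,
      ← whiskerRight_comp_tensorHom_assoc, P.π_mul, coeffMul, Category.assoc, reassoc_of% h₁,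
      reassoc_of% (P.π_counit h), Category.assoc, P.π_map]
    rw [coeffMap_unit] at key
    have step : ∀ {A B M Q : C} (t : A ⟶ B) (u : B ⟶ 𝟙_ C) (e : A ⟶ 𝟙_ C) (m : 𝟙_ C ⊗ B ⟶ M)
        (q : M ⟶ Q) (p : 𝟙_ C ⊗ 𝟙_ C ⟶ Q), m ≫ q = 𝟙_ C ◁ u ≫ 𝟙 _ ≫ p → t ≫ u = e →
        t ≫ (λ_ B).inv ≫ m ≫ q = e ≫ (λ_ (𝟙_ C)).inv ≫ p := by
      rintro A B M Q t u _ m q p hm rfl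
      rw [hm, Category.id_comp, ← leftUnitor_inv_naturality_assoc, Category.assoc]
    exact step _ _ _ _ _ _ key h₂
  antipode_right n := P.π_hom_ext fun k h => by
    have h₀ : P.le 0 (n + n) := hle.2 (Nat.zero_le _)
    have hw := P.dinat_word (j := n + n)
      (fun m hm => hle.2 (hm.trans (Nat.add_le_add (hle.1 h) (hle.1 h))))
      (word_selfPair_coevaluation (R := R) (K := (· = c)) c rfl k) h₀ (P.le_tensor h h)
    have key := coeffMap_dinatural (𝟙_ C) (dpow D k ⊗ dpow D k) (dpow D 0) (dpow D (k + k))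
      (T := tpow X 0) (Iso.refl (𝟙_ C)) (tpowAdd X k k) (f := (selfPair c k).coevaluation')
      (Category.id_comp _).symm hw
    have h₁ := insertCoev_selfAntipode_right (dpow D k) (selfPair c k)
    have h₂ := ofSelf_evaluation (dpow D k) (selfPair c k)
    change _ ≫ P.comul n ≫ _ ≫ P.mul n n = _ ≫ P.counit n ≫ (_ ≫ _) ≫ _
    rw [reassoc_of% (P.π_comul h), tensorHom_comp_whiskerLeft_assoc, P.π_antipodeHom,
      ← whiskerLeft_comp_tensorHom_assoc, P.π_mul, coeffMul, Category.assoc, reassoc_of% h₁,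
      reassoc_of% (P.π_counit h), Category.assoc, P.π_map]
    rw [coeffMap_unit] at key
    have step : ∀ {A B M Q : C} (t : A ⟶ B) (u : B ⟶ 𝟙_ C) (e : A ⟶ 𝟙_ C) (m : B ⊗ 𝟙_ C ⟶ M)
        (q : M ⟶ Q) (p : 𝟙_ C ⊗ 𝟙_ C ⟶ Q), u ▷ 𝟙_ C ≫ 𝟙 _ ≫ p = m ≫ q → t ≫ u = e →
        t ≫ (ρ_ B).inv ≫ m ≫ q = e ≫ (λ_ (𝟙_ C)).inv ≫ p := by
      rintro A B M Q t u _ m q p hm rfl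
      rw [← hm, Category.id_comp, ← rightUnitor_inv_naturality_assoc, Category.assoc,
        unitors_inv_equal]
    exact (Category.assoc _ _ _).symm.trans
      (step _ _ _ _ _ _ key ((Category.assoc _ _ _).trans h₂))

end Presentation

/-! ### Multiples of the defining relations -/

section

variable {C : Type u} [Category.{v} C] [MonoidalCategory C]

/-- Conjugating `f` by isomorphisms `e` and `d` to `g`: the left legs of the two dinaturality
relations differ by an isomorphism that also relates the right legs. -/
theorem mate_comp_coeffMap {V W T S : C} (V' W' T' S' : C) [ExactPairing V V'] [ExactPairing W W']
    [ExactPairing T T'] [ExactPairing S S'] (e : V ≅ T) (d : W ≅ S) {f : V ⟶ W} {g : T ⟶ S}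
    (hg : g = e.inv ≫ f ≫ d.hom) :
    mate V' W' f ▷ V ≫ coeffMap V' T' e = (mate S' W' d.inv ⊗ₘ e.hom) ≫ mate T' S' g ▷ T := by
  have h₁ : mate V' W' f ≫ mate T' V' e.inv = mate S' W' d.inv ≫ mate T' S' g := by
    rw [← mate_comp, ← mate_comp, hg]; simp
  rw [coeffMap, whiskerRight_comp_tensorHom, h₁, ← tensorHom_comp_whiskerRight]

theorem comp_coeffMap {V W T S : C} (W' S' : C) [ExactPairing W W']
    [ExactPairing S S'] (e : V ≅ T) (d : W ≅ S) {f : V ⟶ W} {g : T ⟶ S}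
    (hg : g = e.inv ≫ f ≫ d.hom) :
    W' ◁ f ≫ coeffMap W' S' d = (mate S' W' d.inv ⊗ₘ e.hom) ≫ S' ◁ g := by
  have h₂ : f ≫ d.hom = e.hom ≫ g := by rw [hg]; simp
  rw [coeffMap, whiskerLeft_comp_tensorHom, h₂, ← tensorHom_comp_whiskerLeft]

variable {X : C}

/-- `1 ⊗ f` on tensor powers, with `i` factors added on the left. -/
def padLeft (i : ℕ) {a b : ℕ} (f : tpow X a ⟶ tpow X b) : tpow X (i + a) ⟶ tpow X (i + b) :=
  (tpowAdd X i a).inv ≫ tpow X i ◁ f ≫ (tpowAdd X i b).hom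

/-- `f ⊗ 1` on tensor powers, with `j` factors added on the right. -/
def padRight {a b : ℕ} (f : tpow X a ⟶ tpow X b) (j : ℕ) : tpow X (a + j) ⟶ tpow X (b + j) :=
  (tpowAdd X a j).inv ≫ f ▷ tpow X j ≫ (tpowAdd X b j).hom

/-- The morphisms from which the generators `Gen R K` arise by adding factors on both sides. -/
inductive BasicGen (R : X ⊗ X ⟶ X ⊗ X) (K : ExactPairing X X → Prop) :
    ∀ {a b : ℕ}, (tpow X a ⟶ tpow X b) → Prop
  | braid : BasicGen R K (a := 2) (b := 2) (Rtwo R)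
  | cap (c : ExactPairing X X) (hc : K c) :
      BasicGen R K (a := 2) (b := 0) ((tpowTwo X).inv ≫ c.evaluation')
  | cup (c : ExactPairing X X) (hc : K c) :
      BasicGen R K (a := 0) (b := 2) (c.coevaluation' ≫ (tpowTwo X).hom)

/-- The morphisms `1 ⊗ f ⊗ 1` for `f` in `BasicGen R K`. -/
inductive PaddedGen (R : X ⊗ X ⟶ X ⊗ X) (K : ExactPairing X X → Prop) :
    ∀ {a b : ℕ}, (tpow X a ⟶ tpow X b) → Prop
  | mk {a b : ℕ} {f : tpow X a ⟶ tpow X b} (hf : BasicGen R K f) (i j : ℕ) :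
      PaddedGen R K (padRight (padLeft i f) j)

variable {R : X ⊗ X ⟶ X ⊗ X} {K : ExactPairing X X → Prop}

theorem padRight_zero {a b : ℕ} (f : tpow X a ⟶ tpow X b) : padRight f 0 = f := by
  have step : ∀ {A B : C} (f : A ⟶ B), (ρ_ A).inv ≫ f ▷ 𝟙_ C ≫ (ρ_ B).hom = f := by
    intro A B f
    simp
  exact step f

theorem padRight_succ {a b : ℕ} (f : tpow X a ⟶ tpow X b) (j : ℕ) :
    padRight f (j + 1) = padRight f j ▷ X := by
  have step : ∀ {A B E P Q : C} (e : A ⊗ E ≅ P) (e' : B ⊗ E ≅ Q) (f : A ⟶ B),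
      (e.inv ▷ X ≫ (α_ A E X).hom) ≫ f ▷ (E ⊗ X) ≫ (α_ B E X).inv ≫ e'.hom ▷ X =
        (e.inv ≫ f ▷ E ≫ e'.hom) ▷ X := by
    intro A B E P Q e e' f
    monoidal
  exact step (tpowAdd X a j) (tpowAdd X b j) f

theorem Gen.padRight {a b : ℕ} {f : tpow X a ⟶ tpow X b} (hf : Gen R K f) (j : ℕ) :
    Gen R K (padRight f j) := by
  induction j with
  | zero => exact Eq.mpr (congrArg (Gen R K (a := a) (b := b)) (padRight_zero f)) hf
  | succ j ih =>
    exact Eq.mpr (congrArg (Gen R K (a := a + j + 1) (b := b + j + 1)) (padRight_succ f j)) ih.whisk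

theorem braidAt_zero : braidAt R 0 = Rtwo R := by
  have step : (α_ (𝟙_ C) X X).hom ≫ 𝟙_ C ◁ R ≫ (α_ (𝟙_ C) X X).inv =
      (λ_ X).hom ▷ X ≫ R ≫ (λ_ X).inv ▷ X := by monoidal
  exact step

theorem capAt_zero (c : X ⊗ X ⟶ 𝟙_ C) : capAt c 0 = (tpowTwo X).inv ≫ c := by
  have step : (α_ (𝟙_ C) X X).hom ≫ 𝟙_ C ◁ c ≫ (ρ_ (𝟙_ C)).hom = (λ_ X).hom ▷ X ≫ c := by
    monoidal
  exact step

theorem cupAt_zero (k : 𝟙_ C ⟶ X ⊗ X) : cupAt k 0 = k ≫ (tpowTwo X).hom := by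
  have step : (ρ_ (𝟙_ C)).inv ≫ 𝟙_ C ◁ k ≫ (α_ (𝟙_ C) X X).inv = k ≫ (λ_ X).inv ▷ X := by
    monoidal
  exact step

theorem BasicGen.gen {a b : ℕ} {f : tpow X a ⟶ tpow X b} (hf : BasicGen R K f) : Gen R K f := by
  cases hf with
  | braid => exact Eq.mp (congrArg (Gen R K (a := 2) (b := 2)) braidAt_zero) (.braid 0)
  | cap c hc =>
    exact Eq.mp (congrArg (Gen R K (a := 2) (b := 0)) (capAt_zero c.evaluation')) (.cap c hc 0)
  | cup c hc =>
    exact Eq.mp (congrArg (Gen R K (a := 0) (b := 2)) (cupAt_zero c.coevaluation')) (.cup c hc 0)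

theorem PaddedGen.gen {a b : ℕ} {f : tpow X a ⟶ tpow X b} (hf : PaddedGen R K f) : Gen R K f := by
  cases hf with
  | mk hf i j => exact (hf.gen.tpowLeft i).padRight j

theorem PaddedGen.whisk {a b : ℕ} {f : tpow X a ⟶ tpow X b} (hf : PaddedGen R K f) :
    PaddedGen R K (a := a + 1) (b := b + 1) (f ▷ X) := by
  cases hf with
  | @mk a b f hf i j =>
    exact Eq.mpr (congrArg (PaddedGen R K (a := i + a + j + 1) (b := i + b + j + 1))
      (padRight_succ _ j).symm) (.mk hf i (j + 1))

theorem padLeft_braid (i : ℕ) : padLeft i (Rtwo R) = braidAt R i := by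
  rw [← braidAt_zero]
  exact pad_braidAt R (tpowAdd X i 0)

theorem padLeft_cap (c : X ⊗ X ⟶ 𝟙_ C) (i : ℕ) :
    padLeft (a := 2) (b := 0) i ((tpowTwo X).inv ≫ c) = capAt c i :=
  (congrArg (padLeft (a := 2) (b := 0) i) (capAt_zero c).symm).trans
    (pad_capAt c (tpowAdd X i 0))

theorem padLeft_cup (k : 𝟙_ C ⟶ X ⊗ X) (i : ℕ) :
    padLeft (a := 0) (b := 2) i (k ≫ (tpowTwo X).hom) = cupAt k i :=
  (congrArg (padLeft (a := 0) (b := 2) i) (cupAt_zero k).symm).trans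
    (pad_cupAt k (tpowAdd X i 0))

/-- Every generator arises from a basic one by tensoring with powers of `X` on both sides. -/
theorem Gen.padded {a b : ℕ} {f : tpow X a ⟶ tpow X b} (hf : Gen R K f) : PaddedGen R K f := by
  induction hf with
  | braid i =>
    exact Eq.mpr (congrArg (PaddedGen R K (a := i + 2) (b := i + 2))
      ((padRight_zero _).trans (padLeft_braid i)).symm) (.mk .braid i 0)
  | cap c hc i =>
    exact Eq.mpr (congrArg (PaddedGen R K (a := i + 2) (b := i))
      ((padRight_zero _).trans (padLeft_cap c.evaluation' i)).symm) (.mk (.cap c hc) i 0)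
  | cup c hc i =>
    exact Eq.mpr (congrArg (PaddedGen R K (a := i) (b := i + 2))
      ((padRight_zero _).trans (padLeft_cup c.coevaluation' i)).symm) (.mk (.cup c hc) i 0)
  | whisk f _ ih => exact ih.whisk

/-- Passing from `R` to its inverse replaces generators by generators and inverses of
generators. -/
theorem Gen.of_inv {R : X ⊗ X ≅ X ⊗ X} {a b : ℕ} {f : tpow X a ⟶ tpow X b}
    (hf : Gen R.inv K f) :
    Gen R.hom K f ∨ ∃ g : tpow X b ⟶ tpow X a, Gen R.hom K g ∧ f ≫ g = 𝟙 _ ∧ g ≫ f = 𝟙 _ := by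
  induction hf with
  | braid i =>
    have step : ∀ (Z : C) {u v : X ⊗ X ⟶ X ⊗ X}, u ≫ v = 𝟙 _ →
        ((α_ Z X X).hom ≫ Z ◁ u ≫ (α_ Z X X).inv) ≫ (α_ Z X X).hom ≫ Z ◁ v ≫ (α_ Z X X).inv =
          𝟙 _ := by
      intro Z u v h
      simp only [Category.assoc, Iso.inv_hom_id_assoc]
      rw [← whiskerLeft_comp_assoc, h]
      simp
    exact .inr ⟨braidAt R.hom i, .braid i, step _ R.inv_hom_id, step _ R.hom_inv_id⟩
  | cap c hc i => exact .inl (.cap c hc i)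
  | cup c hc i => exact .inl (.cup c hc i)
  | whisk f _ ih =>
    rcases ih with ih | ⟨g, hg, h₁, h₂⟩
    · exact .inl ih.whisk
    · refine .inr ⟨_, hg.whisk, ?_, ?_⟩
      · exact (comp_whiskerRight _ _ _).symm.trans
          ((congrArg (· ▷ X) h₁).trans (id_whiskerRight _ _))
      · exact (comp_whiskerRight _ _ _).symm.trans
          ((congrArg (· ▷ X) h₂).trans (id_whiskerRight _ _))

/-- Dinaturality along a morphism follows from dinaturality along its inverse. -/
theorem dinat_of_inverse {V W Z : C} (V' W' : C) [ExactPairing V V'] [ExactPairing W W']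
    {f : V ⟶ W} {g : W ⟶ V} (h₁ : f ≫ g = 𝟙 _) (h₂ : g ≫ f = 𝟙 _) {p : V' ⊗ V ⟶ Z}
    {q : W' ⊗ W ⟶ Z} (h : mate W' V' g ▷ W ≫ q = V' ◁ g ≫ p) :
    mate V' W' f ▷ V ≫ p = W' ◁ f ≫ q := by
  have h₃ : mate V' W' f ≫ mate W' V' g = 𝟙 _ := by rw [← mate_comp, h₂, mate_id]
  calc _ = mate V' W' f ▷ V ≫ V' ◁ (f ≫ g) ≫ p := by rw [h₁]; simp
    _ = W' ◁ f ≫ (mate V' W' f ≫ mate W' V' g) ▷ W ≫ q := by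
      rw [whiskerLeft_comp, Category.assoc, ← h, ← whisker_exchange_assoc, comp_whiskerRight,
        Category.assoc]
    _ = _ := by rw [h₃]; simp

end

section

variable {C : Type u} [Category.{v} C] [MonoidalCategory C] [BraidedCategory C]

theorem AX.sandwich_comp {X D Y Z : C} {d : ℕ} (z : Y ⟶ Z) (h : Z ⟶ AX X D d) (i j : ℕ) :
    AX.sandwich (z ≫ h) i j = (AX X D i ◁ z) ▷ AX X D j ≫ AX.sandwich h i j := by
  simp only [AX.sandwich, whiskerLeft_comp, comp_whiskerRight, Category.assoc]

variable {X : C} (D : C) [ExactPairing X D]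

/-- The multiplication extended to the objects `D^{⊗ k} ⊗ X^{⊗ l}`. -/
def mixedMul (X D : C) [ExactPairing X D] (k l m n : ℕ) :
    (dpow D k ⊗ tpow X l) ⊗ (dpow D m ⊗ tpow X n) ⟶ dpow D (k + m) ⊗ tpow X (l + n) :=
  crossMul (dpow D k) (tpow X l) (dpow D m) (tpow X n) ≫
    (mate (V := tpow X (k + m)) (W := tpow X k ⊗ tpow X m) (dpow D (k + m)) (dpow D m ⊗ dpow D k)
      (tpowAdd X k m).inv ⊗ₘ (tpowAdd X l n).hom)

/-- Multiplying the two sides of the dinaturality relation of `f` by `A_j(X)` gives the two sides of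
the relation of `f ⊗ 1`, preceded in both cases by the same multiplication of mixed spaces `D^{⊗ b}
⊗ X^{⊗ a}`. The next three lemmas give the second side and the multiplication on the left. -/
theorem mate_coeffMul_left {a b : ℕ} (f : tpow X a ⟶ tpow X b) (j : ℕ) :
    (mate (dpow D a) (dpow D b) f ▷ tpow X a) ▷ coeffPow X D j ≫ coeffMul X D a j =
      mixedMul X D b a j j ≫ mate (dpow D (a + j)) (dpow D (b + j)) (padRight f j) ▷ _ := by
  rw [coeffMul, mixedMul, Category.assoc,
    reassoc_of% (mate_crossMul_left (dpow D a) (dpow D b) (dpow D j) (tpow X j) f)]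
  exact congrArg (_ ≫ ·) (mate_comp_coeffMap _ _ _ _ _ _ rfl)

theorem coeffMul_left {a b : ℕ} (f : tpow X a ⟶ tpow X b) (j : ℕ) :
    (dpow D b ◁ f) ▷ coeffPow X D j ≫ coeffMul X D b j =
      mixedMul X D b a j j ≫ _ ◁ padRight f j := by
  rw [coeffMul, mixedMul, Category.assoc,
    reassoc_of% (crossMul_left (dpow D b) (dpow D j) (tpow X j) f)]
  exact congrArg (_ ≫ ·) (comp_coeffMap _ _ _ _ rfl)

theorem mate_coeffMul_right {a b : ℕ} (f : tpow X a ⟶ tpow X b) (i : ℕ) :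
    coeffPow X D i ◁ (mate (dpow D a) (dpow D b) f ▷ tpow X a) ≫ coeffMul X D i a =
      mixedMul X D i i b a ≫ mate (dpow D (i + a)) (dpow D (i + b)) (padLeft i f) ▷ _ := by
  rw [coeffMul, mixedMul, Category.assoc,
    reassoc_of% (mate_crossMul_right (dpow D i) (tpow X i) (dpow D a) (dpow D b) f)]
  exact congrArg (_ ≫ ·) (mate_comp_coeffMap _ _ _ _ _ _ rfl)

theorem coeffMul_right {a b : ℕ} (f : tpow X a ⟶ tpow X b) (i : ℕ) :
    coeffPow X D i ◁ (dpow D b ◁ f) ≫ coeffMul X D i b =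
      mixedMul X D i i b a ≫ _ ◁ padLeft i f := by
  rw [coeffMul, mixedMul, Category.assoc,
    reassoc_of% (crossMul_right (dpow D i) (tpow X i) (dpow D b) f)]
  exact congrArg (_ ≫ ·) (comp_coeffMap _ _ _ _ rfl)

instance (k l m n : ℕ) : IsIso (mixedMul X D k l m n) := by
  have : IsIso (mate (V := tpow X (k + m)) (W := tpow X k ⊗ tpow X m) (dpow D (k + m))
      (dpow D m ⊗ dpow D k) (tpowAdd X k m).inv) := by
    rw [mate_tpowAdd_inv]; infer_instance
  unfold mixedMul
  infer_instance

/-- Multiplication by `A_i(X)` on the left and by `A_j(X)` on the right, extended to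
`D^{⊗ b} ⊗ X^{⊗ a}`. -/
def mixedSandwich (X D : C) [ExactPairing X D] (i b a j : ℕ) :
    (coeffPow X D i ⊗ (dpow D b ⊗ tpow X a)) ⊗ coeffPow X D j ⟶
      dpow D (i + b + j) ⊗ tpow X (i + a + j) :=
  mixedMul X D i i b a ▷ coeffPow X D j ≫ mixedMul X D (i + b) (i + a) j j

instance (i b a j : ℕ) : IsIso (mixedSandwich X D i b a j) := by
  unfold mixedSandwich; infer_instance

theorem AX.sandwich_eq {Z : C} {d : ℕ} (h : Z ⟶ coeffPow X D d) (i j : ℕ) :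
    AX.sandwich (D := D) h i j = (coeffPow X D i ◁ h) ▷ coeffPow X D j ≫
      coeffMul X D i d ▷ coeffPow X D j ≫ coeffMul X D (i + d) j := by
  unfold AX.sandwich
  rw [AX.mul_eq, AX.mul_eq]
  rfl

/-- Multiplying the first side of a dinaturality relation on both sides by powers gives the first
side of the relation for the padded morphism; `sandwich_whiskerLeft` treats the second side. -/
theorem sandwich_mate {a b : ℕ} (f : tpow X a ⟶ tpow X b) (i j : ℕ) :
    AX.sandwich (D := D) (mate (dpow D a) (dpow D b) f ▷ tpow X a) i j =
      mixedSandwich X D i b a j ≫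
        mate (dpow D (i + a + j)) (dpow D (i + b + j)) (padRight (padLeft i f) j) ▷ _ := by
  rw [AX.sandwich_eq, ← comp_whiskerRight_assoc, mate_coeffMul_right, comp_whiskerRight,
    Category.assoc, mate_coeffMul_left, mixedSandwich, Category.assoc]

theorem sandwich_whiskerLeft {a b : ℕ} (f : tpow X a ⟶ tpow X b) (i j : ℕ) :
    AX.sandwich (D := D) (d := b) (dpow D b ◁ f) i j =
      mixedSandwich X D i b a j ≫ _ ◁ padRight (padLeft i f) j := by
  rw [AX.sandwich_eq, ← comp_whiskerRight_assoc, coeffMul_right, comp_whiskerRight,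
    Category.assoc, coeffMul_left, mixedSandwich, Category.assoc]

/-- The two-sided multiples of a relation in `A(X)` given by dinaturality along `f` amount to
dinaturality along the morphisms `1 ⊗ f ⊗ 1`. -/
theorem sandwich_relation_iff (G : C ⥤ C) {a b : ℕ} (f : tpow X a ⟶ tpow X b) {Z : C}
    (z : Z ≅ dpow D b ⊗ tpow X a) {x : Z ⟶ AX X D a} {y : Z ⟶ AX X D b}
    (hx : x = z.hom ≫ mate (dpow D a) (dpow D b) f ▷ tpow X a) (hy : y = z.hom ≫ dpow D b ◁ f)
    (i j : ℕ) {T : C} (p : G.obj (coeffPow X D (i + a + j)) ⟶ T)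
    (q : G.obj (coeffPow X D (i + b + j)) ⟶ T) :
    G.map (AX.sandwich x i j) ≫ p = G.map (AX.sandwich y i j) ≫ q ↔
      G.map (mate (dpow D (i + a + j)) (dpow D (i + b + j)) (padRight (padLeft i f) j) ▷ _) ≫ p =
        G.map (_ ◁ padRight (padLeft i f) j) ≫ q := by
  have hx' := AX.sandwich_comp z.hom
    (show _ ⟶ AX X D a from mate (dpow D a) (dpow D b) f ▷ tpow X a) i j
  have hy' := AX.sandwich_comp z.hom (show _ ⟶ AX X D b from dpow D b ◁ f) i j
  have step : ∀ {A B E E₁ E₂ : C} (m : A ⟶ B) (n : B ⟶ E) (_ : IsIso m) (_ : IsIso n) (u : E ⟶ E₁)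
      (w : E ⟶ E₂) (p : G.obj E₁ ⟶ T) (q : G.obj E₂ ⟶ T),
      G.map (m ≫ n ≫ u) ≫ p = G.map (m ≫ n ≫ w) ≫ q ↔ G.map u ≫ p = G.map w ≫ q := by
    intro A B E E₁ E₂ m n _ _ u w p q
    simp only [Functor.map_comp, Category.assoc, cancel_epi]
  rw [sandwich_mate] at hx'
  rw [sandwich_whiskerLeft] at hy'
  have hx'' : AX.sandwich x i j = _ := (congrArg (fun t => AX.sandwich t i j) hx).trans hx'
  have hy'' : AX.sandwich y i j = _ := (congrArg (fun t => AX.sandwich t i j) hy).trans hy'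
  rw [hx'', hy'']
  refine step _ _ ?_ ?_ _ _ p q
  · infer_instance
  · exact inferInstanceAs (IsIso (mixedSandwich X D i b a j))

end

/-! ### Right exact functors and sums of images -/

section

variable {C : Type u} [Category.{v} C] [Abelian C]

open ZeroObject in
/-- A right exact functor between abelian categories is additive. -/
theorem additive_of_preservesFiniteColimits (G : C ⥤ C) [PreservesFiniteColimits G] :
    G.Additive := by
  have : G.PreservesZeroMorphisms := Functor.preservesZeroMorphisms_of_preserves_initial_object
  have := preservesBinaryBiproducts_of_preservesBinaryCoproducts G
  exact Functor.additive_of_preservesBinaryBiproducts G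

/-- A subobject is contained in another one if the projection onto the quotient by the latter
vanishes on it. -/
theorem le_of_arrow_comp_cokernel {A : C} {S T : Subobject A}
    (h : S.arrow ≫ cokernel.π T.arrow = 0) : S ≤ T :=
  Subobject.le_of_comm (Abelian.monoLift T.arrow S.arrow h) (Abelian.monoLift_comp _ _ _)

variable (G : C ⥤ C) {A Z : C} {t : G.obj A ⟶ Z}

theorem map_arrow_comp_eq_zero_of_le {S T : Subobject A} (h : S ≤ T)
    (hT : G.map T.arrow ≫ t = 0) : G.map S.arrow ≫ t = 0 := by
  rw [← Subobject.ofLE_arrow h, G.map_comp, Category.assoc, hT, comp_zero]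

variable [PreservesFiniteColimits G]

theorem map_imageSubobject_arrow_comp {Y : C} {r : Y ⟶ A} (h : G.map r ≫ t = 0) :
    G.map (imageSubobject r).arrow ≫ t = 0 := by
  rw [← cancel_epi (G.map (factorThruImageSubobject r)), ← G.map_comp_assoc,
    imageSubobject_arrow_comp, h, comp_zero]

theorem map_sup_arrow_comp {S T : Subobject A} (hS : G.map S.arrow ≫ t = 0)
    (hT : G.map T.arrow ≫ t = 0) : G.map (S ⊔ T).arrow ≫ t = 0 := by
  have := additive_of_preservesFiniteColimits G
  refine map_arrow_comp_eq_zero_of_le G (T := imageSubobject (biprod.desc S.arrow T.arrow))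
    (sup_le ?_ ?_) (map_imageSubobject_arrow_comp G ?_)
  · exact Subobject.le_of_comm (biprod.inl ≫ factorThruImageSubobject _) (by simp)
  · exact Subobject.le_of_comm (biprod.inr ≫ factorThruImageSubobject _) (by simp)
  · rw [biprod.desc_eq, G.map_add, Preadditive.add_comp, G.map_comp, G.map_comp, Category.assoc,
      Category.assoc, hS, hT, comp_zero, comp_zero, add_zero]

theorem map_bot_arrow_comp : G.map (⊥ : Subobject A).arrow ≫ t = 0 := by
  have := additive_of_preservesFiniteColimits G
  rw [Subobject.bot_arrow, G.map_zero, zero_comp]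

/-- A right exact functor preserves the quotient by a subobject. -/
theorem exists_map_cokernel_desc (S : Subobject A) (h : G.map S.arrow ≫ t = 0) :
    ∃ s : G.obj (cokernel S.arrow) ⟶ Z, G.map (cokernel.π S.arrow) ≫ s = t := by
  have := additive_of_preservesFiniteColimits G
  have hc := CokernelCofork.mapIsColimit (CokernelCofork.ofπ _ (cokernel.condition S.arrow))
    (cokernelIsCokernel S.arrow) G
  exact ⟨hc.desc (CokernelCofork.ofπ t h), hc.fac (CokernelCofork.ofπ t h) .one⟩

end

section

variable {C : Type u} [Category.{v} C] [Abelian C]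

attribute [local instance] Abelian.hasFiniteBiproducts

/-- A right exact functor preserves finite direct sums. -/
theorem exists_map_biproduct_desc (G : C ⥤ C) [PreservesFiniteColimits G] {ι : Type} [Fintype ι]
    (f : ι → C) {Z : C} (g : ∀ k, G.obj (f k) ⟶ Z) :
    ∃ t : G.obj (⨁ f) ⟶ Z, ∀ k, G.map (biproduct.ι f k) ≫ t = g k := by
  classical
  have := additive_of_preservesFiniteColimits G
  refine ⟨∑ k, G.map (biproduct.π f k) ≫ g k, fun k => ?_⟩
  rw [Preadditive.comp_sum, Finset.sum_eq_single k]
  · rw [← G.map_comp_assoc, biproduct.ι_π_self, G.map_id, Category.id_comp]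
  · intro l _ hl
    rw [← G.map_comp_assoc, biproduct.ι_π_ne _ hl.symm, G.map_zero, zero_comp]
  · intro h
    exact absurd (Finset.mem_univ _) h

theorem map_biproduct_ext (G : C ⥤ C) [PreservesFiniteColimits G] {ι : Type} [Fintype ι]
    (f : ι → C) {Z : C} {s t : G.obj (⨁ f) ⟶ Z}
    (H : ∀ k, G.map (biproduct.ι f k) ≫ s = G.map (biproduct.ι f k) ≫ t) : s = t := by
  have := additive_of_preservesFiniteColimits G
  rw [← Category.id_comp s, ← Category.id_comp t, ← G.map_id, ← biproduct.total, G.map_sum,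
    Preadditive.sum_comp, Preadditive.sum_comp]
  refine Finset.sum_congr rfl fun k _ => ?_
  rw [G.map_comp, Category.assoc, H, Category.assoc]

variable [MonoidalCategory C]

theorem exists_map_filtIncl (G : C ⥤ C) [PreservesFiniteColimits G] (X D : C) {n : ℕ} {Z : C}
    (g : ∀ k, k ≤ n → (G.obj (AX X D k) ⟶ Z)) :
    ∃ t : G.obj (filtAX X D n) ⟶ Z, ∀ k (h : k ≤ n), G.map (filtIncl X D h) ≫ t = g k h := by
  obtain ⟨t, ht⟩ := exists_map_biproduct_desc G (fun k : Fin (n + 1) => AX X D k)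
    fun k => g k (Nat.le_of_lt_succ k.2)
  exact ⟨t, fun k h => ht ⟨k, Nat.lt_succ_of_le h⟩⟩

theorem map_filtIncl_ext (G : C ⥤ C) [PreservesFiniteColimits G] {X D : C} {n : ℕ} {Z : C}
    {s t : G.obj (filtAX X D n) ⟶ Z}
    (H : ∀ k (h : k ≤ n), G.map (filtIncl X D h) ≫ s = G.map (filtIncl X D h) ≫ t) : s = t :=
  map_biproduct_ext G _ fun k => H k (Nat.le_of_lt_succ k.2)

end

/-! ### The relations as dinaturality relations -/

section

variable {C : Type u} [Category.{v} C] [MonoidalCategory C] {X : C} (D : C) [ExactPairing X D]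

/-- The two sides of the invariance relation of a pairing are, up to unitors, the two sides of the
dinaturality relation along this pairing; likewise for copairings. -/
theorem pairingCoaction_eq (c : X ⊗ X ⟶ 𝟙_ C) : pairingCoaction D c = (λ_ (tpow X 2)).inv ≫
    mate (V := tpow X 2) (W := tpow X 0) (dpow D 2) (dpow D 0) ((tpowTwo X).inv ≫ c) ▷
      tpow X 2 := by
  have step : ∀ {T P : C} (η : 𝟙_ C ⟶ T ⊗ P) (f : T ⟶ 𝟙_ C),
      η ≫ f ▷ P ≫ (λ_ P).hom = (ρ_ (𝟙_ C)).inv ≫ 𝟙_ C ◁ η ≫ 𝟙_ C ◁ (f ▷ P) ≫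
        (α_ (𝟙_ C) (𝟙_ C) P).inv ≫ (λ_ (𝟙_ C)).hom ▷ P ≫ (λ_ P).hom := by
    intro T P η f
    monoidal
  exact congrArg (fun t => (λ_ (tpow X 2)).inv ≫ t ▷ tpow X 2) (step (coev X D 2) _)

theorem pairingUnit_eq {X : C} (D : C) (c : X ⊗ X ⟶ 𝟙_ C) : pairingUnit D c = (λ_ (tpow X 2)).inv ≫
    dpow D 0 ◁ (show tpow X 2 ⟶ tpow X 0 from (tpowTwo X).inv ≫ c) := by
  have step : ∀ {T : C} (f : T ⟶ 𝟙_ C), f ≫ (λ_ (𝟙_ C)).inv = (λ_ T).inv ≫ 𝟙_ C ◁ f := by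
    intro T f
    monoidal
  exact step _

theorem copairingCoaction_eq (k : 𝟙_ C ⟶ X ⊗ X) : copairingCoaction D k = (ρ_ (dpow D 2)).inv ≫
    dpow D 2 ◁ (show tpow X 0 ⟶ tpow X 2 from k ≫ (tpowTwo X).hom) := by
  have h := coevaluation_mate (V := tpow X 0) (W := tpow X 2) (dpow D 0) (dpow D 2)
    (k ≫ (tpowTwo X).hom)
  have step : ∀ {A B : C} (η : 𝟙_ C ⟶ A ⊗ B) (m : B ⟶ 𝟙_ C) (f : 𝟙_ C ⟶ A),
      η ≫ A ◁ m = (λ_ (𝟙_ C)).inv ≫ f ▷ 𝟙_ C → η ≫ A ◁ m ≫ (ρ_ A).hom = f := by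
    intro A B η m f h
    rw [reassoc_of% h]
    monoidal
  exact congrArg (fun t => (ρ_ (dpow D 2)).inv ≫ dpow D 2 ◁ t) (step _ _ _ h)

theorem copairingUnit_eq (k : 𝟙_ C ⟶ X ⊗ X) : copairingUnit D k = (ρ_ (dpow D 2)).inv ≫
    mate (V := tpow X 0) (W := tpow X 2) (dpow D 0) (dpow D 2) (k ≫ (tpowTwo X).hom) ▷
      tpow X 0 := by
  have step : ∀ {T : C} (f : T ⟶ 𝟙_ C), f ≫ (λ_ (𝟙_ C)).inv = (ρ_ T).inv ≫ f ▷ 𝟙_ C := by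
    intro T f
    monoidal
  exact step _

end

section

variable {C : Type u} [Category.{v} C] [MonoidalCategory C] [BraidedCategory C] {X : C} (D : C)
  [ExactPairing X D] (G : C ⥤ C)

/-- Multiples of the invariance relation of a pairing, as dinaturality relations along the padded
pairing. -/
theorem map_pairingRel_comp_iff (c : X ⊗ X ⟶ 𝟙_ C) (i j : ℕ) {T : C}
    (p : G.obj (AX X D (i + 2 + j)) ⟶ T) (q : G.obj (AX X D (i + 0 + j)) ⟶ T) :
    G.map (AX.sandwich (pairingCoaction D c) i j) ≫ p =
        G.map (AX.sandwich (pairingUnit D c) i j) ≫ q ↔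
      G.map (mate (dpow D (i + 2 + j)) (dpow D (i + 0 + j))
        (padRight (padLeft (a := 2) (b := 0) i ((tpowTwo X).inv ≫ c)) j) ▷ tpow X (i + 2 + j)) ≫ p =
      G.map (dpow D (i + 0 + j) ◁
        padRight (padLeft (a := 2) (b := 0) i ((tpowTwo X).inv ≫ c)) j) ≫ q :=
  sandwich_relation_iff D G (a := 2) (b := 0) _ (λ_ (tpow X 2)).symm (pairingCoaction_eq D c)
    (pairingUnit_eq D c) i j p q

/-- Multiples of the invariance relation of the dual of a copairing, as dinaturality relations along
the padded copairing. -/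
theorem map_copairingRel_comp_iff (k : 𝟙_ C ⟶ X ⊗ X) (i j : ℕ) {T : C}
    (p : G.obj (AX X D (i + 0 + j)) ⟶ T) (q : G.obj (AX X D (i + 2 + j)) ⟶ T) :
    G.map (AX.sandwich (copairingUnit D k) i j) ≫ p =
        G.map (AX.sandwich (copairingCoaction D k) i j) ≫ q ↔
      G.map (mate (dpow D (i + 0 + j)) (dpow D (i + 2 + j))
        (padRight (padLeft (a := 0) (b := 2) i (k ≫ (tpowTwo X).hom)) j) ▷ tpow X (i + 0 + j)) ≫ p =
      G.map (dpow D (i + 2 + j) ◁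
        padRight (padLeft (a := 0) (b := 2) i (k ≫ (tpowTwo X).hom)) j) ≫ q :=
  sandwich_relation_iff D G (a := 0) (b := 2) _ (ρ_ (dpow D 2)).symm (copairingUnit_eq D k)
    (copairingCoaction_eq D k) i j p q

end

section

variable {C : Type u} [Category.{v} C] [Abelian C] [MonoidalCategory C] [BraidedCategory C]

theorem sandwich_frtRel_comp {X : C} (D : C) [ExactPairing X D] (R : X ⊗ X ⟶ X ⊗ X) (i j : ℕ) :
    AX.sandwich (frtRel D R) i j ≫ cokernel.π (frtIdeal D R (i + 2 + j)).arrow = 0 := by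
  have h : (i, j) ∈ Finset.range (i + 2 + j + 1) ×ˢ Finset.range (i + 2 + j + 1) := by
    simp; omega
  have hle := (Finset.le_sup (f := fun p : ℕ × ℕ =>
    if h : p.1 + 2 + p.2 = i + 2 + j then
      imageSubobject (AX.sandwich (frtRel D R) p.1 p.2 ≫ eqToHom (congrArg (AX X D) h))
    else ⊥) h).trans ((le_kernelSubobject_iff (frtIdeal D R (i + 2 + j)) _).2
      (cokernel.condition _))
  dsimp only at hle
  rw [dif_pos rfl, imageSubobject_le_kernelSubobject_iff, eqToHom_refl, Category.comp_id] at hle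
  exact hle

theorem map_inhomRel_comp_iff (G : C ⥤ C) [PreservesFiniteColimits G] {X D Z : C}
    (x : Z ⟶ AX X D 2) (y : Z ⟶ AX X D 0) (i j n : ℕ)
    (h : i + 2 + j ≤ n) {T : C} (t : G.obj (filtAX X D n) ⟶ T) :
    G.map (inhomRel x y i j n h) ≫ t = 0 ↔
      G.map (AX.sandwich x i j) ≫ G.map (filtIncl X D h) ≫ t =
        G.map (AX.sandwich y i j) ≫
          G.map (filtIncl X D (show i + 0 + j ≤ n by omega)) ≫ t := by
  have := additive_of_preservesFiniteColimits G
  rw [inhomRel, G.map_sub, Preadditive.sub_comp, sub_eq_zero, G.map_comp, G.map_comp,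
    Category.assoc, Category.assoc]

variable [∀ Z : C, PreservesFiniteColimits (tensorLeft Z)]
  [∀ Z : C, PreservesFiniteColimits (tensorRight Z)]

theorem AX.sandwich_sub {X D Z : C} {d : ℕ} (x y : Z ⟶ AX X D d) (i j : ℕ) :
    AX.sandwich (x - y) i j = AX.sandwich x i j - AX.sandwich y i j := by
  have := additive_of_preservesFiniteColimits (tensorLeft (AX X D i))
  have := additive_of_preservesFiniteColimits (tensorRight (AX X D j))
  have h : (AX X D i ◁ (x - y)) ▷ AX X D j =
      (AX X D i ◁ x) ▷ AX X D j - (AX X D i ◁ y) ▷ AX X D j :=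
    (congrArg (tensorRight (AX X D j)).map
      ((tensorLeft (AX X D i)).map_sub (f := x) (g := y))).trans
      ((tensorRight (AX X D j)).map_sub (f := AX X D i ◁ x) (g := AX X D i ◁ y))
  simp only [AX.sandwich, h, Preadditive.sub_comp]

variable {X : C} (D : C) [ExactPairing X D] {R : X ⊗ X ⟶ X ⊗ X} (G : C ⥤ C)
  [PreservesFiniteColimits G]

theorem map_sandwich_frtRel_comp_iff (i j : ℕ) {T : C} (t : G.obj (AX X D (i + 2 + j)) ⟶ T) :
    G.map (AX.sandwich (frtRel D R) i j) ≫ t = 0 ↔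
      G.map (mate (dpow D (i + 2 + j)) (dpow D (i + 2 + j))
        (padRight (padLeft i (Rtwo R)) j) ▷ tpow X (i + 2 + j)) ≫ t =
      G.map (dpow D (i + 2 + j) ◁ padRight (padLeft i (Rtwo R)) j) ≫ t := by
  have := additive_of_preservesFiniteColimits G
  have h : AX.sandwich (frtRel D R) i j = _ :=
    AX.sandwich_sub (X := X) (D := D) (Z := dpow D 2 ⊗ tpow X 2) (d := 2)
      (dualArrow D (Rtwo R) ▷ tpow X 2) (dpow D 2 ◁ Rtwo R) i j
  have step : ∀ {A B : C} (x y : A ⟶ B) (t : G.obj B ⟶ T),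
      G.map (x - y) ≫ t = 0 ↔ G.map x ≫ t = G.map y ≫ t := by
    intro A B x y t
    rw [G.map_sub, Preadditive.sub_comp, sub_eq_zero]
  rw [h]
  refine (step _ _ t).trans ?_
  exact sandwich_relation_iff D G (Rtwo R) (Iso.refl _) (Category.id_comp _).symm
    (Category.id_comp _).symm i j t t

/-- A morphism which is dinatural along the generators vanishes on the ideal, also when it is
defined on the image under a right exact functor. -/
theorem map_frtIdeal_arrow_comp {n : ℕ} {Z : C} (t : G.obj (coeffPow X D n) ⟶ Z)
    (ht : ∀ f : tpow X n ⟶ tpow X n, Gen R (fun _ => False) f →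
      G.map (mate (dpow D n) (dpow D n) f ▷ tpow X n) ≫ t = G.map (dpow D n ◁ f) ≫ t) :
    G.map (frtIdeal D R n).arrow ≫ t = 0 := by
  refine Finset.sup_induction (p := fun S : Subobject (AX X D n) => G.map S.arrow ≫ t = 0)
    (map_bot_arrow_comp G) (fun S hS T hT => map_sup_arrow_comp G hS hT) ?_
  rintro ⟨i, j⟩ -
  dsimp only
  by_cases h : i + 2 + j = n
  · subst h
    rw [dif_pos rfl]
    refine map_imageSubobject_arrow_comp G ?_
    rw [eqToHom_refl, Category.comp_id]
    exact (map_sandwich_frtRel_comp_iff D G i j t).2 (ht _ (PaddedGen.mk .braid i j).gen)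
  · rw [dif_neg h]
    exact map_bot_arrow_comp G

/-- The projections of `A(X)` onto the quotient by the ideal are dinatural. -/
theorem frtIdeal_dinat {n a b : ℕ} {f : tpow X a ⟶ tpow X b} (hf : Gen R (fun _ => False) f)
    (ha : a = n) (hb : b = n) :
    mate (dpow D a) (dpow D b) f ▷ tpow X a ≫ eqToHom (congrArg (coeffPow X D) ha) ≫
        cokernel.π (frtIdeal D R n).arrow =
      dpow D b ◁ f ≫ eqToHom (congrArg (coeffPow X D) hb) ≫
        cokernel.π (frtIdeal D R n).arrow := by
  cases hf.padded with
  | mk hg i j =>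
    cases hg with
    | braid =>
      subst ha
      rw [eqToHom_refl]
      exact (congrArg (_ ≫ ·) (Category.id_comp _)).trans
        (((map_sandwich_frtRel_comp_iff D (𝟭 C) i j _).1 (sandwich_frtRel_comp D R i j)).trans
          (congrArg (_ ≫ ·) (Category.id_comp _).symm))
    | cap c hc => exact hc.elim
    | cup c hc => exact hc.elim

variable {c : ExactPairing X X}

/-- The filtered form of `map_frtIdeal_arrow_comp`. -/
theorem map_filtIdeal_arrow_comp {n : ℕ} {Z : C} (t : G.obj (filtAX X D n) ⟶ Z)
    (ht : ∀ {a b : ℕ} {f : tpow X a ⟶ tpow X b}, Gen R (· = c) f → ∀ (ha : a ≤ n) (hb : b ≤ n),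
      G.map (mate (dpow D a) (dpow D b) f ▷ tpow X a) ≫ G.map (filtIncl X D ha) ≫ t =
        G.map (dpow D b ◁ f) ≫ G.map (filtIncl X D hb) ≫ t) :
    G.map (filtIdeal D R c n).arrow ≫ t = 0 := by
  refine Finset.sup_induction (p := fun S : Subobject (filtAX X D n) => G.map S.arrow ≫ t = 0)
    (map_bot_arrow_comp G) (fun S hS T hT => map_sup_arrow_comp G hS hT) ?_
  rintro ⟨i, j⟩ -
  dsimp only
  by_cases h : i + 2 + j ≤ n
  · have h₀ : i + 0 + j ≤ n := by omega
    rw [dif_pos h]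
    refine map_sup_arrow_comp G (map_imageSubobject_arrow_comp G ?_) (map_sup_arrow_comp G
      (map_imageSubobject_arrow_comp G ?_) (map_imageSubobject_arrow_comp G ?_))
    · rw [G.map_comp, Category.assoc]
      exact (map_sandwich_frtRel_comp_iff D G i j _).2 (ht (PaddedGen.mk .braid i j).gen h h)
    · exact (map_inhomRel_comp_iff G _ _ i j n h t).2 ((map_pairingRel_comp_iff D G _ i j _ _).2
        (ht (PaddedGen.mk (K := (· = c)) (.cap c rfl) i j).gen h h₀))
    · exact (map_inhomRel_comp_iff G _ _ i j n h t).2 ((map_copairingRel_comp_iff D G _ i j _ _).2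
        (ht (PaddedGen.mk (K := (· = c)) (.cup c rfl) i j).gen h₀ h)).symm
  · rw [dif_neg h]
    exact map_bot_arrow_comp G

/-- The projections of `A(X)` onto the quotient by the filtered ideal are dinatural. -/
theorem filtIdeal_dinat {n a b : ℕ} {f : tpow X a ⟶ tpow X b} (hf : Gen R (· = c) f) (ha : a ≤ n)
    (hb : b ≤ n) :
    mate (dpow D a) (dpow D b) f ▷ tpow X a ≫
        filtIncl X D ha ≫ cokernel.π (filtIdeal D R c n).arrow =
      dpow D b ◁ f ≫ filtIncl X D hb ≫ cokernel.π (filtIdeal D R c n).arrow := by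
  have key := (filtIdeal_le_iff D R c (kernelSubobject (cokernel.π (filtIdeal D R c n).arrow))).1
    ((le_kernelSubobject_iff _ _).2 (cokernel.condition _))
  simp only [imageSubobject_le_kernelSubobject_iff] at key
  cases hf.padded with
  | mk hg i j =>
    cases hg with
    | braid =>
      have h := (key i j ha).1
      rw [Category.assoc] at h
      exact (map_sandwich_frtRel_comp_iff D (𝟭 C) i j _).1 h
    | cap c' hc =>
      subst hc
      exact (map_pairingRel_comp_iff D (𝟭 C) _ i j _ _).1
        ((map_inhomRel_comp_iff (𝟭 C) _ _ i j n ha _).1 (key i j ha).2.1)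
    | cup c' hc =>
      subst hc
      exact (map_copairingRel_comp_iff D (𝟭 C) _ i j _ _).1
        ((map_inhomRel_comp_iff (𝟭 C) _ _ i j n hb _).1 (key i j hb).2.2).symm

end

/-! ### The two presentations -/

theorem deg_injective {m n : ℕ} (h : deg m = deg n) : m = n := congrArg Discrete.as h

theorem deg_eq_of_hom {i j : Deg} (f : i ⟶ j) : i = j :=
  congrArg deg (Discrete.eq_of_hom (X := Discrete.mk i.as) (Y := Discrete.mk j.as) f)

section

variable {C : Type u} [Category.{v} C] [MonoidalCategory C] {X : C} {R : X ⊗ X ⟶ X ⊗ X}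

theorem Gen.weaken {K K' : ExactPairing X X → Prop} (h : ∀ c, K c → K' c) {a b : ℕ}
    {f : tpow X a ⟶ tpow X b} (hf : Gen R K f) : Gen R K' f := by
  induction hf with
  | braid i => exact .braid i
  | cap c hc i => exact .cap c (h c hc) i
  | cup c hc i => exact .cup c (h c hc) i
  | whisk f _ ih => exact ih.whisk

end

section

variable {C : Type u} [Category.{v} C] [Abelian C] [MonoidalCategory C] [BraidedCategory C]
  {X : C} (D : C) [ExactPairing X D] (R : X ⊗ X ⟶ X ⊗ X)

/-- The projections `A_k(X) ⟶ A(X,R)_j`, nonzero only for `j = k`, which is part of the data. -/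
noncomputable def frtπ {k : ℕ} : ∀ {j : Deg}, deg k = j → (coeffPow X D k ⟶ (frtSpace D R).obj j)
  | _, rfl => frtProj D R k

theorem frtπ_eq {k n : ℕ} (h : k = n) : frtπ D R (congrArg deg h) =
    eqToHom (congrArg (coeffPow X D) h) ≫ cokernel.π (frtIdeal D R n).arrow := by
  subst h
  exact (Category.id_comp _).symm

end

section

variable {C : Type u} [Category.{v} C] [Abelian C] [MonoidalCategory C] [BraidedCategory C]
  [∀ Z : C, PreservesFiniteColimits (tensorLeft Z)]
  [∀ Z : C, PreservesFiniteColimits (tensorRight Z)]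
  {X : C} (D : C) [ExactPairing X D] (R : X ⊗ X ⟶ X ⊗ X)

/-- `A(X,R)` is presented by the generators `1 ⊗ R ⊗ 1`. -/
noncomputable def frtPresentation : Presentation D R (fun _ => False) (frtSpace D R) where
  le k j := deg k = j
  π h := frtπ D R h
  le_map h f := h.trans (deg_eq_of_hom f)
  π_map {k i j} h f := by
    subst h
    obtain rfl : deg k = j := deg_eq_of_hom f
    obtain rfl : f = 𝟙 _ := Subsingleton.elim (α := ULift (PLift _)) _ _
    exact (congrArg (_ ≫ ·) ((frtSpace D R).map_id _)).trans (Category.comp_id _)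
  le_unit := rfl
  le_tensor := by
    rintro k l _ _ rfl rfl
    rfl
  dinat {a b f} hf j ha hb := by
    subst hb
    have h := deg_injective ha
    have := frtIdeal_dinat D (R := R) hf h rfl
    rw [← frtπ_eq D R h, ← frtπ_eq D R (rfl : b = b)] at this
    exact this
  desc G _ j Z g hg := by
    obtain ⟨n, rfl⟩ : ∃ n, deg n = j := ⟨j.as, rfl⟩
    obtain ⟨s, hs⟩ := exists_map_cokernel_desc G (frtIdeal D R n) (t := g n rfl)
      (map_frtIdeal_arrow_comp D G (g n rfl) fun f hf => hg hf rfl rfl)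
    refine ⟨s, fun k h => ?_⟩
    obtain rfl := deg_injective h
    exact hs
  ext G _ j Z s t H := by
    obtain ⟨n, rfl⟩ : ∃ n, deg n = j := ⟨j.as, rfl⟩
    have h := H n rfl
    exact (cancel_epi (G.map (cokernel.π (frtIdeal D R n).arrow))).1 h

variable (c : ExactPairing X X)

/-- `A(X,R;c)` is presented by the generators `1 ⊗ g ⊗ 1`, where `g` is `R` or the pairing or
copairing of `c`. -/
noncomputable def filtPresentation : Presentation D R (· = c) (filtSpace D R c) where
  le k j := k ≤ j
  π h := filtProj D R c h
  le_map h f := h.trans (leOfHom f)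
  π_map h f := by
    have step : ∀ {A B B' Q Q' : C} (i : A ⟶ B) (i' : A ⟶ B') (m : B ⟶ B') (p : B ⟶ Q)
        (p' : B' ⟶ Q') (w : Q ⟶ Q'), i ≫ m = i' → p ≫ w = m ≫ p' → (i ≫ p) ≫ w = i' ≫ p' := by
      rintro A B B' Q Q' i _ m p p' w rfl h
      rw [Category.assoc, h, Category.assoc]
    exact step _ _ _ _ _ _ (filtIncl_map X D h (leOfHom f)) (cokernel.π_desc _ _ _)
  le_unit := le_refl 0
  le_tensor := Nat.add_le_add
  dinat hf _ ha hb := filtIdeal_dinat D hf ha hb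
  desc G _ n Z g hg := by
    obtain ⟨t, ht⟩ := exists_map_filtIncl G X D g
    obtain ⟨s, hs⟩ := exists_map_cokernel_desc G (filtIdeal D R c n) (t := t)
      (map_filtIdeal_arrow_comp D G t fun hf ha hb =>
        (congrArg (_ ≫ ·) (ht _ ha)).trans
          ((hg hf ha hb).trans (congrArg (_ ≫ ·) (ht _ hb)).symm))
    refine ⟨s, fun k h => ?_⟩
    rw [← ht k h, ← hs]
    exact (G.map_comp_assoc _ _ _)
  ext G _ n Z s t H := by
    refine (cancel_epi (G.map (cokernel.π (filtIdeal D R c n).arrow))).1 ?_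
    refine map_filtIncl_ext G fun k h => ?_
    exact (G.map_comp_assoc _ _ _).symm.trans ((H k h).trans (G.map_comp_assoc _ _ _))

end

/-! ### Comparison of the ideals -/

section

variable {C : Type u} [Category.{v} C] [Abelian C] [MonoidalCategory C]
  [∀ Z : C, PreservesFiniteColimits (tensorLeft Z)]
  [∀ Z : C, PreservesFiniteColimits (tensorRight Z)]
  {X : C} (D : C) [ExactPairing X D]

/-- The ideal defined by `R⁻¹` with one braiding lies in the ideal defined by `R` with any other:
the projection to the second quotient is dinatural along `R`, hence along `R⁻¹`. -/
theorem frtIdeal_inv_le (B B' : BraidedCategory C) (R : X ⊗ X ≅ X ⊗ X) (n : ℕ) :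
    @frtIdeal C _ _ _ B X D _ R.inv n ≤ @frtIdeal C _ _ _ B' X D _ R.hom n := by
  refine le_of_arrow_comp_cokernel (@map_frtIdeal_arrow_comp C _ _ _ B _ _ X D _ R.inv (𝟭 C) _ n _
    (cokernel.π (@frtIdeal C _ _ _ B' X D _ R.hom n).arrow) fun f hf => ?_)
  have key : ∀ {g : tpow X n ⟶ tpow X n}, Gen R.hom (fun _ => False) g →
      mate (dpow D n) (dpow D n) g ▷ tpow X n ≫
        cokernel.π (@frtIdeal C _ _ _ B' X D _ R.hom n).arrow =
      dpow D n ◁ g ≫ cokernel.π (@frtIdeal C _ _ _ B' X D _ R.hom n).arrow := by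
    intro g hg
    have := @frtIdeal_dinat C _ _ _ B' _ _ X D _ R.hom n n n g hg rfl rfl
    rw [eqToHom_refl] at this
    exact (congrArg (_ ≫ ·) (Category.id_comp _).symm).trans
      (this.trans (congrArg (_ ≫ ·) (Category.id_comp _)))
  rcases hf.of_inv with h | ⟨g, hg, h₁, h₂⟩
  · exact key h
  · exact dinat_of_inverse (dpow D n) (dpow D n) h₁ h₂ (key hg)

/-- The filtered form of `frtIdeal_inv_le`; the generators given by `C` are the same on both sides.
-/
theorem filtIdeal_inv_le (B B' : BraidedCategory C) (R : X ⊗ X ≅ X ⊗ X) (c : ExactPairing X X)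
    (n : ℕ) :
    @filtIdeal C _ _ _ B X D _ R.inv c n ≤ @filtIdeal C _ _ _ B' X D _ R.hom c n := by
  refine le_of_arrow_comp_cokernel (@map_filtIdeal_arrow_comp C _ _ _ B _ _ X D _ R.inv (𝟭 C) _ c n
    _ (cokernel.π (@filtIdeal C _ _ _ B' X D _ R.hom c n).arrow) fun {a b f} hf ha hb => ?_)
  rcases hf.of_inv with h | ⟨g, hg, h₁, h₂⟩
  · exact @filtIdeal_dinat C _ _ _ B' _ _ X D _ R.hom c n a b f h ha hb
  · exact dinat_of_inverse (dpow D a) (dpow D b) h₁ h₂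
      (@filtIdeal_dinat C _ _ _ B' _ _ X D _ R.hom c n b a g hg hb ha)

variable [B : BraidedCategory C]

theorem frtIdealBar_eq (R : X ⊗ X ≅ X ⊗ X) (n : ℕ) : frtIdealBar D R n = frtIdeal D R.hom n :=
  le_antisymm (frtIdeal_inv_le D (reverseBraiding C) B R n)
    (frtIdeal_inv_le D B (reverseBraiding C) R.symm n)

theorem filtIdealBar_eq (R : X ⊗ X ≅ X ⊗ X) (c : ExactPairing X X) (n : ℕ) :
    filtIdealBar D R c n = filtIdeal D R.hom c n :=
  le_antisymm (filtIdeal_inv_le D (reverseBraiding C) B R c n)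
    (filtIdeal_inv_le D B (reverseBraiding C) R.symm c n)

end

section

variable {C : Type u} [Category.{v} C] [Abelian C] [MonoidalCategory C] [BraidedCategory C]
  [∀ Z : C, PreservesFiniteColimits (tensorLeft Z)]
  [∀ Z : C, PreservesFiniteColimits (tensorRight Z)]
  {X : C} (D : C) [ExactPairing X D] {R : X ⊗ X ⟶ X ⊗ X}

theorem exists_frtProj_comp (c : ExactPairing X X) {k n : ℕ} (h : k ≤ n) :
    ∃ q : (frtSpace D R).obj (deg k) ⟶ (filtSpace D R c).obj n,
      frtProj D R k ≫ q = filtProj D R c h := by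
  obtain ⟨q, hq⟩ := exists_map_cokernel_desc (𝟭 C) (frtIdeal D R k) (t := filtProj D R c h)
    (map_frtIdeal_arrow_comp D (𝟭 C) (filtProj D R c h) fun f hf =>
      filtIdeal_dinat D (hf.weaken fun _ => False.elim) h h)
  exact ⟨q, hq⟩

variable [IsIso R]

theorem frtInduced (hR : BraidEq R) (hK : ∀ c : ExactPairing X X, False → Flows R c.evaluation') :
    FrtInduced ((frtPresentation D R).coquasiBialg hR hK) where
  comul n := (frtPresentation D R).π_comul (k := n) (j := deg n) rfl
  counit n := (frtPresentation D R).π_counit (k := n) (j := deg n) rfl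
  one := rfl
  mul m n := by
    rw [AX.mul_eq]
    exact (frtPresentation D R).π_mul (k := m) (l := n) (i := deg m) (j := deg n) rfl rfl
  one_bar := rfl
  mul_bar m n := by
    rw [@AX.mul_eq C _ _ X D _ (reverseBraiding C)]
    exact @Presentation.π_mul C _ _ X D _ Deg _ _ R _ _ (frtPresentation D R)
      (reverseBraiding C) _ _ m n (deg m) (deg n) rfl rfl
  pairing m n := (frtPresentation D R).π_pairing _ (k := m) (l := n) (i := deg m) (j := deg n)
    rfl rfl

theorem filtInduced (c : ExactPairing X X) (hR : BraidEq R)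
    (hK : ∀ c' : ExactPairing X X, c' = c → Flows R c'.evaluation') :
    FiltInduced ((filtPresentation D R c).coquasiBialg hR hK) where
  comul k n h := (filtPresentation D R c).π_comul (k := k) (j := n) h
  counit k n h := (filtPresentation D R c).π_counit (k := k) (j := n) h
  one := rfl
  mul k l m n h h' := by
    rw [AX.mul_eq]
    exact (filtPresentation D R c).π_mul (k := k) (l := l) (i := m) (j := n) h h'
  one_bar := rfl
  mul_bar k l m n h h' := by
    rw [@AX.mul_eq C _ _ X D _ (reverseBraiding C)]
    exact @Presentation.π_mul C _ _ X D _ ℕ _ _ R _ _ (filtPresentation D R c)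
      (reverseBraiding C) _ _ k l m n h h'
  pairing k l m n h h' := (filtPresentation D R c).π_pairing _ (k := k) (l := l) (i := m) (j := n)
    h h'

theorem filt_isCoquasiHopf (c : ExactPairing X X) (hR : BraidEq R)
    (hK : ∀ c' : ExactPairing X X, c' = c → Flows R c'.evaluation') :
    IsCoquasiHopf ((filtPresentation D R c).coquasiBialg hR hK) :=
  ⟨⟨(filtPresentation D R c).antipode (hK c rfl) Iff.rfl⟩,
    ⟨@Presentation.antipode C _ _ (reverseBraiding C) X D _ R _ c _ (filtPresentation D R c) _ _
      (hK c rfl) Iff.rfl⟩⟩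

end

end BraidedFRT

theorem mainTheorem1 {C : Type u} [Category.{v} C] [Abelian C] [MonoidalCategory C]
    [BraidedCategory C]
    [∀ Z : C, PreservesFiniteColimits (tensorLeft Z)]
    [∀ Z : C, PreservesFiniteColimits (tensorRight Z)]
    (X D : C) [ExactPairing X D] (R : X ⊗ X ≅ X ⊗ X) (hR : BraidEq R.hom)
    [IsIso (rotate D R.hom)] :
    ((∀ n : ℕ, frtIdealBar D R n = frtIdeal D R.hom n) ∧
      ∃ T : CoquasiBialg (frtSpace D R.hom), FrtInduced T ∧
        ∃ s : Pairing (frtSpace D R.hom), IsSecondInverse T.coalg T.pairing s ∧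
          ∀ m n : ℕ, (frtProj D R.hom m ⊗ₘ frtProj D R.hom n) ≫ s.app (deg m) (deg n) =
            AX.secondInverse D R.hom m n) ∧
    ∀ c : ExactPairing X X, Flows R.hom c.evaluation' →
      (∀ n : ℕ, filtIdealBar D R c n = filtIdeal D R.hom c n) ∧
      (∃ q : ∀ k n : ℕ, k ≤ n → ((frtSpace D R.hom).obj (deg k) ⟶ (filtSpace D R.hom c).obj n),
        ∀ (k n : ℕ) (h : k ≤ n), frtProj D R.hom k ≫ q k n h = filtProj D R.hom c h) ∧
      ∃ T : CoquasiBialg (filtSpace D R.hom c), FiltInduced T ∧ IsCoquasiHopf T ∧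
        ∃ s : Pairing (filtSpace D R.hom c), IsSecondInverse T.coalg T.pairing s ∧
          ∀ (k l m n : ℕ) (h : k ≤ m) (h' : l ≤ n),
            (filtProj D R.hom c h ⊗ₘ filtProj D R.hom c h') ≫ s.app m n =
              AX.secondInverse D R.hom k l := by
  have hF : ∀ c : ExactPairing X X, False → Flows R.hom c.evaluation' := fun _ => False.elim
  refine ⟨⟨frtIdealBar_eq D R, (frtPresentation D R.hom).coquasiBialg hR hF, frtInduced D hR hF,
    (frtPresentation D R.hom).pairing (Presentation.dinatPairingSecond D hR hF),
    (frtPresentation D R.hom).isSecondInverse hR hF, fun m n =>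
      (frtPresentation D R.hom).π_pairing (Presentation.dinatPairingSecond D hR hF)
        (i := deg m) (j := deg n) rfl rfl⟩, fun c hc => ?_⟩
  have hK : ∀ c' : ExactPairing X X, c' = c → Flows R.hom c'.evaluation' := by
    rintro _ rfl
    exact hc
  refine ⟨filtIdealBar_eq D R c,
    ⟨fun k n h => (exists_frtProj_comp D c h).choose, fun k n h =>
      (exists_frtProj_comp D c h).choose_spec⟩,
    (filtPresentation D R.hom c).coquasiBialg hR hK, filtInduced D c hR hK,
    filt_isCoquasiHopf D c hR hK,
    (filtPresentation D R.hom c).pairing (Presentation.dinatPairingSecond D hR hK),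
    (filtPresentation D R.hom c).isSecondInverse hR hK, fun k l m n h h' =>
      (filtPresentation D R.hom c).π_pairing (Presentation.dinatPairingSecond D hR hK)
        (i := m) (j := n) h h'⟩
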